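/- For $f_1,f_2,f_3,f_4\in L^2(\mathbb R^2;\mathbb C)$ define, with $(x_1,x_2)^\perp=(-x_2,x_1)$, $$\mathcal T(f_1,f_2,f_3)(z)=\int_{\mathbb R}\int_{\mathbb R^2} f_1(x+z)\,f_2(\lambda x^\perp+z)\,\overline{f_3(x+\lambda x^\perp+z)}\,dx\,d\lambda ,\qquad z\in\mathbb R^2,$$ $$\mathcal E(f_1,f_2,f_3,f_4)=\langle \mathcal T(f_1,f_2,f_3),f_4\rangle_{L^2}=\int_{\mathbb R^2}\mathcal T(f_1,f_2,f_3)\,\overline{f_4}\,dz .$$ Let $e^{it\Delta}$ be the free Schrödinger group on $L^2(\mathbb R^2)$, and let $e^{isH}=\sum_{n\ge 0}e^{2i(n+1)s}\,\Pi_n$ be the unitary group of the harmonic oscillator $H=-\Delta+|x|^2$ on $L^2(\mathbb R^2)$, where $\Pi_n$ is the orthogonal projection onto the eigenspace $E_n=\{u\in L^2(\mathbb R^2): Hu=2(n+1)u\}$. The double integral defining $\mathcal T(f_1,f_2,f_3)(z)$ converges absolutely for almost every $z$, $\mathcal T(f_1,f_2,f_3)\in L^2(\mathbb R^2)$, and the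 triple integral $$\mathcal E(f_1,f_2,f_3,f_4)=\int_{\mathbb R}\int_{\mathbb R^2}\int_{\mathbb R^2} f_1(x+z)f_2(\lambda x^\perp+z)\overline{f_3(x+\lambda x^\perp+z)}\,\overline{f_4(z)}\,dz\,dx\,d\lambda$$ converges absolutely. Moreover $$\mathcal E(f_1,f_2,f_3,f_4)=4\pi\int_{\mathbb R}\int_{\mathbb R^2}(e^{it\Delta}f_1)(e^{it\Delta}f_2)(\overline{e^{it\Delta}f_3})(\overline{e^{it\Delta}f_4})\,dx\,dt$$ $$\qquad=4\pi\int_{-\pi/4}^{\pi/4}\int_{\mathbb R^2}(e^{-itH}f_1)(e^{-itH}f_2)(\overline{e^{-itH}f_3})(\overline{e^{-itH}f_4})\,dx\,dt ,$$ where both iterated integrals converge absolutely. Consequently, in $L^2(\mathbb R^2)$, $$\mathcal T(f_1,f_2,f_3)=4\pi\int_{\mathbb R}e^{-it\Delta}\Big[(e^{it\Delta}f_1)(e^{it\Delta}f_2)(\overline{e^{it\Delta}f_3})\Big]dt =4\pi\int_{-\pi/4}^{\pi/4}e^{itH}\Big[(e^{-itH}f_1)(e^{-itH}f_2)(\overline{e^{-itH}f_3})\Big]dt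 ,$$ where for almost every $t$ the products in brackets belong to $L^2(\mathbb R^2)$ and the time integrals are absolutely convergent (Bochner) integrals in $L^2(\mathbb R^2)$. -/

import Mathlib

open MeasureTheory Complex SchwartzMap
open scoped FourierTransform Laplacian ComplexConjugate ENNReal InnerProductSpace

/-- The plane `ℝ²` with its Euclidean structure and Lebesgue measure. -/
abbrev Plane : Type := EuclideanSpace ℝ (Fin 2)

/-- The complex Hilbert space `L²(ℝ²)`. -/
abbrev L2 : Type := Lp (α := Plane) ℂ 2 volume

namespace CR

/-- The rotation by `π / 2`: `(x₁, x₂)^⊥ = (-x₂, x₁)`. -/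
noncomputable def perp (x : Plane) : Plane := !₂[-x 1, x 0]

open Classical in
/-- The class in `L²(ℝ²)` of a square-integrable function (and `0` for other functions). -/
noncomputable def toL2 (g : Plane → ℂ) : L2 :=
  if h : MemLp g 2 volume then h.toLp g else 0

/-! ### The trilinear operator and the associated quadrilinear form -/

/-- The integrand `f₁(x + z) f₂(λ x^⊥ + z) conj f₃(x + λ x^⊥ + z)` of the trilinear operator. -/
noncomputable def integrandT (f₁ f₂ f₃ : Plane → ℂ) (lam : ℝ) (x z : Plane) : ℂ :=
  f₁ (x + z) * f₂ (lam • perp x + z) * conj (f₃ (x + lam • perp x + z))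

/-- `𝓣(f₁, f₂, f₃)(z) = ∫_ℝ ∫_{ℝ²} f₁(x + z) f₂(λ x^⊥ + z) conj f₃(x + λ x^⊥ + z) dx dλ`. -/
noncomputable def T (f₁ f₂ f₃ : Plane → ℂ) (z : Plane) : ℂ :=
  ∫ lam : ℝ, ∫ x : Plane, integrandT f₁ f₂ f₃ lam x z

/-- `𝓔(f₁, f₂, f₃, f₄) = ⟨𝓣(f₁, f₂, f₃), f₄⟩ = ∫ 𝓣(f₁, f₂, f₃) conj f₄`. -/
noncomputable def energy (f₁ f₂ f₃ f₄ : Plane → ℂ) : ℂ :=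
  ∫ z : Plane, T f₁ f₂ f₃ z * conj (f₄ z)

/-! ### The free Schrödinger group -/

/-- The Fourier symbol of `e^{itΔ}`. For the Fourier transform with kernel `e^{-2πi⟨x, ξ⟩}`, the
operator `Δ` is the multiplier `-4π²|ξ|²`. -/
noncomputable def freeSymbol (t : ℝ) (ξ : Plane) : ℂ :=
  exp (((-(4 * Real.pi ^ 2 * ‖ξ‖ ^ 2 * t) : ℝ) : ℂ) * I)

theorem memLp_freeSymbol_mul (t : ℝ) (g : L2) :
    MemLp (fun ξ => freeSymbol t ξ * g ξ) 2 volume := by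
  have hg : MemLp (fun ξ => g ξ) 2 volume := Lp.memLp g
  refine hg.of_le ?_ ?_
  · refine AEStronglyMeasurable.mul ?_ hg.1
    apply Continuous.aestronglyMeasurable
    unfold freeSymbol
    fun_prop
  · filter_upwards with ξ
    rw [norm_mul, freeSymbol, norm_exp_ofReal_mul_I, one_mul]

/-- The unitary group `e^{itΔ}` on `L²(ℝ²)`: the Fourier multiplier `e^{-it|·|²}` (in the
normalization of the Fourier transform in which `Δ` becomes `-|·|²`). -/
noncomputable def freeGroup (t : ℝ) (f : L2) : L2 :=
  𝓕⁻ ((memLp_freeSymbol_mul t (𝓕 f)).toLp _)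

/-! ### The harmonic oscillator and its unitary group -/

/-- The harmonic oscillator `H = -Δ + |x|²` on Schwartz functions. -/
noncomputable def oscillator : 𝓢(Plane, ℂ) →L[ℂ] 𝓢(Plane, ℂ) :=
  -LineDeriv.laplacianCLM ℂ Plane 𝓢(Plane, ℂ) +
    smulLeftCLM ℂ (fun x : Plane => ((‖x‖ ^ 2 : ℝ) : ℂ))

theorem oscillator_apply (φ : 𝓢(Plane, ℂ)) (x : Plane) :
    oscillator φ x = -Laplacian.laplacian (φ : Plane → ℂ) x + ((‖x‖ ^ 2 : ℝ) : ℂ) * φ x := by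
  have hg : (fun x : Plane => ((‖x‖ ^ 2 : ℝ) : ℂ)).HasTemperateGrowth := by fun_prop
  simp only [oscillator, add_apply, neg_apply,
    SchwartzMap.laplacianCLM_eq,
    SchwartzMap.laplacian_apply, smulLeftCLM_apply_apply hg, smul_eq_mul]

/-- The eigenspace `E_n = {u ∈ L²(ℝ²) : H u = 2 (n + 1) u}`, the equation being understood in the
sense of distributions: `⟨u, (H - 2 (n + 1)) φ⟩ = 0` for all Schwartz functions `φ`. -/
noncomputable def eigenspace (n : ℕ) : Submodule ℂ L2 :=
  (LinearMap.range ((toLpCLM ℂ ℂ 2 (volume : Measure Plane)).toLinearMap ∘ₗ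
    (oscillator - (2 * ((n : ℂ) + 1)) • ContinuousLinearMap.id ℂ 𝓢(Plane, ℂ)).toLinearMap))ᗮ

theorem mem_eigenspace_iff (n : ℕ) (u : L2) :
    u ∈ eigenspace n ↔ ∀ φ : 𝓢(Plane, ℂ),
      ∫ x, conj (oscillator φ x) * u x = 2 * ((n : ℂ) + 1) * ∫ x, conj (φ x) * u x := by
  have key : ∀ ψ : 𝓢(Plane, ℂ),
      inner ℂ (toLpCLM ℂ ℂ 2 (volume : Measure Plane) ψ) u = ∫ x, conj (ψ x) * u x := by
    intro ψ
    rw [L2.inner_def]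
    refine integral_congr_ae ?_
    filter_upwards [ψ.coeFn_toLp 2 (volume : Measure Plane)] with x hx
    simp only [toLpCLM_apply, RCLike.inner_apply, hx]
    ring
  rw [eigenspace, Submodule.mem_orthogonal]
  constructor
  · intro h φ
    have h1 := h _ ⟨φ, rfl⟩
    simp only [LinearMap.comp_apply, ContinuousLinearMap.coe_coe, sub_apply,
      smul_apply, ContinuousLinearMap.id_apply, map_sub, map_smul,
      inner_sub_left, inner_smul_left, key, sub_eq_zero] at h1
    simpa [map_ofNat] using h1
  · rintro h _ ⟨φ, rfl⟩
    simp only [LinearMap.comp_apply, ContinuousLinearMap.coe_coe, sub_apply,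
      smul_apply, ContinuousLinearMap.id_apply, map_sub, map_smul,
      inner_sub_left, inner_smul_left, key, h φ]
    simp [map_ofNat]

noncomputable instance (n : ℕ) : (eigenspace n).HasOrthogonalProjection := by
  unfold eigenspace; infer_instance

/-- The orthogonal projection `Π_n` of `L²(ℝ²)` onto `E_n`. -/
noncomputable def proj (n : ℕ) : L2 →L[ℂ] L2 := (eigenspace n).starProjection

/-- The unitary group `e^{isH} = ∑_n e^{2i(n + 1)s} Π_n` on `L²(ℝ²)`, the functional calculus of
`H`, whose spectrum consists of the eigenvalues `2 (n + 1)`. -/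
noncomputable def oscillatorGroup (s : ℝ) (f : L2) : L2 :=
  ∑' n : ℕ, exp (((2 * ((n : ℝ) + 1) * s : ℝ) : ℂ) * I) • proj n f

/-! ### Iterated space-time integrals -/

/-- Absolute convergence of the iterated integral `∫ (∫_{ℝ²} F(t, x) dx) dμ(t)`. -/
def AbsConvergent (μ : Measure ℝ) (F : ℝ → Plane → ℂ) : Prop :=
  (∀ᵐ t ∂μ, Integrable (F t) volume) ∧
    Integrable (fun t => ∫ x, ‖F t x‖) μ ∧
    Integrable (fun t => ∫ x, F t x) μ

end CR

/-! Both quadrilinear forms are evaluated exactly on the coherent states exp(-|x|²/2 + b·x) with b ∈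
ℂ², whose span is dense: a function orthogonal to all of them has a vanishing Fourier transform
after multiplication by exp(-|x|²/2) (`dense_span_coh`).

The form `energy` is bounded by π times the product of the four L² norms. For fixed λ, apply
Cauchy-Schwarz to the pairs f₁f₂ and f₃f₄; the map x ↦ x + λx^⊥ has determinant 1 + λ², and the
resulting weight (1 + λ²)⁻¹ has integral π (`lintegral_integrandE_le`).

On coherent states, Gaussian integration in x and z leaves a λ-integral of (1 + λ²)⁻¹ exp(Aκ +
Bκ⁻¹), where κ = (1 - iλ)/(1 + iλ) runs over the unit circle (`energy_coh`). The free evolution of a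
Gaussian is explicit, and the space integral of four such evolutions has the same shape with λ = 2t,
the same common factor and other constants A, B (`integral_freeCoh_quartic`). Shifting a contour
shows that the integral depends on AB alone (`besselLine_eq_of_mul_eq`), and the two values of AB
agree by the Lagrange identity (u·v)² + (u×v)² = (u·u)(v·v). This proves the first formula on
coherent states, hence on their span. Put equal arguments into it: the bound on `energy` becomes the
L⁴ Strichartz estimate (`eLpNorm_rep_le`), and this estimate extends the formula to L² by density
(`energy_eq_strForm`).

The Bochner integral for the operator needs the product of three evolutions to lie in L¹ in time
with values in L², which follows from the L³L⁶ Strichartz estimate (`lintegral_rep_six_le`). Its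
ingredients are the dispersive bound, a hand-made interpolation between L¹ → L^∞ and L² → L² giving
L^{6/5} → L⁶ with decay |t|^{-2/3}, a bilinear Hardy-Littlewood-Sobolev inequality and a duality
argument. Pairing with an arbitrary element of L² then turns the identity of forms into one of
operators (`toL2_T_eq`).

For the oscillator, the normalized coherent states exp(-w² b·b/4) exp(-|x|²/2 + w b·x) generate the
Hermite functions: H acts on them as 2 + 2w∂_w. Consequently the pairing with an element of E_m is
homogeneous of degree m along |w| = 1, circle averages are eigenfunctions, and the eigenspaces are
complete. The lens transform of e^{itΔ}, with t = tan(2τ)/2, sends the state at w = 1 to e^{-2iτ}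
times the state at w = e^{-2iτ}, so it equals e^{-iτH} for |τ| < π/4 (`oscillatorGroup_neg_eq`). The
powers of cos 2τ that the lens transform produces in cubic and quartic expressions are exactly dt/dτ
= cos⁻²(2τ), and the second formulas follow by changing variables in time. -/

namespace CR

/-! ### Gaussian functions on the plane -/

/-- The complex bilinear dot product on `ℂ²`. -/
def dot (b c : Fin 2 → ℂ) : ℂ := b 0 * c 0 + b 1 * c 1

/-- The quadratic phase `-a|x|² + b·x`. -/
noncomputable def quad (a : ℂ) (b : Fin 2 → ℂ) (x : Plane) : ℂ :=
  -a * ((‖x‖ ^ 2 : ℝ) : ℂ) + (b 0 * (x 0 : ℂ) + b 1 * (x 1 : ℂ))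

/-- The complex Gaussian `exp (-a|x|² + b·x)`. -/
noncomputable def gauss (a : ℂ) (b : Fin 2 → ℂ) (x : Plane) : ℂ := exp (quad a b x)

theorem normSq_plane (x : Plane) : ‖x‖ ^ 2 = x 0 ^ 2 + x 1 ^ 2 := by
  rw [EuclideanSpace.norm_sq_eq]; simp

theorem gauss_comp_toLp (a : ℂ) (b : Fin 2 → ℂ) (v : Fin 2 → ℝ) :
    gauss a b (WithLp.toLp 2 v) = exp (-a * ∑ i, (v i : ℂ) ^ 2 + ∑ i, b i * v i) := by
  simp [gauss, quad, normSq_plane]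

theorem continuous_gauss (a : ℂ) (b : Fin 2 → ℂ) : Continuous (gauss a b) := by
  unfold gauss quad; fun_prop

theorem integrable_gauss {a : ℂ} (ha : 0 < a.re) (b : Fin 2 → ℂ) : Integrable (gauss a b) := by
  have h := GaussianFourier.integrable_cexp_neg_mul_sum_add ha b
  rw [← (PiLp.volume_preserving_toLp (Fin 2)).integrable_comp_emb
    (MeasurableEquiv.toLp 2 (Fin 2 → ℝ)).measurableEmbedding]
  refine h.congr (Filter.Eventually.of_forall fun v => ?_)
  exact (gauss_comp_toLp a b v).symm

theorem integral_gauss {a : ℂ} (ha : 0 < a.re) (b : Fin 2 → ℂ) :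
    ∫ x, gauss a b x = Real.pi / a * exp (dot b b / (4 * a)) := by
  have h := GaussianFourier.integral_cexp_neg_mul_sum_add ha b
  rw [← (PiLp.volume_preserving_toLp (Fin 2)).integral_comp
    (MeasurableEquiv.toLp 2 (Fin 2 → ℝ)).measurableEmbedding]
  simp only [gauss_comp_toLp]
  rw [h]
  simp [dot, sq]

theorem norm_gauss_le (a : ℂ) (b : Fin 2 → ℂ) (x : Plane) :
    ‖gauss a b x‖ ≤ Real.exp (-a.re * ‖x‖ ^ 2 + (‖b 0‖ + ‖b 1‖) * ‖x‖) := by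
  have hx : ∀ i : Fin 2, ‖x i‖ ≤ ‖x‖ := fun i => PiLp.norm_apply_le x i
  have h1 : ∀ i : Fin 2, (b i * (x i : ℂ)).re ≤ ‖b i‖ * ‖x‖ := by
    intro i
    refine (Complex.re_le_norm _).trans ?_
    rw [norm_mul, Complex.norm_real]
    gcongr
    exact hx i
  rw [gauss, Complex.norm_exp, Real.exp_le_exp, quad]
  have h2 : (-a * ((‖x‖ ^ 2 : ℝ) : ℂ)).re = -a.re * ‖x‖ ^ 2 := by
    rw [Complex.re_mul_ofReal, Complex.neg_re]
  rw [Complex.add_re, h2, Complex.add_re]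
  linarith [h1 0, h1 1]

/-- The power is absorbed into N! e^{1+r}, and completing the square bounds the remaining exponent.
It serves both the Schwartz decay of Gaussians and the domination needed to differentiate coherent
states in their parameter. -/
theorem one_add_pow_mul_exp_le {α β : ℝ} (hα : 0 < α) (N : ℕ) {r : ℝ} (hr : 0 ≤ r) :
    (1 + r) ^ N * Real.exp (-α * r ^ 2 + β * r) ≤
      N.factorial * Real.exp (1 + (β + 1) ^ 2 / (4 * α)) := by
  have h1 : (1 + r) ^ N ≤ N.factorial * Real.exp (1 + r) := by
    have := Real.pow_div_factorial_le_exp (1 + r) (by positivity) N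
    rw [div_le_iff₀ (by positivity)] at this
    linarith
  calc (1 + r) ^ N * Real.exp (-α * r ^ 2 + β * r)
      ≤ (N.factorial * Real.exp (1 + r)) * Real.exp (-α * r ^ 2 + β * r) := by gcongr
    _ = N.factorial * Real.exp (1 + r + (-α * r ^ 2 + β * r)) := by
      rw [mul_assoc, ← Real.exp_add]
    _ ≤ _ := by
      refine mul_le_mul_of_nonneg_left (Real.exp_le_exp.2 ?_) (by positivity)
      have : (β + 1) ^ 2 / (4 * α) - (r + (-α * r ^ 2 + β * r)) =
          (2 * α * r - (β + 1)) ^ 2 / (4 * α) := by field_simp; ring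
      have h2 : 0 ≤ (2 * α * r - (β + 1)) ^ 2 / (4 * α) := by positivity
      linarith

theorem hasTemperateGrowth_quad (a : ℂ) (b : Fin 2 → ℂ) : (quad a b).HasTemperateGrowth := by
  have h0 : ∀ i : Fin 2, (fun x : Plane => (x i : ℂ)).HasTemperateGrowth := fun i =>
    (Complex.ofRealCLM.comp (EuclideanSpace.proj i : Plane →L[ℝ] ℝ)).hasTemperateGrowth
  have h1 : (fun x : Plane => ((‖x‖ ^ 2 : ℝ) : ℂ)).HasTemperateGrowth := by fun_prop
  unfold quad
  exact ((Function.HasTemperateGrowth.const _).mul h1).add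
    (((Function.HasTemperateGrowth.const _).mul (h0 0)).add
      ((Function.HasTemperateGrowth.const _).mul (h0 1)))

/-- Real derivatives of exp are restrictions of scalars of the complex ones. In the chain rule bound
for exp ∘ `quad`, every derivative of the outer function is thus controlled by the Gaussian itself.
-/
theorem norm_iteratedFDeriv_cexp (n : ℕ) (z : ℂ) :
    ‖iteratedFDeriv ℝ n (fun z : ℂ => exp z) z‖ ≤ ‖exp z‖ := by
  have h : iteratedFDeriv ℝ n (fun z : ℂ => exp z) z =
      (iteratedFDeriv ℂ n (fun z : ℂ => exp z) z).restrictScalars ℝ := by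
    exact (Complex.contDiff_exp.contDiffAt.restrictScalars_iteratedFDeriv (𝕜 := ℝ) (n := n)
      (f := fun z : ℂ => exp z)).symm
  rw [h, ContinuousMultilinearMap.norm_restrictScalars, norm_iteratedFDeriv_eq_norm_iteratedDeriv,
    iteratedDeriv_eq_iterate, Complex.iter_deriv_exp]

/-- The complex Gaussian as a Schwartz function. -/
noncomputable def gaussS (a : ℂ) (b : Fin 2 → ℂ) (ha : 0 < a.re) : 𝓢(Plane, ℂ) where
  toFun := gauss a b
  smooth' := Complex.contDiff_exp.comp (hasTemperateGrowth_quad a b).1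
  decay' := by
    intro k n
    have hq := hasTemperateGrowth_quad a b
    obtain ⟨K, C, hC, hbd⟩ := hq.norm_iteratedFDeriv_le_uniform n
    -- The chain rule bound wants the i-th derivative of the phase below D^i. Taking C + 1 instead
    -- of C forces D ≥ 1, so that D ≤ D^i for i ≥ 1.
    set D : ℝ → ℝ := fun r => (C + 1) * (1 + r) ^ K
    refine ⟨n.factorial * (C + 1) ^ n * ((k + K * n).factorial *
      Real.exp (1 + ((‖b 0‖ + ‖b 1‖) + 1) ^ 2 / (4 * a.re))), fun x => ?_⟩
    have hr := norm_nonneg x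
    have hD1 : 1 ≤ D ‖x‖ := by
      have : (1 : ℝ) ≤ (1 + ‖x‖) ^ K := one_le_pow₀ (by linarith)
      simp only [D]; nlinarith
    have h1 := norm_iteratedFDeriv_comp_le (𝕜 := ℝ) (g := fun z : ℂ => exp z) (f := quad a b)
      (n := n) (N := (⊤ : ℕ∞)) (Complex.contDiff_exp (𝕜 := ℝ)) hq.1 (mod_cast le_top) x
      (C := ‖gauss a b x‖) (D := D ‖x‖)
      (fun i _ => norm_iteratedFDeriv_cexp i _) (fun i hi hin => by
        refine (hbd i hin x).trans ?_
        calc C * (1 + ‖x‖) ^ K ≤ D ‖x‖ := by simp only [D]; gcongr; linarith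
          _ ≤ D ‖x‖ ^ i := le_self_pow₀ hD1 (by omega))
    have h3 := one_add_pow_mul_exp_le (β := ‖b 0‖ + ‖b 1‖) ha (k + K * n) hr
    calc ‖x‖ ^ k * ‖iteratedFDeriv ℝ n (gauss a b) x‖
        ≤ (1 + ‖x‖) ^ k * (n.factorial * ‖gauss a b x‖ * D ‖x‖ ^ n) := by
          gcongr
          · linarith
          · exact h1
      _ = n.factorial * (C + 1) ^ n * ((1 + ‖x‖) ^ (k + K * n) * ‖gauss a b x‖) := by
          simp only [D]; rw [mul_pow, ← pow_mul, pow_add]; ring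
      _ ≤ n.factorial * (C + 1) ^ n * ((1 + ‖x‖) ^ (k + K * n) *
            Real.exp (-a.re * ‖x‖ ^ 2 + (‖b 0‖ + ‖b 1‖) * ‖x‖)) := by
          gcongr; exact norm_gauss_le a b x
      _ ≤ _ := by gcongr

@[simp] theorem gaussS_apply (a : ℂ) (b : Fin 2 → ℂ) (ha : 0 < a.re) (x : Plane) :
    gaussS a b ha x = gauss a b x := rfl

theorem inner_plane (x y : Plane) : inner ℝ x y = x 0 * y 0 + x 1 * y 1 := by
  simp [PiLp.inner_apply]; ring

theorem fourier_gauss {a : ℂ} (ha : 0 < a.re) (b : Fin 2 → ℂ) (ξ : Plane) :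
    𝓕 (gauss a b) ξ =
      Real.pi / a * exp (dot (fun i => b i - 2 * Real.pi * I * ξ i)
        (fun i => b i - 2 * Real.pi * I * ξ i) / (4 * a)) := by
  rw [Real.fourier_eq', ← integral_gauss ha]
  congr 1; ext x
  rw [smul_eq_mul, gauss, gauss, ← Complex.exp_add, inner_plane]
  congr 1
  simp only [quad]
  push_cast; ring

/-- A function all of whose Gaussian moments vanish is zero. -/
theorem ae_eq_zero_of_integral_gauss_mul {f : Plane → ℂ}
    (hf : Integrable (fun x => gauss (1 / 2) 0 x * f x))
    (h : ∀ b, ∫ x, gauss (1 / 2) b x * f x = 0) : f =ᵐ[volume] 0 := by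
  -- Purely imaginary b = -2πiξ turns the Gaussian moments into the Fourier transform of
  -- exp(-|x|²/2) f.
  have hF : ∀ ξ, 𝓕 (fun x => gauss (1 / 2) 0 x * f x) ξ = 0 := by
    intro ξ
    rw [Real.fourier_eq', ← h (fun i => - 2 * Real.pi * I * ξ i)]
    congr 1; ext x
    rw [smul_eq_mul, ← mul_assoc, gauss, gauss, ← Complex.exp_add, inner_plane]
    congr 2
    simp only [quad]
    push_cast; simp; ring
  -- Every test function is the Fourier transform of a Schwartz function, and the transform can be
  -- moved to the other factor, where it vanishes. This gives uniqueness for L¹ functions without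
  -- Fourier inversion on L¹.
  have key := ae_eq_zero_of_integral_contDiff_smul_eq_zero hf.locallyIntegrable (by
    intro g hg hgc
    have hgc' : HasCompactSupport (fun x => (g x : ℂ)) := hgc.comp_left (g := fun r : ℝ => (r : ℂ)) rfl
    have hg' : ContDiff ℝ (⊤ : ℕ∞) (fun x => (g x : ℂ)) := Complex.ofRealCLM.contDiff.comp hg
    set φ : 𝓢(Plane, ℂ) := hgc'.toSchwartzMap hg'
    set ψ : 𝓢(Plane, ℂ) := 𝓕⁻ φ
    have hφ : φ = 𝓕 ψ := (FourierTransform.fourier_fourierInv_eq φ).symm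
    have h2 := VectorFourier.integral_fourierIntegral_smul_eq_flip (e := Real.fourierChar)
      (L := innerₗ Plane) (μ := (volume : Measure Plane)) (ν := volume)
      Real.continuous_fourierChar continuous_inner ψ.integrable hf
    have h3 : ∀ x, VectorFourier.fourierIntegral Real.fourierChar volume (innerₗ Plane) ψ x
        = (g x : ℂ) := by
      intro x
      have : φ x = 𝓕 ψ x := by rw [← hφ]
      exact this.symm
    have h4 : ∀ ξ, VectorFourier.fourierIntegral Real.fourierChar volume (innerₗ Plane).flip
        (fun x => gauss (1 / 2) 0 x * f x) ξ = 0 := by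
      intro ξ; rw [flip_innerₗ]; exact hF ξ
    simp only [h3, h4, smul_zero, integral_zero] at h2
    rw [← h2]
    congr 1)
  filter_upwards [key] with x hx
  simpa [gauss] using hx

theorem memLp_gauss {a : ℂ} (ha : 0 < a.re) (b : Fin 2 → ℂ) (p : ℝ≥0∞) :
    MemLp (gauss a b) p volume := (gaussS a b ha).memLp p volume

/-- The coherent state `exp (-|x|²/2 + b·x)` as an element of `L²`. -/
noncomputable def coh (b : Fin 2 → ℂ) : L2 := (memLp_gauss (a := 1 / 2) (by norm_num) b 2).toLp _

theorem coeFn_coh (b : Fin 2 → ℂ) : coh b =ᵐ[volume] gauss (1 / 2) b := MemLp.coeFn_toLp _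

theorem conj_gauss (a : ℂ) (b : Fin 2 → ℂ) (x : Plane) :
    conj (gauss a b x) = gauss (conj a) (fun i => conj (b i)) x := by
  simp only [gauss, quad, ← Complex.exp_conj, map_add, map_mul, map_neg, Complex.conj_ofReal]

theorem inner_coh_left (b : Fin 2 → ℂ) (f : L2) :
    inner ℂ (coh b) f = ∫ x, gauss (1 / 2) (fun i => conj (b i)) x * f x := by
  rw [L2.inner_def]
  refine integral_congr_ae ?_
  filter_upwards [coeFn_coh b] with x hx
  have h2 : conj (1 / 2 : ℂ) = 1 / 2 := by simp [map_ofNat]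
  rw [RCLike.inner_apply, hx, conj_gauss, mul_comm, h2]

/-- An element of the orthogonal complement has vanishing Gaussian moments, since conjugating b
permutes the coherent states. -/
theorem dense_span_coh : Dense (Submodule.span ℂ (Set.range coh) : Set L2) := by
  rw [Submodule.dense_iff_topologicalClosure_eq_top, Submodule.topologicalClosure_eq_top_iff,
    Submodule.eq_bot_iff]
  intro f hf
  rw [Submodule.mem_orthogonal] at hf
  have h : ∀ b, ∫ x, gauss (1 / 2) b x * f x = 0 := by
    intro b
    have := hf (coh fun i => conj (b i)) (Submodule.subset_span ⟨_, rfl⟩)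
    rw [inner_coh_left] at this
    simpa using this
  have h0 : Integrable (fun x => gauss (1 / 2) 0 x * f x) :=
    MemLp.integrable_mul (memLp_gauss (by norm_num) 0 2) (Lp.memLp f)
  exact (Lp.eq_zero_iff_ae_eq_zero).2 (ae_eq_zero_of_integral_gauss_mul h0 h)

end CR

namespace CR

/-! ### The free Schrödinger group -/

theorem fourier_freeGroup (t : ℝ) (f : L2) :
    𝓕 (freeGroup t f) = (memLp_freeSymbol_mul t (𝓕 f)).toLp _ :=
  FourierTransform.fourier_fourierInv_eq _

theorem coeFn_fourier_freeGroup (t : ℝ) (f : L2) :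
    (𝓕 (freeGroup t f) : L2) =ᵐ[volume] fun ξ => freeSymbol t ξ * (𝓕 f : L2) ξ := by
  rw [fourier_freeGroup]; exact MemLp.coeFn_toLp _

theorem fourier_L2_injective : Function.Injective (fun f : L2 => (𝓕 f : L2)) :=
  (Lp.fourierTransformₗᵢ Plane ℂ).injective

theorem freeGroup_add_apply (t : ℝ) (f g : L2) :
    freeGroup t (f + g) = freeGroup t f + freeGroup t g := by
  apply fourier_L2_injective
  apply Lp.ext
  simp only [FourierTransform.fourier_add]
  filter_upwards [coeFn_fourier_freeGroup t (f + g), coeFn_fourier_freeGroup t f,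
    coeFn_fourier_freeGroup t g, Lp.coeFn_add (𝓕 f : L2) (𝓕 g),
    Lp.coeFn_add (𝓕 (freeGroup t f) : L2) (𝓕 (freeGroup t g))] with x h1 h2 h3 h4 h5
  rw [h1, h5, Pi.add_apply, h2, h3, FourierTransform.fourier_add, h4, Pi.add_apply, mul_add]

theorem freeGroup_smul (t : ℝ) (c : ℂ) (f : L2) : freeGroup t (c • f) = c • freeGroup t f := by
  apply fourier_L2_injective
  apply Lp.ext
  simp only [FourierTransform.fourier_smul]
  filter_upwards [coeFn_fourier_freeGroup t (c • f), coeFn_fourier_freeGroup t f,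
    Lp.coeFn_smul c (𝓕 f : L2), Lp.coeFn_smul c (𝓕 (freeGroup t f) : L2)] with x h1 h2 h3 h4
  rw [h1, h4, Pi.smul_apply, h2, FourierTransform.fourier_smul, h3, Pi.smul_apply, smul_eq_mul,
    smul_eq_mul]
  ring

theorem conj_freeSymbol (t : ℝ) (ξ : Plane) : conj (freeSymbol t ξ) = freeSymbol (-t) ξ := by
  simp only [freeSymbol, ← Complex.exp_conj, map_mul, Complex.conj_ofReal, conj_I]
  congr 1; push_cast; ring

theorem freeSymbol_add (s t : ℝ) (ξ : Plane) :
    freeSymbol (s + t) ξ = freeSymbol s ξ * freeSymbol t ξ := by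
  simp only [freeSymbol, ← Complex.exp_add]
  congr 1; push_cast; ring

theorem inner_freeGroup (t : ℝ) (f g : L2) :
    inner ℂ (freeGroup t f) g = inner ℂ f (freeGroup (-t) g) := by
  rw [← Lp.inner_fourier_eq, ← Lp.inner_fourier_eq f, L2.inner_def, L2.inner_def]
  refine integral_congr_ae ?_
  filter_upwards [coeFn_fourier_freeGroup t f, coeFn_fourier_freeGroup (-t) g] with x h1 h2
  rw [RCLike.inner_apply, RCLike.inner_apply, h1, h2, map_mul, conj_freeSymbol]
  ring

theorem freeGroup_freeGroup (s t : ℝ) (f : L2) :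
    freeGroup s (freeGroup t f) = freeGroup (s + t) f := by
  apply fourier_L2_injective
  apply Lp.ext
  filter_upwards [coeFn_fourier_freeGroup s (freeGroup t f), coeFn_fourier_freeGroup t f,
    coeFn_fourier_freeGroup (s + t) f] with x h1 h2 h3
  rw [h1, h2, h3, freeSymbol_add, mul_assoc]

theorem freeGroup_zero (f : L2) : freeGroup 0 f = f := by
  apply fourier_L2_injective
  apply Lp.ext
  filter_upwards [coeFn_fourier_freeGroup 0 f] with x h1
  rw [h1]; simp [freeSymbol]

/-- The operator `e^{itΔ}` as a linear isometry of `L²`. -/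
noncomputable def freeLI (t : ℝ) : L2 →ₗᵢ[ℂ] L2 where
  toFun := freeGroup t
  map_add' := freeGroup_add_apply t
  map_smul' := freeGroup_smul t
  norm_map' f := by
    have h : inner ℂ (freeGroup t f) (freeGroup t f) = inner ℂ f f := by
      rw [inner_freeGroup, freeGroup_freeGroup, neg_add_cancel, freeGroup_zero]
    rw [inner_self_eq_norm_sq_to_K, inner_self_eq_norm_sq_to_K] at h
    have h2 : ‖freeGroup t f‖ ^ 2 = ‖f‖ ^ 2 := by exact_mod_cast h
    simpa using h2

theorem norm_freeGroup (t : ℝ) (f : L2) : ‖freeGroup t f‖ = ‖f‖ := (freeLI t).norm_map f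

theorem freeGroup_sub (t : ℝ) (f g : L2) :
    freeGroup t (f - g) = freeGroup t f - freeGroup t g := (freeLI t).map_sub f g

/-! ### The free evolution of coherent states -/

/-- `q(t) = (1 + 2it)⁻¹`. -/
noncomputable def qt (t : ℝ) : ℂ := (1 + 2 * I * t)⁻¹

theorem one_add_ne_zero (t : ℝ) : (1 + 2 * I * t : ℂ) ≠ 0 := by
  intro h
  have := congrArg Complex.re h
  simp at this

theorem qt_ne_zero (t : ℝ) : qt t ≠ 0 := inv_ne_zero (one_add_ne_zero t)

theorem normSq_one_add (t : ℝ) : Complex.normSq (1 + 2 * I * t) = 1 + 4 * t ^ 2 := by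
  rw [Complex.normSq_apply]; simp; ring

theorem re_qt (t : ℝ) : (qt t).re = (1 + 4 * t ^ 2)⁻¹ := by
  rw [qt, Complex.inv_re, normSq_one_add]; simp

theorem re_qt_pos (t : ℝ) : 0 < (qt t).re := by rw [re_qt]; positivity

theorem re_qt_half_pos (t : ℝ) : 0 < (qt t / 2).re := by
  have := re_qt_pos t
  simp; linarith

/-- The explicit free evolution of a coherent state. -/
noncomputable def freeCoh (b : Fin 2 → ℂ) (t : ℝ) (x : Plane) : ℂ :=
  qt t * exp (qt t * (I * t * dot b b)) * gauss (qt t / 2) (fun i => qt t * b i) x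

/-- On the Fourier side the evolution multiplies one complex Gaussian by another, so the result is
again Gaussian. The exponents match by the relation q(t)(1 + 2it) = 1 and I² = -1 alone. -/
theorem freeSymbol_mul_fourier_gauss (t : ℝ) (b : Fin 2 → ℂ) (ξ : Plane) :
    freeSymbol t ξ * 𝓕 (gauss (1 / 2) b) ξ =
      qt t * exp (qt t * (I * t * dot b b)) *
        𝓕 (gauss (qt t / 2) (fun i => qt t * b i)) ξ := by
  rw [fourier_gauss (by norm_num), fourier_gauss (re_qt_half_pos t), freeSymbol]
  have hq := qt_ne_zero t
  have h1 : qt t * (1 + 2 * I * t) = 1 := inv_mul_cancel₀ (one_add_ne_zero t)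
  rw [mul_left_comm, ← Complex.exp_add,
    show ∀ a b c d : ℂ, a * b * (c * d) = (a * c) * (b * d) by intros; ring, ← Complex.exp_add,
    show (qt t * (Real.pi / (qt t / 2)) : ℂ) = Real.pi / (1 / 2) by field_simp]
  congr 2
  rw [normSq_plane]
  simp only [dot]
  field_simp
  push_cast
  linear_combination (-2 * qt t * ((b 0)^2 + (b 1)^2) -
    8 * Real.pi ^ 2 * ((ξ 0 : ℂ) ^ 2 + (ξ 1 : ℂ) ^ 2)) * h1 +
    8 * Real.pi ^ 2 * ((ξ 0 : ℂ) ^ 2 + (ξ 1 : ℂ) ^ 2) * (qt t - 1) * Complex.I_sq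

theorem coh_eq_toLp (b : Fin 2 → ℂ) :
    coh b = (gaussS (1 / 2) b (by norm_num)).toLp 2 volume := rfl

theorem freeGroup_coh (t : ℝ) (b : Fin 2 → ℂ) :
    freeGroup t (coh b) = (qt t * exp (qt t * (I * t * dot b b))) •
      (gaussS (qt t / 2) (fun i => qt t * b i) (re_qt_half_pos t)).toLp 2 volume := by
  apply fourier_L2_injective
  apply Lp.ext
  simp only [FourierTransform.fourier_smul]
  have h0 := coeFn_fourier_freeGroup t (coh b)
  rw [coh_eq_toLp, toLp_fourier_eq] at h0
  rw [coh_eq_toLp, toLp_fourier_eq]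
  set ψ := gaussS (qt t / 2) (fun i => qt t * b i) (re_qt_half_pos t)
  filter_upwards [h0, (𝓕 (gaussS (1 / 2) b (by norm_num))).coeFn_toLp 2 volume,
    (𝓕 ψ).coeFn_toLp 2 volume,
    Lp.coeFn_smul (qt t * exp (qt t * (I * t * dot b b))) ((𝓕 ψ).toLp 2 volume : L2)] with x h1 h2 h3 h4
  rw [h1, h2, h4, Pi.smul_apply, h3, smul_eq_mul]
  exact freeSymbol_mul_fourier_gauss t b x

theorem coeFn_freeGroup_coh (t : ℝ) (b : Fin 2 → ℂ) :
    freeGroup t (coh b) =ᵐ[volume] freeCoh b t := by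
  rw [freeGroup_coh]
  set ψ := gaussS (qt t / 2) (fun i => qt t * b i) (re_qt_half_pos t) with hψ
  filter_upwards [ψ.coeFn_toLp 2 volume,
    Lp.coeFn_smul (qt t * exp (qt t * (I * t * dot b b))) (ψ.toLp 2 volume : L2)] with x h3 h4
  rw [h4, Pi.smul_apply, h3, smul_eq_mul]
  rfl

theorem continuous_freeCoh (b : Fin 2 → ℂ) :
    Continuous (fun p : ℝ × Plane => freeCoh b p.1 p.2) := by
  have hq : Continuous (fun p : ℝ × Plane => qt p.1) := by
    unfold qt
    exact Continuous.inv₀ (by fun_prop) (fun p => one_add_ne_zero p.1)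
  unfold freeCoh gauss quad
  fun_prop

/-! ### Extension of identities from coherent states -/

/-- An additive bounded functional vanishing on coherent states is zero. -/
theorem eq_zero_of_coh {φ : L2 → ℂ} (hadd : ∀ f g, φ (f + g) = φ f + φ g)
    (hsmul : ∀ (c : ℂ) f, φ f = 0 → φ (c • f) = 0) (C : ℝ) (hbd : ∀ f, ‖φ f‖ ≤ C * ‖f‖)
    (hcoh : ∀ b, φ (coh b) = 0) (f : L2) : φ f = 0 := by
  let Φ : L2 →+ ℂ := AddMonoidHom.mk' φ hadd
  have hcont : Continuous φ := AddMonoidHomClass.continuous_of_bound Φ C hbd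
  refine dense_span_coh.induction (P := fun f => φ f = 0) (fun f hf => ?_)
    (isClosed_eq hcont continuous_const) f
  induction hf using Submodule.span_induction with
  | mem x hx => obtain ⟨b, rfl⟩ := hx; exact hcoh b
  | zero => exact Φ.map_zero
  | add x y _ _ hx hy => rw [hadd, hx, hy, add_zero]
  | smul c x _ hx => exact hsmul c x hx

/-- Continuous linear maps agreeing on coherent states are equal. -/
theorem clm_ext_coh {E : Type*} [NormedAddCommGroup E] [NormedSpace ℂ E] {A B : L2 →L[ℂ] E}
    (h : ∀ b, A (coh b) = B (coh b)) : A = B := by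
  refine ContinuousLinearMap.ext_on dense_span_coh ?_
  rintro _ ⟨b, rfl⟩
  exact h b

end CR

namespace CR

/-! ### Absolute convergence of the quadrilinear form -/

@[simp] theorem perp_zero_apply (x : Plane) : perp x 0 = -x 1 := by simp [perp]
@[simp] theorem perp_one_apply (x : Plane) : perp x 1 = x 0 := by simp [perp]

theorem continuous_perp : Continuous perp := by unfold perp; fun_prop

/-- The linear map `x ↦ x + μ x^⊥`. -/
noncomputable def shear (μ : ℝ) : Plane →ₗ[ℝ] Plane where
  toFun x := x + μ • perp x
  map_add' x y := by ext i; fin_cases i <;> simp <;> ring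
  map_smul' c x := by ext i; fin_cases i <;> simp <;> ring

theorem shear_apply (μ : ℝ) (x : Plane) : shear μ x = x + μ • perp x := rfl

theorem det_shear (μ : ℝ) : LinearMap.det (shear μ) = 1 + μ ^ 2 := by
  rw [← LinearMap.det_toMatrix (EuclideanSpace.basisFun (Fin 2) ℝ).toBasis, Matrix.det_fin_two]
  simp [LinearMap.toMatrix_apply, shear_apply]
  ring

/-- The map x ↦ x + μx^⊥ is a rotation composed with a dilation. Its Jacobian is the source of the
weight (1 + λ²)⁻¹ that makes the λ-integral converge. -/
theorem lintegral_shear (μ : ℝ) {h : Plane → ℝ≥0∞} (hh : Measurable h) (z : Plane) :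
    ∫⁻ x, h (x + μ • perp x + z) = ENNReal.ofReal (1 + μ ^ 2)⁻¹ * ∫⁻ x, h x := by
  have hdet : LinearMap.det (shear μ) ≠ 0 := by rw [det_shear]; positivity
  have hm : Measurable (shear μ) := (LinearMap.continuous_of_finiteDimensional _).measurable
  have h1 : ∫⁻ x, h (x + μ • perp x + z) = ∫⁻ y, h (y + z) ∂(Measure.map (shear μ) volume) := by
    rw [lintegral_map (by fun_prop) hm]; rfl
  rw [h1, Measure.map_linearMap_addHaar_eq_smul_addHaar _ hdet, lintegral_smul_measure,
    lintegral_add_right_eq_self, det_shear, abs_of_pos (by positivity)]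
  rfl

/-- Translating z by -λx^⊥ frees the second factor of x; the first one then contains the shear with
parameter -λ, which has the same determinant. -/
theorem lintegral_pair_first (lam : ℝ) {g h : Plane → ℝ≥0∞} (hg : Measurable g)
    (hh : Measurable h) :
    ∫⁻ x, ∫⁻ z, g (x + z) * h (lam • perp x + z) =
      ENNReal.ofReal (1 + lam ^ 2)⁻¹ * ((∫⁻ x, g x) * ∫⁻ x, h x) := by
  have hp := continuous_perp
  have h1 : ∀ x, ∫⁻ z, g (x + z) * h (lam • perp x + z) =
      ∫⁻ z, g (x + (-lam) • perp x + z) * h z := by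
    intro x
    rw [← lintegral_add_left_eq_self (μ := (volume : Measure Plane)) _ ((-lam) • perp x)]
    refine lintegral_congr fun z => ?_
    rw [← add_assoc, ← add_assoc, neg_smul, add_neg_cancel, zero_add]
  simp_rw [h1]
  rw [lintegral_lintegral_swap (by fun_prop)]
  have h2 : ∀ z, ∫⁻ x, g (x + (-lam) • perp x + z) * h z =
      ENNReal.ofReal (1 + lam ^ 2)⁻¹ * (∫⁻ x, g x) * h z := by
    intro z
    rw [lintegral_mul_const _ (by fun_prop), lintegral_shear _ hg, neg_sq]
  simp_rw [h2]
  rw [lintegral_const_mul _ hh, mul_assoc]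

theorem lintegral_pair_second (lam : ℝ) {g h : Plane → ℝ≥0∞} (hg : Measurable g)
    (hh : Measurable h) :
    ∫⁻ x, ∫⁻ z, g (x + lam • perp x + z) * h z =
      ENNReal.ofReal (1 + lam ^ 2)⁻¹ * ((∫⁻ x, g x) * ∫⁻ x, h x) := by
  have hp := continuous_perp
  rw [lintegral_lintegral_swap (by fun_prop)]
  have h2 : ∀ z, ∫⁻ x, g (x + lam • perp x + z) * h z =
      ENNReal.ofReal (1 + lam ^ 2)⁻¹ * (∫⁻ x, g x) * h z := by
    intro z
    rw [lintegral_mul_const _ (by fun_prop), lintegral_shear _ hg]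
  simp_rw [h2]
  rw [lintegral_const_mul _ hh, mul_assoc]

theorem lintegral_inv_one_add_sq :
    ∫⁻ x : ℝ, ENNReal.ofReal (1 + x ^ 2)⁻¹ = ENNReal.ofReal Real.pi := by
  rw [← ofReal_integral_eq_lintegral_ofReal integrable_inv_one_add_sq
    (Filter.Eventually.of_forall fun x => by positivity), integral_univ_inv_one_add_sq]

/-- The integrand of the quadrilinear form. -/
noncomputable def integrandE (f₁ f₂ f₃ f₄ : Plane → ℂ) (p : ℝ × Plane × Plane) : ℂ :=
  integrandT f₁ f₂ f₃ p.1 p.2.1 p.2.2 * conj (f₄ p.2.2)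

theorem measurable_integrandT {f₁ f₂ f₃ : Plane → ℂ} (h₁ : Measurable f₁) (h₂ : Measurable f₂)
    (h₃ : Measurable f₃) :
    Measurable (fun p : ℝ × Plane × Plane => integrandT f₁ f₂ f₃ p.1 p.2.1 p.2.2) := by
  have hp := continuous_perp.measurable
  unfold integrandT
  have hc := Complex.continuous_conj.measurable
  fun_prop

theorem measurable_integrandE {f₁ f₂ f₃ f₄ : Plane → ℂ} (h₁ : Measurable f₁)
    (h₂ : Measurable f₂) (h₃ : Measurable f₃) (h₄ : Measurable f₄) :
    Measurable (integrandE f₁ f₂ f₃ f₄) :=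
  (measurable_integrandT h₁ h₂ h₃).mul
    (Complex.continuous_conj.measurable.comp (h₄.comp (by fun_prop)))

theorem lintegral_sq_eq (f : Plane → ℂ) : ∫⁻ x, ‖f x‖ₑ ^ (2 : ℝ) = eLpNorm f 2 volume ^ (2 : ℝ) := by
  rw [eLpNorm_eq_lintegral_rpow_enorm_toReal two_ne_zero ENNReal.ofNat_ne_top, ← ENNReal.rpow_mul]
  simp

/-- Cauchy-Schwarz in (x, z) with f₁f₂ against f₃f₄. Each of the two L² norms contributes (1 +
λ²)^{-1/2}. -/
theorem lintegral_integrandE_fixed_le (lam : ℝ) {f₁ f₂ f₃ f₄ : Plane → ℂ} (h₁ : Measurable f₁)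
    (h₂ : Measurable f₂) (h₃ : Measurable f₃) (h₄ : Measurable f₄) :
    ∫⁻ p : Plane × Plane, ‖integrandE f₁ f₂ f₃ f₄ (lam, p)‖ₑ ≤
      ENNReal.ofReal (1 + lam ^ 2)⁻¹ * (eLpNorm f₁ 2 volume * eLpNorm f₂ 2 volume *
        (eLpNorm f₃ 2 volume * eLpNorm f₄ 2 volume)) := by
  have hp := continuous_perp.measurable
  set F : Plane × Plane → ℝ≥0∞ := fun p => ‖f₁ (p.1 + p.2)‖ₑ * ‖f₂ (lam • perp p.1 + p.2)‖ₑ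
  set G : Plane × Plane → ℝ≥0∞ := fun p => ‖f₃ (p.1 + lam • perp p.1 + p.2)‖ₑ * ‖f₄ p.2‖ₑ
  have hF : Measurable F := by simp only [F]; fun_prop
  have hG : Measurable G := by simp only [G]; fun_prop
  have h := ENNReal.lintegral_mul_le_Lp_mul_Lq (volume : Measure (Plane × Plane))
    Real.HolderConjugate.two_two hF.aemeasurable hG.aemeasurable
  have e1 : ∀ p, ‖integrandE f₁ f₂ f₃ f₄ (lam, p)‖ₑ = (F * G) p := by
    intro p
    simp [integrandE, integrandT, F, G, enorm_mul, mul_assoc]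
  have e2 : ∫⁻ p, F p ^ (2 : ℝ) = ENNReal.ofReal (1 + lam ^ 2)⁻¹ *
      (eLpNorm f₁ 2 volume ^ (2 : ℝ) * eLpNorm f₂ 2 volume ^ (2 : ℝ)) := by
    rw [← lintegral_sq_eq, ← lintegral_sq_eq,
      ← lintegral_pair_first lam (h₁.enorm.pow_const _) (h₂.enorm.pow_const _),
      Measure.volume_eq_prod, lintegral_prod _ (by fun_prop)]
    simp only [F, ENNReal.mul_rpow_of_nonneg _ _ (zero_le_two : (0 : ℝ) ≤ 2)]
  have e3 : ∫⁻ p, G p ^ (2 : ℝ) = ENNReal.ofReal (1 + lam ^ 2)⁻¹ *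
      (eLpNorm f₃ 2 volume ^ (2 : ℝ) * eLpNorm f₄ 2 volume ^ (2 : ℝ)) := by
    rw [← lintegral_sq_eq, ← lintegral_sq_eq,
      ← lintegral_pair_second lam (h₃.enorm.pow_const _) (h₄.enorm.pow_const _),
      Measure.volume_eq_prod, lintegral_prod _ (by fun_prop)]
    simp only [G, ENNReal.mul_rpow_of_nonneg _ _ (zero_le_two : (0 : ℝ) ≤ 2)]
  have e4 : ∀ a b c : ℝ≥0∞, (a * (b ^ (2 : ℝ) * c ^ (2 : ℝ))) ^ (1 / 2 : ℝ) =
      a ^ (1 / 2 : ℝ) * (b * c) := by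
    intro a b c
    rw [ENNReal.mul_rpow_of_nonneg _ _ (by norm_num), ENNReal.mul_rpow_of_nonneg _ _ (by norm_num),
      ← ENNReal.rpow_mul, ← ENNReal.rpow_mul]
    norm_num
  have e5 : ∀ a : ℝ≥0∞, a ^ (1 / 2 : ℝ) * a ^ (1 / 2 : ℝ) = a := by
    intro a
    rw [← ENNReal.rpow_add_of_nonneg _ _ (by norm_num) (by norm_num)]; norm_num
  simp only [e1]
  refine h.trans (le_of_eq ?_)
  rw [e2, e3, e4, e4, mul_mul_mul_comm, e5]

theorem lintegral_integrandE_le {f₁ f₂ f₃ f₄ : Plane → ℂ} (h₁ : Measurable f₁)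
    (h₂ : Measurable f₂) (h₃ : Measurable f₃) (h₄ : Measurable f₄) :
    ∫⁻ p, ‖integrandE f₁ f₂ f₃ f₄ p‖ₑ ≤
      ENNReal.ofReal Real.pi * (eLpNorm f₁ 2 volume * eLpNorm f₂ 2 volume *
        (eLpNorm f₃ 2 volume * eLpNorm f₄ 2 volume)) := by
  rw [Measure.volume_eq_prod, lintegral_prod _ (measurable_integrandE h₁ h₂ h₃ h₄).enorm.aemeasurable]
  refine (lintegral_mono fun lam => lintegral_integrandE_fixed_le lam h₁ h₂ h₃ h₄).trans ?_
  rw [lintegral_mul_const _ (by fun_prop), lintegral_inv_one_add_sq]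

theorem integrable_integrandE {f₁ f₂ f₃ f₄ : Plane → ℂ} (h₁ : Measurable f₁)
    (h₂ : Measurable f₂) (h₃ : Measurable f₃) (h₄ : Measurable f₄) (m₁ : MemLp f₁ 2 volume)
    (m₂ : MemLp f₂ 2 volume) (m₃ : MemLp f₃ 2 volume) (m₄ : MemLp f₄ 2 volume) :
    Integrable (integrandE f₁ f₂ f₃ f₄) := by
  refine ⟨(measurable_integrandE h₁ h₂ h₃ h₄).aestronglyMeasurable, ?_⟩
  refine (lintegral_integrandE_le h₁ h₂ h₃ h₄).trans_lt ?_
  exact ENNReal.mul_lt_top ENNReal.ofReal_lt_top (ENNReal.mul_lt_top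
    (ENNReal.mul_lt_top m₁.2 m₂.2) (ENNReal.mul_lt_top m₃.2 m₄.2))

/-- Absolute version of the trilinear operator: the square is controlled. -/
theorem lintegral_integrandT_sq_le {f₁ f₂ f₃ : Plane → ℂ} (h₁ : Measurable f₁)
    (h₂ : Measurable f₂) (h₃ : Measurable f₃) (z : Plane) :
    (∫⁻ p : ℝ × Plane, ‖integrandT f₁ f₂ f₃ p.1 p.2 z‖ₑ) ^ (2 : ℝ) ≤
      (∫⁻ p : ℝ × Plane, ‖f₁ (p.2 + z)‖ₑ ^ (2 : ℝ) * ‖f₂ (p.1 • perp p.2 + z)‖ₑ ^ (2 : ℝ)) *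
      (ENNReal.ofReal Real.pi * eLpNorm f₃ 2 volume ^ (2 : ℝ)) := by
  have hp := continuous_perp.measurable
  set F : ℝ × Plane → ℝ≥0∞ := fun p => ‖f₁ (p.2 + z)‖ₑ * ‖f₂ (p.1 • perp p.2 + z)‖ₑ
  set G : ℝ × Plane → ℝ≥0∞ := fun p => ‖f₃ (p.2 + p.1 • perp p.2 + z)‖ₑ
  have hF : Measurable F := by simp only [F]; fun_prop
  have hG : Measurable G := by simp only [G]; fun_prop
  have h := ENNReal.lintegral_mul_le_Lp_mul_Lq (volume : Measure (ℝ × Plane))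
    Real.HolderConjugate.two_two hF.aemeasurable hG.aemeasurable
  have e1 : ∀ p : ℝ × Plane, ‖integrandT f₁ f₂ f₃ p.1 p.2 z‖ₑ = (F * G) p := by
    intro p
    simp [integrandT, F, G, enorm_mul]
  have e3 : ∫⁻ p, G p ^ (2 : ℝ) = ENNReal.ofReal Real.pi * eLpNorm f₃ 2 volume ^ (2 : ℝ) := by
    rw [Measure.volume_eq_prod, lintegral_prod _ (by fun_prop)]
    simp only [G]
    have : ∀ lam : ℝ, ∫⁻ x, ‖f₃ (x + lam • perp x + z)‖ₑ ^ (2 : ℝ) =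
        ENNReal.ofReal (1 + lam ^ 2)⁻¹ * eLpNorm f₃ 2 volume ^ (2 : ℝ) := fun lam => by
      rw [lintegral_shear lam (h := fun x => ‖f₃ x‖ₑ ^ (2 : ℝ)) (by fun_prop), lintegral_sq_eq]
    simp_rw [this]
    rw [lintegral_mul_const _ (by fun_prop), lintegral_inv_one_add_sq]
  simp only [e1]
  refine (ENNReal.rpow_le_rpow h zero_le_two).trans (le_of_eq ?_)
  rw [ENNReal.mul_rpow_of_nonneg _ _ zero_le_two, ← ENNReal.rpow_mul, ← ENNReal.rpow_mul, e3]
  norm_num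
  congr 1
  refine lintegral_congr fun p => ?_
  simp only [F, mul_pow]

/-- In the pointwise Cauchy-Schwarz bound the factor with f₃ no longer depends on z, so only the
factor with f₁ and f₂ has to be integrated in z. Finiteness yields both the a.e. absolute
convergence of the double integral and its membership in L². -/
theorem lintegral_lintegral_integrandT_sq_le {f₁ f₂ f₃ : Plane → ℂ} (h₁ : Measurable f₁)
    (h₂ : Measurable f₂) (h₃ : Measurable f₃) :
    ∫⁻ z, (∫⁻ p : ℝ × Plane, ‖integrandT f₁ f₂ f₃ p.1 p.2 z‖ₑ) ^ (2 : ℝ) ≤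
      ENNReal.ofReal Real.pi * (eLpNorm f₁ 2 volume ^ (2 : ℝ) * eLpNorm f₂ 2 volume ^ (2 : ℝ)) *
      (ENNReal.ofReal Real.pi * eLpNorm f₃ 2 volume ^ (2 : ℝ)) := by
  have hp := continuous_perp.measurable
  refine (lintegral_mono fun z => lintegral_integrandT_sq_le h₁ h₂ h₃ z).trans ?_
  rw [lintegral_mul_const _ (Measurable.lintegral_prod_right' (f := fun q : Plane × ℝ × Plane =>
    ‖f₁ (q.2.2 + q.1)‖ₑ ^ (2 : ℝ) * ‖f₂ (q.2.1 • perp q.2.2 + q.1)‖ₑ ^ (2 : ℝ)) (by fun_prop))]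
  gcongr
  rw [lintegral_lintegral_swap (by fun_prop), Measure.volume_eq_prod,
    lintegral_prod _ (Measurable.aemeasurable (Measurable.lintegral_prod_right'
      (f := fun q : (ℝ × Plane) × Plane =>
    ‖f₁ (q.1.2 + q.2)‖ₑ ^ (2 : ℝ) * ‖f₂ (q.1.1 • perp q.1.2 + q.2)‖ₑ ^ (2 : ℝ)) (by fun_prop)))]
  simp_rw [lintegral_pair_first _ (h₁.enorm.pow_const (2 : ℝ)) (h₂.enorm.pow_const (2 : ℝ))]
  rw [lintegral_mul_const _ (by fun_prop), lintegral_inv_one_add_sq, lintegral_sq_eq,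
    lintegral_sq_eq]

theorem measurable_integrandT' {f₁ f₂ f₃ : Plane → ℂ} (h₁ : Measurable f₁) (h₂ : Measurable f₂)
    (h₃ : Measurable f₃) :
    Measurable (fun q : Plane × ℝ × Plane => integrandT f₁ f₂ f₃ q.2.1 q.2.2 q.1) := by
  have hp := continuous_perp.measurable
  unfold integrandT
  have hc := Complex.continuous_conj.measurable
  fun_prop

theorem measurable_integrandT_slice {f₁ f₂ f₃ : Plane → ℂ} (h₁ : Measurable f₁)
    (h₂ : Measurable f₂) (h₃ : Measurable f₃) (z : Plane) :
    Measurable (fun p : ℝ × Plane => integrandT f₁ f₂ f₃ p.1 p.2 z) := by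
  have hp := continuous_perp.measurable
  unfold integrandT
  have hc := Complex.continuous_conj.measurable
  fun_prop

theorem ae_integrable_integrandT {f₁ f₂ f₃ : Plane → ℂ} (h₁ : Measurable f₁)
    (h₂ : Measurable f₂) (h₃ : Measurable f₃) (m₁ : MemLp f₁ 2 volume)
    (m₂ : MemLp f₂ 2 volume) (m₃ : MemLp f₃ 2 volume) :
    ∀ᵐ z : Plane, Integrable (fun p : ℝ × Plane => integrandT f₁ f₂ f₃ p.1 p.2 z) := by
  have h := (lintegral_lintegral_integrandT_sq_le h₁ h₂ h₃).trans_lt (ENNReal.mul_lt_top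
    (ENNReal.mul_lt_top ENNReal.ofReal_lt_top (ENNReal.mul_lt_top
      (ENNReal.rpow_lt_top_of_nonneg zero_le_two m₁.2.ne)
      (ENNReal.rpow_lt_top_of_nonneg zero_le_two m₂.2.ne)))
    (ENNReal.mul_lt_top ENNReal.ofReal_lt_top (ENNReal.rpow_lt_top_of_nonneg zero_le_two m₃.2.ne)))
  have hm := measurable_integrandT' h₁ h₂ h₃
  have h4 := ae_lt_top ((Measurable.lintegral_prod_right' hm.enorm).pow_const (2 : ℝ)) h.ne
  filter_upwards [h4] with z hz
  refine ⟨(measurable_integrandT_slice h₁ h₂ h₃ z).aestronglyMeasurable, ?_⟩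
  by_contra hcon
  rw [HasFiniteIntegral, not_lt, top_le_iff] at hcon
  simp [hcon] at hz

theorem measurable_T {f₁ f₂ f₃ : Plane → ℂ} (h₁ : Measurable f₁)
    (h₂ : Measurable f₂) (h₃ : Measurable f₃) : StronglyMeasurable (T f₁ f₂ f₃) := by
  have hm := (measurable_integrandT' h₁ h₂ h₃).comp
    (MeasurableEquiv.prodAssoc (α := Plane) (β := ℝ) (γ := Plane)).measurable
  exact hm.stronglyMeasurable.integral_prod_right'.integral_prod_right'

theorem enorm_T_le {f₁ f₂ f₃ : Plane → ℂ} (h₁ : Measurable f₁)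
    (h₂ : Measurable f₂) (h₃ : Measurable f₃) (z : Plane) :
    ‖T f₁ f₂ f₃ z‖ₑ ≤ ∫⁻ p : ℝ × Plane, ‖integrandT f₁ f₂ f₃ p.1 p.2 z‖ₑ := by
  have hm := measurable_integrandT_slice h₁ h₂ h₃ z
  rw [Measure.volume_eq_prod, lintegral_prod _ hm.enorm.aemeasurable]
  exact (enorm_integral_le_lintegral_enorm _).trans
    (lintegral_mono fun lam => enorm_integral_le_lintegral_enorm _)

theorem memLp_T {f₁ f₂ f₃ : Plane → ℂ} (h₁ : Measurable f₁)
    (h₂ : Measurable f₂) (h₃ : Measurable f₃) (m₁ : MemLp f₁ 2 volume)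
    (m₂ : MemLp f₂ 2 volume) (m₃ : MemLp f₃ 2 volume) : MemLp (T f₁ f₂ f₃) 2 volume := by
  refine ⟨(measurable_T h₁ h₂ h₃).aestronglyMeasurable, ?_⟩
  have h := (lintegral_lintegral_integrandT_sq_le h₁ h₂ h₃).trans_lt (ENNReal.mul_lt_top
    (ENNReal.mul_lt_top ENNReal.ofReal_lt_top (ENNReal.mul_lt_top
      (ENNReal.rpow_lt_top_of_nonneg zero_le_two m₁.2.ne)
      (ENNReal.rpow_lt_top_of_nonneg zero_le_two m₂.2.ne)))
    (ENNReal.mul_lt_top ENNReal.ofReal_lt_top (ENNReal.rpow_lt_top_of_nonneg zero_le_two m₃.2.ne)))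
  have h2 : ∫⁻ z, ‖T f₁ f₂ f₃ z‖ₑ ^ (2 : ℝ) < ∞ := (lintegral_mono fun z =>
    ENNReal.rpow_le_rpow (enorm_T_le h₁ h₂ h₃ z) zero_le_two).trans_lt h
  rw [lintegral_sq_eq] at h2
  by_contra hcon
  rw [not_lt, top_le_iff] at hcon
  simp [hcon] at h2

theorem energy_eq_integral {f₁ f₂ f₃ f₄ : Plane → ℂ} (h₁ : Measurable f₁)
    (h₂ : Measurable f₂) (h₃ : Measurable f₃) (h₄ : Measurable f₄) (m₁ : MemLp f₁ 2 volume)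
    (m₂ : MemLp f₂ 2 volume) (m₃ : MemLp f₃ 2 volume) (m₄ : MemLp f₄ 2 volume) :
    energy f₁ f₂ f₃ f₄ = ∫ p, integrandE f₁ f₂ f₃ f₄ p := by
  have hi := integrable_integrandE h₁ h₂ h₃ h₄ m₁ m₂ m₃ m₄
  have hpres := (volume_preserving_prodAssoc (α₁ := ℝ) (β₁ := Plane) (γ₁ := Plane))
  have hi' : Integrable (fun q : (ℝ × Plane) × Plane =>
      integrandE f₁ f₂ f₃ f₄ (MeasurableEquiv.prodAssoc q)) (volume.prod volume) :=
    (hpres.integrable_comp_emb MeasurableEquiv.prodAssoc.measurableEmbedding).2 hi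
  rw [← hpres.integral_comp MeasurableEquiv.prodAssoc.measurableEmbedding,
    Measure.volume_eq_prod, integral_prod_symm _ hi', energy]
  refine integral_congr_ae ?_
  filter_upwards [ae_integrable_integrandT h₁ h₂ h₃ m₁ m₂ m₃] with z hz
  have e : T f₁ f₂ f₃ z = ∫ p : ℝ × Plane, integrandT f₁ f₂ f₃ p.1 p.2 z := by
    rw [Measure.volume_eq_prod] at hz ⊢
    rw [integral_prod _ hz]
    rfl
  rw [e, ← integral_mul_const]
  rfl

theorem integral_integrandE {f₁ f₂ f₃ f₄ : Plane → ℂ}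
    (hi : Integrable (integrandE f₁ f₂ f₃ f₄)) :
    ∫ p, integrandE f₁ f₂ f₃ f₄ p = ∫ lam : ℝ, ∫ x : Plane, ∫ z : Plane,
      integrandT f₁ f₂ f₃ lam x z * conj (f₄ z) := by
  rw [Measure.volume_eq_prod] at hi ⊢
  rw [integral_prod _ hi]
  refine integral_congr_ae ?_
  filter_upwards [hi.prod_right_ae] with lam hlam
  rw [Measure.volume_eq_prod] at hlam ⊢
  rw [integral_prod _ hlam]
  rfl

/-! ### The quadrilinear form on `L²` -/

/-- For fixed (λ, x) the map in z is a translation, so Fubini makes preimages of null sets null.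
This is why the form is well defined on classes in L². -/
theorem quasiMeasurePreserving_add_snd {φ : ℝ → Plane → Plane}
    (hφ : Measurable (fun p : ℝ × Plane => φ p.1 p.2)) :
    Measure.QuasiMeasurePreserving (fun p : ℝ × Plane × Plane => φ p.1 p.2.1 + p.2.2) := by
  have hm : Measurable (fun p : ℝ × Plane × Plane => φ p.1 p.2.1 + p.2.2) :=
    (hφ.comp (show Measurable fun p : ℝ × Plane × Plane => (p.1, p.2.1) by fun_prop)).add
      (by fun_prop)
  refine ⟨hm, Measure.AbsolutelyContinuous.mk fun N hN h0 => ?_⟩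
  rw [Measure.map_apply hm hN, Measure.volume_eq_prod, Measure.measure_prod_null (hm hN)]
  refine Filter.Eventually.of_forall fun lam => ?_
  have hm2 : MeasurableSet (Prod.mk lam ⁻¹' ((fun p : ℝ × Plane × Plane =>
    φ p.1 p.2.1 + p.2.2) ⁻¹' N)) := measurable_prodMk_left (hm hN)
  rw [Measure.volume_eq_prod, Pi.zero_apply, Measure.measure_prod_null hm2]
  refine Filter.Eventually.of_forall fun x => ?_
  have : Prod.mk x ⁻¹' (Prod.mk lam ⁻¹' ((fun p : ℝ × Plane × Plane =>
    φ p.1 p.2.1 + p.2.2) ⁻¹' N)) = (fun z => φ lam x + z) ⁻¹' N := rfl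
  simp only [this, measure_preimage_add, h0, Pi.zero_apply]

theorem integrandE_congr {f₁ f₂ f₃ f₄ g₁ g₂ g₃ g₄ : Plane → ℂ} (h₁ : f₁ =ᵐ[volume] g₁)
    (h₂ : f₂ =ᵐ[volume] g₂) (h₃ : f₃ =ᵐ[volume] g₃) (h₄ : f₄ =ᵐ[volume] g₄) :
    integrandE f₁ f₂ f₃ f₄ =ᵐ[volume] integrandE g₁ g₂ g₃ g₄ := by
  have hp := continuous_perp.measurable
  have e₁ := (quasiMeasurePreserving_add_snd (φ := fun _ x => x) (by fun_prop)).ae_eq_comp h₁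
  have e₂ := (quasiMeasurePreserving_add_snd (φ := fun lam x => lam • perp x)
    (by fun_prop)).ae_eq_comp h₂
  have e₃ := (quasiMeasurePreserving_add_snd (φ := fun lam x => x + lam • perp x)
    (by fun_prop)).ae_eq_comp h₃
  have e₄ := (quasiMeasurePreserving_add_snd (φ := fun _ _ => 0) (by fun_prop)).ae_eq_comp h₄
  filter_upwards [e₁, e₂, e₃, e₄] with p p₁ p₂ p₃ p₄
  simp only [Function.comp_apply, zero_add] at p₁ p₂ p₃ p₄
  simp only [integrandE, integrandT, p₁, p₂, p₃, p₄]

theorem measurable_coe (f : L2) : Measurable (f : Plane → ℂ) :=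
  (Lp.stronglyMeasurable f).measurable

theorem integrable_integrandE_coe (f₁ f₂ f₃ f₄ : L2) : Integrable (integrandE f₁ f₂ f₃ f₄) :=
  integrable_integrandE (measurable_coe _) (measurable_coe _) (measurable_coe _)
    (measurable_coe _) (Lp.memLp _) (Lp.memLp _) (Lp.memLp _) (Lp.memLp _)

theorem energy_coe (f₁ f₂ f₃ f₄ : L2) : energy f₁ f₂ f₃ f₄ = ∫ p, integrandE f₁ f₂ f₃ f₄ p :=
  energy_eq_integral (measurable_coe _) (measurable_coe _) (measurable_coe _)
    (measurable_coe _) (Lp.memLp _) (Lp.memLp _) (Lp.memLp _) (Lp.memLp _)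

theorem norm_energy_le (f₁ f₂ f₃ f₄ : L2) :
    ‖energy f₁ f₂ f₃ f₄‖ ≤ Real.pi * (‖f₁‖ * ‖f₂‖ * (‖f₃‖ * ‖f₄‖)) := by
  rw [energy_coe]
  have h := (enorm_integral_le_lintegral_enorm (integrandE f₁ f₂ f₃ f₄)
    (μ := volume)).trans (lintegral_integrandE_le (measurable_coe f₁) (measurable_coe f₂)
      (measurable_coe f₃) (measurable_coe f₄))
  have hn : ∀ f : L2, eLpNorm f 2 volume = ENNReal.ofReal ‖f‖ := fun f => by
    rw [Lp.norm_def, ENNReal.ofReal_toReal (Lp.eLpNorm_ne_top f)]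
  rw [hn, hn, hn, hn, ← ofReal_norm, ← ENNReal.ofReal_mul (norm_nonneg _),
    ← ENNReal.ofReal_mul (norm_nonneg _), ← ENNReal.ofReal_mul (by positivity),
    ← ENNReal.ofReal_mul Real.pi_pos.le, ENNReal.ofReal_le_ofReal_iff (by positivity)] at h
  exact h

theorem energy_add₁ (f g f₂ f₃ f₄ : L2) :
    energy (f + g : L2) f₂ f₃ f₄ = energy f f₂ f₃ f₄ + energy g f₂ f₃ f₄ := by
  simp only [energy_coe]
  rw [← integral_add (integrable_integrandE_coe _ _ _ _) (integrable_integrandE_coe _ _ _ _)]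
  refine integral_congr_ae ((integrandE_congr (Lp.coeFn_add f g) (ae_eq_refl _) (ae_eq_refl _)
    (ae_eq_refl _)).trans (Filter.Eventually.of_forall fun p => ?_))
  simp only [integrandE, integrandT, Pi.add_apply]; ring

theorem energy_add₂ (f₁ f g f₃ f₄ : L2) :
    energy f₁ (f + g : L2) f₃ f₄ = energy f₁ f f₃ f₄ + energy f₁ g f₃ f₄ := by
  simp only [energy_coe]
  rw [← integral_add (integrable_integrandE_coe _ _ _ _) (integrable_integrandE_coe _ _ _ _)]
  refine integral_congr_ae ((integrandE_congr (ae_eq_refl _) (Lp.coeFn_add f g) (ae_eq_refl _)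
    (ae_eq_refl _)).trans (Filter.Eventually.of_forall fun p => ?_))
  simp only [integrandE, integrandT, Pi.add_apply]; ring

theorem energy_add₃ (f₁ f₂ f g f₄ : L2) :
    energy f₁ f₂ (f + g : L2) f₄ = energy f₁ f₂ f f₄ + energy f₁ f₂ g f₄ := by
  simp only [energy_coe]
  rw [← integral_add (integrable_integrandE_coe _ _ _ _) (integrable_integrandE_coe _ _ _ _)]
  refine integral_congr_ae ((integrandE_congr (ae_eq_refl _) (ae_eq_refl _) (Lp.coeFn_add f g)
    (ae_eq_refl _)).trans (Filter.Eventually.of_forall fun p => ?_))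
  simp only [integrandE, integrandT, Pi.add_apply, map_add]; ring

theorem energy_add₄ (f₁ f₂ f₃ f g : L2) :
    energy f₁ f₂ f₃ (f + g : L2) = energy f₁ f₂ f₃ f + energy f₁ f₂ f₃ g := by
  simp only [energy_coe]
  rw [← integral_add (integrable_integrandE_coe _ _ _ _) (integrable_integrandE_coe _ _ _ _)]
  refine integral_congr_ae ((integrandE_congr (ae_eq_refl _) (ae_eq_refl _) (ae_eq_refl _)
    (Lp.coeFn_add f g)).trans (Filter.Eventually.of_forall fun p => ?_))
  simp only [integrandE, integrandT, Pi.add_apply, map_add]; ring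

theorem energy_smul₁ (c : ℂ) (f f₂ f₃ f₄ : L2) :
    energy (c • f : L2) f₂ f₃ f₄ = c * energy f f₂ f₃ f₄ := by
  simp only [energy_coe]
  rw [← integral_const_mul]
  refine integral_congr_ae ((integrandE_congr (Lp.coeFn_smul c f) (ae_eq_refl _) (ae_eq_refl _)
    (ae_eq_refl _)).trans (Filter.Eventually.of_forall fun p => ?_))
  simp only [integrandE, integrandT, Pi.smul_apply, smul_eq_mul]; ring

theorem energy_smul₂ (c : ℂ) (f₁ f f₃ f₄ : L2) :
    energy f₁ (c • f : L2) f₃ f₄ = c * energy f₁ f f₃ f₄ := by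
  simp only [energy_coe]
  rw [← integral_const_mul]
  refine integral_congr_ae ((integrandE_congr (ae_eq_refl _) (Lp.coeFn_smul c f) (ae_eq_refl _)
    (ae_eq_refl _)).trans (Filter.Eventually.of_forall fun p => ?_))
  simp only [integrandE, integrandT, Pi.smul_apply, smul_eq_mul]; ring

theorem energy_smul₃ (c : ℂ) (f₁ f₂ f f₄ : L2) :
    energy f₁ f₂ (c • f : L2) f₄ = conj c * energy f₁ f₂ f f₄ := by
  simp only [energy_coe]
  rw [← integral_const_mul]
  refine integral_congr_ae ((integrandE_congr (ae_eq_refl _) (ae_eq_refl _) (Lp.coeFn_smul c f)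
    (ae_eq_refl _)).trans (Filter.Eventually.of_forall fun p => ?_))
  simp only [integrandE, integrandT, Pi.smul_apply, smul_eq_mul, map_mul]; ring

theorem energy_smul₄ (c : ℂ) (f₁ f₂ f₃ f : L2) :
    energy f₁ f₂ f₃ (c • f : L2) = conj c * energy f₁ f₂ f₃ f := by
  simp only [energy_coe]
  rw [← integral_const_mul]
  refine integral_congr_ae ((integrandE_congr (ae_eq_refl _) (ae_eq_refl _) (ae_eq_refl _)
    (Lp.coeFn_smul c f)).trans (Filter.Eventually.of_forall fun p => ?_))
  simp only [integrandE, integrandT, Pi.smul_apply, smul_eq_mul, map_mul]; ring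

end CR

namespace CR

/-! ### A Bessel-type integral depending only on the product of its parameters -/

/-- `∫₀^{2π} exp (A e^{-iθ} + B e^{iθ}) dθ`. -/
noncomputable def besselCircle (A B : ℂ) : ℂ :=
  ∫ θ in (0 : ℝ)..(2 * Real.pi), exp (A * exp (-(θ * I)) + B * exp (θ * I))

/-- The contour integral of z⁻¹ exp(A/z + Bz) over |z| = R is i times the circle integral with
parameters A/R and BR. By Cauchy's theorem on annuli around the only singularity, it does not depend
on R. -/
theorem besselCircle_radius (A B : ℂ) {r : ℝ} (hr : 0 < r) :
    besselCircle (A / r) (B * r) = besselCircle A B := by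
  have key : ∀ R : ℝ, 0 < R → (∮ z in C(0, R), (z - 0)⁻¹ • exp (A * z⁻¹ + B * z)) =
      I * besselCircle (A / R) (B * R) := by
    intro R hR
    have hR' : (R : ℂ) ≠ 0 := by exact_mod_cast hR.ne'
    rw [circleIntegral, besselCircle, ← intervalIntegral.integral_const_mul]
    refine intervalIntegral.integral_congr fun θ _ => ?_
    simp only [deriv_circleMap, circleMap, zero_add, sub_zero, smul_eq_mul]
    have he : exp (θ * I) ≠ 0 := exp_ne_zero _
    rw [Complex.exp_neg, show (R * exp (θ * I)) * I * ((R * exp (θ * I))⁻¹ *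
      exp (A * (R * exp (θ * I))⁻¹ + B * (R * exp (θ * I)))) =
      I * exp (A * (R * exp (θ * I))⁻¹ + B * (R * exp (θ * I))) by field_simp]
    congr 2
    field_simp
  have hdiff : ∀ z : ℂ, z ≠ 0 → DifferentiableAt ℂ (fun z => exp (A * z⁻¹ + B * z)) z := by
    intro z hz
    have h1 : DifferentiableAt ℂ (fun z : ℂ => z⁻¹) z := differentiableAt_inv hz
    fun_prop
  have main : ∀ a b : ℝ, 0 < a → a ≤ b →
      besselCircle (A / a) (B * a) = besselCircle (A / b) (B * b) := by
    intro a b ha hab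
    have h := Complex.circleIntegral_sub_center_inv_smul_eq_of_differentiable_on_annulus_off_countable
      (c := 0) ha hab Set.countable_empty (f := fun z => exp (A * z⁻¹ + B * z))
      (fun z hz => (hdiff z (by
        rintro rfl
        exact hz.2 (Metric.mem_ball_self ha))).continuousAt.continuousWithinAt)
      (fun z hz => hdiff z (by
        rintro rfl
        exact hz.1.2 (Metric.mem_closedBall_self ha.le)))
    rw [key a ha, key b (ha.trans_le hab)] at h
    exact (mul_left_cancel₀ I_ne_zero h).symm
  rcases le_total r 1 with h | h
  · simpa using main r 1 hr h
  · simpa using (main 1 r one_pos h).symm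

theorem besselCircle_rotate (A B : ℂ) (α : ℝ) :
    besselCircle (A * exp (-(α * I))) (B * exp (α * I)) = besselCircle A B := by
  set g : ℝ → ℂ := fun θ => exp (A * exp (-(θ * I)) + B * exp (θ * I)) with hg
  have hper : Function.Periodic g (2 * Real.pi) := by
    intro θ
    simp only [hg]
    have h1 : exp (((θ + 2 * Real.pi : ℝ) : ℂ) * I) = exp (θ * I) := by
      push_cast; rw [add_mul, Complex.exp_add, Complex.exp_two_pi_mul_I, mul_one]
    rw [Complex.exp_neg, Complex.exp_neg, h1]
  have h1 : besselCircle (A * exp (-(α * I))) (B * exp (α * I)) =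
      ∫ θ in (0 : ℝ)..(2 * Real.pi), g (θ + α) := by
    refine intervalIntegral.integral_congr fun θ _ => ?_
    simp only [hg]
    push_cast
    rw [add_mul, neg_add, Complex.exp_add (-(θ * I)), Complex.exp_add (θ * I)]
    congr 1; ring
  rw [h1, intervalIntegral.integral_comp_add_right, zero_add, add_comm,
    hper.intervalIntegral_add_eq α 0, zero_add]
  rfl

/-- Polar form of μ: the modulus is a change of radius, the argument a rotation. -/
theorem besselCircle_scale (A B : ℂ) {μ : ℂ} (hμ : μ ≠ 0) :
    besselCircle (A / μ) (B * μ) = besselCircle A B := by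
  have h1 : (μ : ℂ) = ‖μ‖ * exp (μ.arg * I) := (Complex.norm_mul_exp_arg_mul_I μ).symm
  have h2 := besselCircle_radius (A * exp (-(μ.arg * I))) (B * exp (μ.arg * I))
    (norm_pos_iff.2 hμ)
  rw [besselCircle_rotate] at h2
  rw [← h2]
  conv_lhs => rw [h1]
  congr 1
  · rw [Complex.exp_neg, div_eq_mul_inv, div_eq_mul_inv, mul_inv]; ring
  · ring

theorem besselCircle_swap (A B : ℂ) : besselCircle A B = besselCircle B A := by
  have hper : Function.Periodic (fun θ : ℝ => exp (B * exp (-(θ * I)) + A * exp (θ * I)))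
      (2 * Real.pi) := by
    intro θ
    have h1 : exp (((θ + 2 * Real.pi : ℝ) : ℂ) * I) = exp (θ * I) := by
      push_cast; rw [add_mul, Complex.exp_add, Complex.exp_two_pi_mul_I, mul_one]
    simp only [Complex.exp_neg, h1]
  set g : ℝ → ℂ := fun θ => exp (B * exp (-(θ * I)) + A * exp (θ * I)) with hg
  have h1 : besselCircle A B = ∫ θ in (0 : ℝ)..(2 * Real.pi), g (-θ) := by
    refine intervalIntegral.integral_congr fun θ _ => ?_
    simp only [hg, ofReal_neg, neg_mul, neg_neg]
    rw [add_comm]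
  rw [h1, intervalIntegral.integral_comp_neg]
  have h2 := hper.intervalIntegral_add_eq (-(2 * Real.pi)) 0
  rw [neg_add_cancel, zero_add] at h2
  rw [neg_zero, h2]
  rfl

/-- Cauchy's formula at the origin for the entire function exp(Bz). -/
theorem besselCircle_zero_left (B : ℂ) : besselCircle 0 B = 2 * Real.pi := by
  have hd : DiffContOnCl ℂ (fun z : ℂ => exp (B * z)) (Metric.ball 0 1) :=
    (Differentiable.diffContOnCl (by fun_prop))
  have h := hd.circleIntegral_sub_inv_smul (Metric.mem_ball_self one_pos)
  have key : (∮ z in C(0, 1), (z - 0)⁻¹ • exp (B * z)) = I * besselCircle 0 B := by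
    rw [circleIntegral, besselCircle, ← intervalIntegral.integral_const_mul]
    refine intervalIntegral.integral_congr fun θ _ => ?_
    simp only [deriv_circleMap, circleMap, zero_add, sub_zero, smul_eq_mul, ofReal_one, one_mul,
      zero_mul]
    have he : exp (θ * I) ≠ 0 := exp_ne_zero _
    field_simp
  rw [key] at h
  simp only [mul_zero, Complex.exp_zero, smul_eq_mul, mul_one] at h
  apply mul_left_cancel₀ I_ne_zero
  rw [h]; ring

/-- Scaling by μ = B'/B carries one pair to the other. When the product vanishes no such μ need
exist, but then both sides are 2π. -/
theorem besselCircle_eq_of_mul_eq {A B A' B' : ℂ} (h : A * B = A' * B') :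
    besselCircle A B = besselCircle A' B' := by
  have hzero : ∀ A B : ℂ, A * B = 0 → besselCircle A B = 2 * Real.pi := by
    intro A B hAB
    rcases mul_eq_zero.1 hAB with rfl | rfl
    · exact besselCircle_zero_left B
    · rw [besselCircle_swap, besselCircle_zero_left]
  by_cases h0 : A * B = 0
  · rw [hzero A B h0, hzero A' B' (h ▸ h0)]
  · have hA : A ≠ 0 := left_ne_zero_of_mul h0
    have hB : B ≠ 0 := right_ne_zero_of_mul h0
    have hB' : B' ≠ 0 := right_ne_zero_of_mul (h ▸ h0)
    rw [← besselCircle_scale A B (div_ne_zero hB' hB)]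
    congr 1
    · field_simp; rw [h]; ring
    · field_simp

/-- The Cayley transform `(1 - iλ) / (1 + iλ)`. -/
noncomputable def cayley (lam : ℝ) : ℂ := (1 - I * lam) / (1 + I * lam)

theorem one_add_I_mul_ne_zero (lam : ℝ) : (1 + I * lam : ℂ) ≠ 0 := by
  intro h; have := congrArg Complex.re h; simp at this

theorem one_sub_I_mul_ne_zero (lam : ℝ) : (1 - I * lam : ℂ) ≠ 0 := by
  intro h; have := congrArg Complex.re h; simp at this

theorem cayley_ne_zero (lam : ℝ) : cayley lam ≠ 0 :=
  div_ne_zero (one_sub_I_mul_ne_zero lam) (one_add_I_mul_ne_zero lam)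

theorem cayley_eq_exp (lam : ℝ) : cayley lam = exp (-((2 * Real.arctan lam : ℝ) * I)) := by
  have hc : (Real.cos (Real.arctan lam) : ℂ) ≠ 0 := by
    exact_mod_cast (Real.cos_arctan_pos lam).ne'
  have ht : (lam : ℂ) = Complex.sin (Real.arctan lam) / Complex.cos (Real.arctan lam) := by
    rw [← Complex.ofReal_sin, ← Complex.ofReal_cos, ← Complex.ofReal_div, ← Real.tan_eq_sin_div_cos,
      Real.tan_arctan]
  set θ := Real.arctan lam
  rw [Complex.ofReal_cos] at hc
  have e1 : exp (θ * I) = cos θ + sin θ * I := Complex.exp_mul_I _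
  have e2 : exp (-(θ * I)) = cos θ - sin θ * I := by
    rw [← neg_mul, Complex.exp_mul_I, Complex.cos_neg, Complex.sin_neg]; ring
  have e3 : exp (-((2 * θ : ℝ) * I)) = exp (-(θ * I)) / exp (θ * I) := by
    rw [← Complex.exp_sub]; congr 1; push_cast; ring
  have h1 := one_add_I_mul_ne_zero lam
  have h2 : cos (θ : ℂ) + sin θ * I ≠ 0 := by rw [← e1]; exact exp_ne_zero _
  rw [e3, e1, e2, cayley, div_eq_div_iff h1 h2, ht]
  field_simp

/-- The line version of `besselCircle`. -/
noncomputable def besselLine (A B : ℂ) : ℂ :=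
  ∫ lam : ℝ, ((1 + lam ^ 2)⁻¹ : ℝ) • exp (A * cayley lam + B * (cayley lam)⁻¹)

/-- Substitute λ = tan φ: the weight becomes dφ on (-π/2, π/2) and the Cayley transform becomes
e^{-2iφ}. The half comes from θ = 2φ. -/
theorem besselLine_eq (A B : ℂ) : besselLine A B = (1 / 2 : ℝ) • besselCircle A B := by
  set g : ℝ → ℂ := fun θ => exp (A * exp (-(θ * I)) + B * exp (θ * I)) with hg
  have hper : Function.Periodic g (2 * Real.pi) := by
    intro θ
    have h1 : exp (((θ + 2 * Real.pi : ℝ) : ℂ) * I) = exp (θ * I) := by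
      push_cast; rw [add_mul, Complex.exp_add, Complex.exp_two_pi_mul_I, mul_one]
    simp only [hg, Complex.exp_neg, h1]
  have h := integral_image_eq_integral_abs_deriv_smul MeasurableSet.univ
    (f := Real.arctan) (f' := fun x => 1 / (1 + x ^ 2))
    (fun x _ => (Real.hasDerivAt_arctan x).hasDerivWithinAt)
    Real.arctan_injective.injOn (fun θ => g (2 * θ))
  rw [Set.image_univ, Real.range_arctan, setIntegral_univ] at h
  have h2 : besselLine A B = ∫ x : ℝ, |1 / (1 + x ^ 2)| • g (2 * Real.arctan x) := by
    refine integral_congr_ae (Filter.Eventually.of_forall fun lam => ?_)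
    simp only [hg]
    rw [cayley_eq_exp, Complex.exp_neg, inv_inv, abs_of_pos (by positivity), one_div]
  rw [h2, ← h, ← integral_Ioc_eq_integral_Ioo, ← intervalIntegral.integral_of_le
    (by linarith [Real.pi_pos]), intervalIntegral.integral_comp_mul_left _ two_ne_zero]
  have h3 := hper.intervalIntegral_add_eq (2 * -(Real.pi / 2)) 0
  rw [show (2 * -(Real.pi / 2) + 2 * Real.pi) = 2 * (Real.pi / 2) by ring, zero_add] at h3
  rw [show -(Real.pi / 2) = -(Real.pi / 2) from rfl, h3, one_div]
  rfl

theorem besselLine_eq_of_mul_eq {A B A' B' : ℂ} (h : A * B = A' * B') :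
    besselLine A B = besselLine A' B' := by
  rw [besselLine_eq, besselLine_eq, besselCircle_eq_of_mul_eq h]

theorem integrable_besselLine (A B : ℂ) : Integrable (fun lam : ℝ =>
    ((1 + lam ^ 2)⁻¹ : ℝ) • exp (A * cayley lam + B * (cayley lam)⁻¹)) := by
  have hc : Continuous cayley := by
    unfold cayley
    exact Continuous.div (by fun_prop) (by fun_prop) one_add_I_mul_ne_zero
  have hci : Continuous (fun lam => (cayley lam)⁻¹) := hc.inv₀ cayley_ne_zero
  have hn : ∀ lam, ‖cayley lam‖ = 1 := fun lam => by
    rw [cayley_eq_exp, ← neg_mul, ← Complex.ofReal_neg, norm_exp_ofReal_mul_I]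
  refine (integrable_inv_one_add_sq).smul_bdd (C := Real.exp (‖A‖ + ‖B‖))
    (f := fun lam : ℝ => exp (A * cayley lam + B * (cayley lam)⁻¹)) ?_ ?_
  · exact Continuous.aestronglyMeasurable (by fun_prop)
  · refine Filter.Eventually.of_forall fun lam => (Complex.norm_exp_le_exp_norm _).trans ?_
    refine Real.exp_le_exp.2 ((norm_add_le _ _).trans ?_)
    rw [norm_mul, norm_mul, norm_inv, hn]; simp

end CR

namespace CR

/-! ### The two forms on coherent states -/

/-- The exponent common to both forms on coherent states. -/
noncomputable def cohExponent (b₁ b₂ c₃ c₄ : Fin 2 → ℂ) : ℂ :=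
  (dot b₁ b₁ + dot b₂ b₂ + dot c₃ c₃ + dot c₄ c₄ + dot (b₁ + b₂) (c₃ + c₄)) / 4

/-- The conjugated parameters enter as separate variables c₃, c₄, which makes the exponent
identities here and below polynomial or rational, free of conjugation. -/
theorem integrandE_gauss (b₁ b₂ b₃ b₄ : Fin 2 → ℂ) (c₃ c₄ : Fin 2 → ℂ)
    (h₃ : c₃ = fun i => conj (b₃ i)) (h₄ : c₄ = fun i => conj (b₄ i)) (lam : ℝ) (x z : Plane) :
    integrandT (gauss (1 / 2) b₁) (gauss (1 / 2) b₂) (gauss (1 / 2) b₃) lam x z *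
      conj (gauss (1 / 2) b₄ z) =
    exp (-(1 + lam ^ 2) * (x 0 ^ 2 + x 1 ^ 2) + (b₁ 0 + c₃ 0) * x 0 + (b₁ 1 + c₃ 1) * x 1
      + lam * ((b₂ 1 + c₃ 1) * x 0 - (b₂ 0 + c₃ 0) * x 1)) *
      gauss 2 ![b₁ 0 + b₂ 0 + c₃ 0 + c₄ 0 - 2 * (x 0 - lam * x 1),
        b₁ 1 + b₂ 1 + c₃ 1 + c₄ 1 - 2 * (x 1 + lam * x 0)] z := by
  have h2 : conj (1 / 2 : ℂ) = 1 / 2 := by simp [map_ofNat]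
  simp only [integrandT, conj_gauss, h2, ← h₃, ← h₄]
  simp only [gauss, ← Complex.exp_add, quad, normSq_plane]
  congr 1
  simp
  ring

theorem integral_z_gauss (b₁ b₂ b₃ b₄ : Fin 2 → ℂ) (c₃ c₄ : Fin 2 → ℂ)
    (h₃ : c₃ = fun i => conj (b₃ i)) (h₄ : c₄ = fun i => conj (b₄ i)) (lam : ℝ) (x : Plane) :
    ∫ z, integrandT (gauss (1 / 2) b₁) (gauss (1 / 2) b₂) (gauss (1 / 2) b₃) lam x z *
      conj (gauss (1 / 2) b₄ z) =
    (Real.pi / 2 * exp (dot (b₁ + b₂ + c₃ + c₄) (b₁ + b₂ + c₃ + c₄) / 8)) *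
      gauss ((1 + lam ^ 2) / 2)
        ![(b₁ 0 - b₂ 0 + (c₃ 0 - c₄ 0)) / 2 + lam * ((c₃ 1 - c₄ 1) - (b₁ 1 - b₂ 1)) / 2,
          (b₁ 1 - b₂ 1 + (c₃ 1 - c₄ 1)) / 2 - lam * ((c₃ 0 - c₄ 0) - (b₁ 0 - b₂ 0)) / 2] x := by
  simp_rw [integrandE_gauss b₁ b₂ b₃ b₄ c₃ c₄ h₃ h₄ lam x]
  rw [integral_const_mul, integral_gauss (by norm_num), mul_left_comm, mul_assoc,
    ← Complex.exp_add, gauss, ← Complex.exp_add]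
  congr 2
  simp only [dot, quad, normSq_plane, Pi.add_apply]
  simp
  ring

/-- The exponent left by the Gaussian integral is a quadratic polynomial in λ over 1 + λ². Since the
Cayley transform and its inverse are (1 ∓ iλ)²/(1 + λ²), it is a combination of them and a constant;
the constant is `cohExponent`. -/
theorem integral_xz_gauss (b₁ b₂ b₃ b₄ : Fin 2 → ℂ) (c₃ c₄ : Fin 2 → ℂ)
    (h₃ : c₃ = fun i => conj (b₃ i)) (h₄ : c₄ = fun i => conj (b₄ i)) (lam : ℝ) :
    ∫ x, ∫ z, integrandT (gauss (1 / 2) b₁) (gauss (1 / 2) b₂) (gauss (1 / 2) b₃) lam x z *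
      conj (gauss (1 / 2) b₄ z) =
    (Real.pi ^ 2 * exp (cohExponent b₁ b₂ c₃ c₄)) * (((1 + lam ^ 2)⁻¹ : ℝ) •
      exp ((dot (b₁ - b₂) (c₃ - c₄) + I * ((b₁ 0 - b₂ 0) * (c₃ 1 - c₄ 1) -
          (b₁ 1 - b₂ 1) * (c₃ 0 - c₄ 0))) / 8 * cayley lam +
        (dot (b₁ - b₂) (c₃ - c₄) - I * ((b₁ 0 - b₂ 0) * (c₃ 1 - c₄ 1) -
          (b₁ 1 - b₂ 1) * (c₃ 0 - c₄ 0))) / 8 * (cayley lam)⁻¹)) := by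
  simp_rw [integral_z_gauss b₁ b₂ b₃ b₄ c₃ c₄ h₃ h₄ lam]
  have hre : 0 < (((1 + lam ^ 2) / 2 : ℂ)).re := by
    have : ((1 + lam ^ 2) / 2 : ℂ) = (((1 + lam ^ 2) / 2 : ℝ) : ℂ) := by push_cast; ring
    rw [this, Complex.ofReal_re]; positivity
  rw [integral_const_mul, integral_gauss hre]
  have h1 := one_add_I_mul_ne_zero lam
  have h2 := one_sub_I_mul_ne_zero lam
  have h3 : (1 + lam ^ 2 : ℂ) = (1 + I * lam) * (1 - I * lam) := by
    linear_combination (lam : ℂ) ^ 2 * Complex.I_sq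
  have h4 : (1 + lam ^ 2 : ℂ) ≠ 0 := by rw [h3]; exact mul_ne_zero h1 h2
  have e : ∀ p₁ p₂ p₃ p₄ E₁ E₂ E₃ E₄ : ℂ, p₁ * p₂ = p₃ * p₄ → E₁ + E₂ = E₃ + E₄ →
      p₁ * exp E₁ * (p₂ * exp E₂) = p₃ * exp E₃ * (p₄ * exp E₄) := by
    intro p₁ p₂ p₃ p₄ E₁ E₂ E₃ E₄ hp hE
    rw [mul_mul_mul_comm, mul_mul_mul_comm p₃, hp, ← Complex.exp_add, ← Complex.exp_add, hE]
  rw [Complex.real_smul]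
  apply e
  · push_cast; field_simp
  · have hc1 : cayley lam = (1 - I * lam) ^ 2 / (1 + lam ^ 2) := by
      rw [cayley, h3]; field_simp
    have hc2 : (cayley lam)⁻¹ = (1 + I * lam) ^ 2 / (1 + lam ^ 2) := by
      rw [cayley, h3]; field_simp
    rw [hc2, hc1]
    simp only [dot, cohExponent, Pi.add_apply, Pi.sub_apply, Matrix.cons_val_zero,
      Matrix.cons_val_one]
    field_simp
    ring_nf
    simp only [Complex.I_sq]
    ring

theorem energy_coh (b₁ b₂ b₃ b₄ : Fin 2 → ℂ) (c₃ c₄ : Fin 2 → ℂ)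
    (h₃ : c₃ = fun i => conj (b₃ i)) (h₄ : c₄ = fun i => conj (b₄ i)) :
    energy (coh b₁) (coh b₂) (coh b₃) (coh b₄) =
      (Real.pi ^ 2 * exp (cohExponent b₁ b₂ c₃ c₄)) *
        besselLine (-dot (b₁ - b₂) (b₁ - b₂) / 8) (-dot (c₃ - c₄) (c₃ - c₄) / 8) := by
  have hae := integrandE_congr (coeFn_coh b₁) (coeFn_coh b₂) (coeFn_coh b₃) (coeFn_coh b₄)
  rw [energy_coe, integral_congr_ae hae,
    integral_integrandE ((integrable_integrandE_coe _ _ _ _).congr hae)]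
  simp_rw [integral_xz_gauss b₁ b₂ b₃ b₄ c₃ c₄ h₃ h₄]
  rw [integral_const_mul]
  congr 1
  -- With u = b₁ - b₂ and v = c₃ - c₄, the product of the old parameters is ((u·v)² + (u×v)²)/64,
  -- which the Lagrange identity turns into (u·u)(v·v)/64.
  refine besselLine_eq_of_mul_eq ?_
  simp only [dot, Pi.sub_apply]
  ring_nf
  simp only [Complex.I_sq]
  ring

theorem conj_qt (t : ℝ) : conj (qt t) = qt (-t) := by
  simp [qt, map_ofNat]

theorem qt_add_qt_neg (t : ℝ) : qt t + qt (-t) = 2 * (qt t * qt (-t)) := by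
  have h1 := one_add_ne_zero t
  have h2 := one_add_ne_zero (-t)
  simp only [qt]
  field_simp
  push_cast
  ring

theorem qt_mul_qt_neg (t : ℝ) : qt t * qt (-t) = (((1 + 4 * t ^ 2)⁻¹ : ℝ) : ℂ) := by
  have h1 := one_add_ne_zero t
  have h2 := one_add_ne_zero (-t)
  have h3 : (1 + 4 * t ^ 2 : ℂ) = (1 + 2 * I * t) * (1 + 2 * I * (-t : ℝ)) := by
    push_cast; linear_combination 4 * (t : ℂ) ^ 2 * Complex.I_sq
  push_cast
  rw [h3, qt, qt, mul_inv]

theorem freeCoh_quartic (b₁ b₂ b₃ b₄ : Fin 2 → ℂ) (c₃ c₄ : Fin 2 → ℂ)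
    (h₃ : c₃ = fun i => conj (b₃ i)) (h₄ : c₄ = fun i => conj (b₄ i)) (t : ℝ) (x : Plane) :
    freeCoh b₁ t x * freeCoh b₂ t x * conj (freeCoh b₃ t x) * conj (freeCoh b₄ t x) =
      ((qt t * qt (-t)) ^ 2 * exp (qt t * (I * t * (dot b₁ b₁ + dot b₂ b₂)) -
        qt (-t) * (I * t * (dot c₃ c₃ + dot c₄ c₄)))) *
        gauss (qt t + qt (-t)) (fun i => qt t * (b₁ i + b₂ i) + qt (-t) * (c₃ i + c₄ i)) x := by
  have hb3 : ∀ i, conj (b₃ i) = c₃ i := fun i => by rw [h₃]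
  have hb4 : ∀ i, conj (b₄ i) = c₄ i := fun i => by rw [h₄]
  have e : ∀ p₁ p₂ E₁ E₂ E₃ E₄ F₁ F₂ F₃ F₄ E F : ℂ,
      E₁ + E₂ + E₃ + E₄ + (F₁ + F₂ + F₃ + F₄) = E + F →
      p₁ * exp E₁ * exp F₁ * (p₁ * exp E₂ * exp F₂) * (p₂ * exp E₃ * exp F₃) *
        (p₂ * exp E₄ * exp F₄) = ((p₁ * p₂) ^ 2 * exp E) * exp F := by
    intro p₁ p₂ E₁ E₂ E₃ E₄ F₁ F₂ F₃ F₄ E F h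
    rw [mul_assoc ((p₁ * p₂) ^ 2), ← Complex.exp_add, ← h]
    simp only [Complex.exp_add]
    ring
  simp only [freeCoh, map_mul, ← Complex.exp_conj, conj_gauss, conj_qt, map_div₀, map_ofNat,
    Complex.conj_I, Complex.conj_ofReal, dot, map_add, hb3, hb4]
  simp only [gauss]
  apply e
  simp only [quad]
  ring

/-- The same constant exponent and the same weight appear as for `energy`, at λ = 2t. Here u·u and
v·v separate, one multiplying the Cayley transform and the other its inverse. -/
theorem integral_freeCoh_quartic (b₁ b₂ b₃ b₄ : Fin 2 → ℂ) (c₃ c₄ : Fin 2 → ℂ)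
    (h₃ : c₃ = fun i => conj (b₃ i)) (h₄ : c₄ = fun i => conj (b₄ i)) (t : ℝ) :
    ∫ x, freeCoh b₁ t x * freeCoh b₂ t x * conj (freeCoh b₃ t x) * conj (freeCoh b₄ t x) =
      (Real.pi / 2 * exp (cohExponent b₁ b₂ c₃ c₄)) * (((1 + (2 * t) ^ 2)⁻¹ : ℝ) •
        exp (-dot (b₁ - b₂) (b₁ - b₂) / 8 * cayley (2 * t) +
          -dot (c₃ - c₄) (c₃ - c₄) / 8 * (cayley (2 * t))⁻¹)) := by
  simp_rw [freeCoh_quartic b₁ b₂ b₃ b₄ c₃ c₄ h₃ h₄ t]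
  have hre : 0 < (qt t + qt (-t)).re := by
    rw [Complex.add_re]; exact add_pos (re_qt_pos t) (re_qt_pos (-t))
  rw [integral_const_mul, integral_gauss hre]
  have h1 := one_add_ne_zero t
  have h2 : (1 - 2 * I * t : ℂ) ≠ 0 := by
    have := one_add_ne_zero (-t); push_cast at this; rwa [mul_neg, ← sub_eq_add_neg] at this
  have e : ∀ p₁ p₂ p₃ p₄ E₁ E₂ E₃ E₄ : ℂ, p₁ * p₂ = p₃ * p₄ → E₁ + E₂ = E₃ + E₄ →
      p₁ * exp E₁ * (p₂ * exp E₂) = p₃ * exp E₃ * (p₄ * exp E₄) := by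
    intro p₁ p₂ p₃ p₄ E₁ E₂ E₃ E₄ hp hE
    rw [mul_mul_mul_comm, mul_mul_mul_comm p₃, hp, ← Complex.exp_add, ← Complex.exp_add, hE]
  rw [Complex.real_smul]
  apply e
  · rw [qt_add_qt_neg, show (1 + (2 * t) ^ 2)⁻¹ = (1 + 4 * t ^ 2)⁻¹ by ring, ← qt_mul_qt_neg]
    have := qt_ne_zero t
    have := qt_ne_zero (-t)
    field_simp
  · have hq1 : qt t = (1 + 2 * I * t)⁻¹ := rfl
    have hq2 : qt (-t) = (1 - 2 * I * t)⁻¹ := by rw [qt]; push_cast; ring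
    have hc1 : cayley (2 * t) = (1 - 2 * I * t) / (1 + 2 * I * t) := by
      rw [cayley]; push_cast; ring
    have hsum : qt t + qt (-t) = 2 / ((1 + 2 * I * t) * (1 - 2 * I * t)) := by
      rw [qt_add_qt_neg, hq1, hq2]; field_simp
    rw [hsum, hc1, hq1, hq2]
    simp only [dot, cohExponent, Pi.add_apply, Pi.sub_apply]
    field_simp
    ring_nf

end CR

namespace CR

/-! ### Jointly measurable representatives of the free evolution -/

theorem eLpNorm_two_eq (f : L2) : eLpNorm f 2 volume = ENNReal.ofReal ‖f‖ := by
  rw [Lp.norm_def, ENNReal.ofReal_toReal (Lp.eLpNorm_ne_top f)]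

/-- At a geometric rate the squared errors are summable, hence finite in sum almost everywhere, and
no subsequence is extracted. This matters because the unitary evolution preserves the rate, so one
sequence serves all times at once. -/
theorem ae_tendsto_of_norm_le_pow {g : ℕ → L2} {h : L2}
    (hg : ∀ n, ‖g n - h‖ ≤ (1 / 2) ^ n) :
    ∀ᵐ x, Filter.Tendsto (fun n => g n x) Filter.atTop (nhds (h x)) := by
  have h1 : ∀ n, ∫⁻ x, ‖(g n - h : L2) x‖ₑ ^ (2 : ℝ) ≤ ENNReal.ofReal ((1 / 2) ^ n) := by
    intro n
    rw [lintegral_sq_eq, eLpNorm_two_eq,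
      ENNReal.ofReal_rpow_of_nonneg (norm_nonneg _) zero_le_two]
    refine ENNReal.ofReal_le_ofReal ?_
    have h2 := hg n
    have h3 : (1 / 2 : ℝ) ^ n ≤ 1 := pow_le_one₀ (by norm_num) (by norm_num)
    have h4 := norm_nonneg (g n - h)
    rw [Real.rpow_two]
    nlinarith
  have h2 : ∫⁻ x, ∑' n, ‖(g n - h : L2) x‖ₑ ^ (2 : ℝ) < ∞ := by
    rw [lintegral_tsum fun n => ((measurable_coe _).enorm.pow_const _).aemeasurable]
    refine (ENNReal.tsum_le_tsum h1).trans_lt ?_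
    rw [← ENNReal.ofReal_tsum_of_nonneg (fun n => by positivity) summable_geometric_two]
    exact ENNReal.ofReal_lt_top
  have h3 := ae_lt_top (Measurable.tsum fun n =>
    ((measurable_coe (g n - h)).enorm.pow_const (2 : ℝ))) h2.ne
  have h4 : ∀ᵐ x, ∀ n, (g n - h : L2) x = g n x - h x :=
    ae_all_iff.2 fun n => Lp.coeFn_sub (g n) h
  filter_upwards [h3, h4] with x hx hx4
  have h5 := ENNReal.tendsto_atTop_zero_of_tsum_ne_top hx.ne
  have h6 : Filter.Tendsto (fun n => ‖g n x - h x‖ₑ) Filter.atTop (nhds 0) := by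
    have h7 := (ENNReal.continuous_rpow_const (y := (1 / 2 : ℝ))).tendsto 0 |>.comp h5
    simp only [Function.comp_def, ← ENNReal.rpow_mul] at h7
    norm_num at h7
    refine h7.congr fun n => ?_
    exact congrArg _ (hx4 n)
  rw [tendsto_iff_norm_sub_tendsto_zero]
  have h8 := (ENNReal.tendsto_toReal ENNReal.zero_ne_top).comp h6
  simpa [Function.comp_def] using h8

/-- The span of the coherent states. -/
noncomputable abbrev cohSpan : Submodule ℂ L2 := Submodule.span ℂ (Set.range coh)

theorem exists_seq_cohSpan (f : L2) :
    ∃ g : ℕ → L2, (∀ n, g n ∈ cohSpan) ∧ ∀ n, ‖g n - f‖ ≤ (1 / 2) ^ n := by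
  have h : ∀ n : ℕ, ∃ g ∈ cohSpan, ‖g - f‖ ≤ (1 / 2) ^ n := by
    intro n
    obtain ⟨g, hg, hd⟩ := dense_span_coh.exists_dist_lt f (ε := (1 / 2) ^ n) (by positivity)
    refine ⟨g, hg, ?_⟩
    rw [← dist_eq_norm, dist_comm]; exact hd.le
  choose g hg using h
  exact ⟨g, fun n => (hg n).1, fun n => (hg n).2⟩

theorem exists_rep_of_mem_cohSpan {f : L2} (hf : f ∈ cohSpan) :
    ∃ u : ℝ × Plane → ℂ, Measurable u ∧ ∀ t, (fun x => u (t, x)) =ᵐ[volume] freeGroup t f := by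
  induction hf using Submodule.span_induction with
  | mem x hx =>
    obtain ⟨b, rfl⟩ := hx
    exact ⟨_, (continuous_freeCoh b).measurable, fun t => (coeFn_freeGroup_coh t b).symm⟩
  | zero =>
    refine ⟨0, measurable_zero, fun t => ?_⟩
    have : freeGroup t 0 = 0 := (freeLI t).map_zero
    rw [this]
    filter_upwards [Lp.coeFn_zero ℂ 2 (volume : Measure Plane)] with x hx
    rw [hx]; rfl
  | add f g _ _ hf hg =>
    obtain ⟨u, hu, hu'⟩ := hf
    obtain ⟨v, hv, hv'⟩ := hg
    refine ⟨u + v, hu.add hv, fun t => ?_⟩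
    rw [freeGroup_add_apply]
    filter_upwards [hu' t, hv' t, Lp.coeFn_add (freeGroup t f) (freeGroup t g)] with x h1 h2 h3
    rw [h3, Pi.add_apply, Pi.add_apply, h1, h2]
  | smul c f _ hf =>
    obtain ⟨u, hu, hu'⟩ := hf
    refine ⟨c • u, hu.const_smul c, fun t => ?_⟩
    rw [freeGroup_smul]
    filter_upwards [hu' t, Lp.coeFn_smul c (freeGroup t f)] with x h1 h3
    rw [h3, Pi.smul_apply, Pi.smul_apply, h1]

/-- For each t the evolution is only a class modulo null sets, whereas Fubini in (t, x) needs a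
jointly measurable function. On the span of coherent states the explicit formula supplies one; in
general a pointwise limit does. -/
theorem exists_rep (f : L2) :
    ∃ u : ℝ × Plane → ℂ, Measurable u ∧ ∀ t, (fun x => u (t, x)) =ᵐ[volume] freeGroup t f := by
  obtain ⟨g, hg, hgf⟩ := exists_seq_cohSpan f
  choose u hu hu' using fun n => exists_rep_of_mem_cohSpan (hg n)
  -- Where the sequence diverges `limUnder` takes an arbitrary value; for each t this happens only
  -- on a null set of x.
  refine ⟨fun p => Filter.limUnder Filter.atTop (fun n => u n p),
    (StronglyMeasurable.limUnder fun n => (hu n).stronglyMeasurable).measurable, fun t => ?_⟩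
  have h1 := ae_tendsto_of_norm_le_pow (g := fun n => freeGroup t (g n)) (h := freeGroup t f)
    (fun n => by rw [← freeGroup_sub, norm_freeGroup]; exact hgf n)
  filter_upwards [h1, ae_all_iff.2 fun n => hu' n t] with x hx hx'
  simp only [hx']
  exact hx.limUnder_eq

/-- A jointly measurable version of `(t, x) ↦ (e^{itΔ} f)(x)`. -/
noncomputable def rep (f : L2) : ℝ × Plane → ℂ := Classical.choose (exists_rep f)

theorem measurable_rep (f : L2) : Measurable (rep f) := (Classical.choose_spec (exists_rep f)).1

theorem rep_ae (f : L2) (t : ℝ) : (fun x => rep f (t, x)) =ᵐ[volume] freeGroup t f :=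
  (Classical.choose_spec (exists_rep f)).2 t

theorem ae_eq_of_slices {u v : ℝ × Plane → ℂ} (hu : Measurable u) (hv : Measurable v)
    (h : ∀ t, (fun x => u (t, x)) =ᵐ[volume] fun x => v (t, x)) : u =ᵐ[volume] v := by
  rw [Measure.volume_eq_prod]
  exact (Measure.ae_prod_iff_ae_ae (measurableSet_eq_fun hu hv)).2
    (Filter.Eventually.of_forall h)

theorem rep_coh (b : Fin 2 → ℂ) : rep (coh b) =ᵐ[volume] fun p => freeCoh b p.1 p.2 :=
  ae_eq_of_slices (measurable_rep _) (continuous_freeCoh b).measurable fun t =>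
    (rep_ae _ t).trans (coeFn_freeGroup_coh t b)

theorem rep_add (f g : L2) : rep (f + g) =ᵐ[volume] rep f + rep g := by
  refine ae_eq_of_slices (measurable_rep _) ((measurable_rep f).add (measurable_rep g)) fun t => ?_
  filter_upwards [rep_ae (f + g) t, rep_ae f t, rep_ae g t,
    Lp.coeFn_add (freeGroup t f) (freeGroup t g)] with x h1 h2 h3 h4
  rw [h1, freeGroup_add_apply, h4, Pi.add_apply, Pi.add_apply, h2, h3]

theorem rep_smul (c : ℂ) (f : L2) : rep (c • f) =ᵐ[volume] c • rep f := by
  refine ae_eq_of_slices (measurable_rep _) ((measurable_rep f).const_smul c) fun t => ?_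
  filter_upwards [rep_ae (c • f) t, rep_ae f t,
    Lp.coeFn_smul c (freeGroup t f)] with x h1 h2 h4
  rw [h1, freeGroup_smul, h4, Pi.smul_apply, Pi.smul_apply, h2]

theorem rep_zero : rep 0 =ᵐ[volume] 0 := by
  have := rep_smul 0 0
  rw [zero_smul, zero_smul] at this; exact this

theorem exists_seq_rep_tendsto (f : L2) : ∃ g : ℕ → L2, (∀ n, g n ∈ cohSpan) ∧
    Filter.Tendsto g Filter.atTop (nhds f) ∧
    ∀ᵐ p, Filter.Tendsto (fun n => rep (g n) p) Filter.atTop (nhds (rep f p)) := by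
  obtain ⟨g, hg, hgf⟩ := exists_seq_cohSpan f
  refine ⟨g, hg, ?_, ?_⟩
  · rw [tendsto_iff_norm_sub_tendsto_zero]
    exact squeeze_zero (fun n => norm_nonneg _) hgf
      (tendsto_pow_atTop_nhds_zero_of_lt_one (by norm_num) (by norm_num))
  · rw [Measure.volume_eq_prod, Measure.ae_prod_iff_ae_ae]
    · refine Filter.Eventually.of_forall fun t => ?_
      have h1 := ae_tendsto_of_norm_le_pow (g := fun n => freeGroup t (g n)) (h := freeGroup t f)
        (fun n => by rw [← freeGroup_sub, norm_freeGroup]; exact hgf n)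
      filter_upwards [h1, ae_all_iff.2 fun n => rep_ae (g n) t, rep_ae f t] with x hx hx' hx2
      simp only [hx', hx2]
      exact hx
    · exact measurableSet_tendsto_fun (fun n => measurable_rep _) (measurable_rep f)

/-! ### The space-time quartic form -/

/-- The product `u₁ u₂ conj(u₃) conj(u₄)`. -/
noncomputable def quartic {α : Type*} (u₁ u₂ u₃ u₄ : α → ℂ) (p : α) : ℂ :=
  u₁ p * u₂ p * conj (u₃ p) * conj (u₄ p)

instance holderTriple_four : ENNReal.HolderTriple 4 4 2 where
  inv_add_inv_eq_inv := by
    rw [← two_mul, show (4 : ℝ≥0∞) = 2 * 2 by norm_num, ENNReal.mul_inv (by simp) (by simp),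
      ← mul_assoc, ENNReal.mul_inv_cancel two_ne_zero ENNReal.ofNat_ne_top, one_mul]

theorem memLp_conj {α : Type*} [MeasurableSpace α] {μ : Measure α} {p : ℝ≥0∞} {u : α → ℂ}
    (h : MemLp u p μ) : MemLp (fun x => conj (u x)) p μ :=
  h.star

theorem eLpNorm_conj {α : Type*} [MeasurableSpace α] {μ : Measure α} {p : ℝ≥0∞} (u : α → ℂ) :
    eLpNorm (fun x => conj (u x)) p μ = eLpNorm u p μ :=
  eLpNorm_congr_norm_ae (Filter.Eventually.of_forall fun x => by simp)

section
variable {α : Type*} [MeasurableSpace α] {μ : Measure α} {u₁ u₂ u₃ u₄ : α → ℂ}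

theorem integrable_quartic (h₁ : MemLp u₁ 4 μ) (h₂ : MemLp u₂ 4 μ)
    (h₃ : MemLp u₃ 4 μ) (h₄ : MemLp u₄ 4 μ) : Integrable (quartic u₁ u₂ u₃ u₄) μ := by
  have a : MemLp (fun x => u₁ x * u₂ x) 2 μ := h₂.mul' h₁
  have b : MemLp (fun x => conj (u₃ x) * conj (u₄ x)) 2 μ := (memLp_conj h₄).mul' (memLp_conj h₃)
  refine (a.integrable_mul b).congr (Filter.Eventually.of_forall fun x => ?_)
  simp only [quartic, Pi.mul_apply]; ring

/-- Hölder with exponents 4, 4 inside each pair and 2, 2 between the pairs. -/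
theorem lintegral_quartic_le (h₁ : AEStronglyMeasurable u₁ μ) (h₂ : AEStronglyMeasurable u₂ μ)
    (h₃ : AEStronglyMeasurable u₃ μ) (h₄ : AEStronglyMeasurable u₄ μ) :
    ∫⁻ x, ‖quartic u₁ u₂ u₃ u₄ x‖ₑ ∂μ ≤
      eLpNorm u₁ 4 μ * eLpNorm u₂ 4 μ * (eLpNorm u₃ 4 μ * eLpNorm u₄ 4 μ) := by
  have hc : ∀ {u : α → ℂ}, AEStronglyMeasurable u μ →
      AEStronglyMeasurable (fun x => conj (u x)) μ := fun h =>
    Complex.continuous_conj.comp_aestronglyMeasurable h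
  have a := eLpNorm_smul_le_mul_eLpNorm (p := 4) (q := 4) (r := 2) h₂ h₁
  have b := eLpNorm_smul_le_mul_eLpNorm (p := 4) (q := 4) (r := 2) (hc h₄) (hc h₃)
  have c := eLpNorm_smul_le_mul_eLpNorm (p := 2) (q := 2) (r := 1)
    ((hc h₃).smul (hc h₄)) (h₁.smul h₂)
  rw [eLpNorm_conj, eLpNorm_conj] at b
  rw [eLpNorm_one_eq_lintegral_enorm] at c
  refine le_trans (le_of_eq (lintegral_congr fun x => ?_)) (c.trans (mul_le_mul' a b))
  simp [quartic, mul_assoc]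

end

theorem quartic_congr {α : Type*} [MeasurableSpace α] {μ : Measure α}
    {u₁ u₂ u₃ u₄ v₁ v₂ v₃ v₄ : α → ℂ} (h₁ : u₁ =ᵐ[μ] v₁)
    (h₂ : u₂ =ᵐ[μ] v₂) (h₃ : u₃ =ᵐ[μ] v₃) (h₄ : u₄ =ᵐ[μ] v₄) :
    quartic u₁ u₂ u₃ u₄ =ᵐ[μ] quartic v₁ v₂ v₃ v₄ := by
  filter_upwards [h₁, h₂, h₃, h₄] with x p₁ p₂ p₃ p₄
  simp only [quartic, p₁, p₂, p₃, p₄]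

/-- The space-time integral of `u₁ u₂ conj(u₃) conj(u₄)`, `uᵢ = e^{itΔ} fᵢ`. -/
noncomputable def strForm (f₁ f₂ f₃ f₄ : L2) : ℂ :=
  ∫ p, quartic (rep f₁) (rep f₂) (rep f₃) (rep f₄) p

/-- Finiteness of the `L⁴` space-time norm. -/
def FiniteL4 (f : L2) : Prop := MemLp (rep f) 4 volume

theorem FiniteL4.add {f g : L2} (hf : FiniteL4 f) (hg : FiniteL4 g) : FiniteL4 (f + g) :=
  (memLp_congr_ae (rep_add f g)).2 (MemLp.add hf hg)

theorem FiniteL4.smul {f : L2} (c : ℂ) (hf : FiniteL4 f) : FiniteL4 (c • f) :=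
  (memLp_congr_ae (rep_smul c f)).2 (MemLp.const_smul hf c)

theorem strForm_add₁ {f g f₂ f₃ f₄ : L2} (hf : FiniteL4 f) (hg : FiniteL4 g) (h₂ : FiniteL4 f₂)
    (h₃ : FiniteL4 f₃) (h₄ : FiniteL4 f₄) :
    strForm (f + g) f₂ f₃ f₄ = strForm f f₂ f₃ f₄ + strForm g f₂ f₃ f₄ := by
  simp only [strForm]
  rw [← integral_add (integrable_quartic hf h₂ h₃ h₄) (integrable_quartic hg h₂ h₃ h₄)]
  refine integral_congr_ae ((quartic_congr (rep_add f g) (ae_eq_refl _) (ae_eq_refl _)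
    (ae_eq_refl _)).trans (Filter.Eventually.of_forall fun p => ?_))
  simp only [quartic, Pi.add_apply]; ring

theorem strForm_add₂ {f₁ f g f₃ f₄ : L2} (h₁ : FiniteL4 f₁) (hf : FiniteL4 f) (hg : FiniteL4 g)
    (h₃ : FiniteL4 f₃) (h₄ : FiniteL4 f₄) :
    strForm f₁ (f + g) f₃ f₄ = strForm f₁ f f₃ f₄ + strForm f₁ g f₃ f₄ := by
  simp only [strForm]
  rw [← integral_add (integrable_quartic h₁ hf h₃ h₄) (integrable_quartic h₁ hg h₃ h₄)]
  refine integral_congr_ae ((quartic_congr (ae_eq_refl _) (rep_add f g) (ae_eq_refl _)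
    (ae_eq_refl _)).trans (Filter.Eventually.of_forall fun p => ?_))
  simp only [quartic, Pi.add_apply]; ring

theorem strForm_add₃ {f₁ f₂ f g f₄ : L2} (h₁ : FiniteL4 f₁) (h₂ : FiniteL4 f₂) (hf : FiniteL4 f)
    (hg : FiniteL4 g) (h₄ : FiniteL4 f₄) :
    strForm f₁ f₂ (f + g) f₄ = strForm f₁ f₂ f f₄ + strForm f₁ f₂ g f₄ := by
  simp only [strForm]
  rw [← integral_add (integrable_quartic h₁ h₂ hf h₄) (integrable_quartic h₁ h₂ hg h₄)]
  refine integral_congr_ae ((quartic_congr (ae_eq_refl _) (ae_eq_refl _) (rep_add f g)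
    (ae_eq_refl _)).trans (Filter.Eventually.of_forall fun p => ?_))
  simp only [quartic, Pi.add_apply, map_add]; ring

theorem strForm_add₄ {f₁ f₂ f₃ f g : L2} (h₁ : FiniteL4 f₁) (h₂ : FiniteL4 f₂) (h₃ : FiniteL4 f₃)
    (hf : FiniteL4 f) (hg : FiniteL4 g) :
    strForm f₁ f₂ f₃ (f + g) = strForm f₁ f₂ f₃ f + strForm f₁ f₂ f₃ g := by
  simp only [strForm]
  rw [← integral_add (integrable_quartic h₁ h₂ h₃ hf) (integrable_quartic h₁ h₂ h₃ hg)]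
  refine integral_congr_ae ((quartic_congr (ae_eq_refl _) (ae_eq_refl _) (ae_eq_refl _)
    (rep_add f g)).trans (Filter.Eventually.of_forall fun p => ?_))
  simp only [quartic, Pi.add_apply, map_add]; ring

theorem strForm_smul₁ (c : ℂ) (f f₂ f₃ f₄ : L2) :
    strForm (c • f) f₂ f₃ f₄ = c * strForm f f₂ f₃ f₄ := by
  simp only [strForm]
  rw [← integral_const_mul]
  refine integral_congr_ae ((quartic_congr (rep_smul c f) (ae_eq_refl _) (ae_eq_refl _)
    (ae_eq_refl _)).trans (Filter.Eventually.of_forall fun p => ?_))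
  simp only [quartic, Pi.smul_apply, smul_eq_mul]; ring

theorem strForm_smul₂ (c : ℂ) (f₁ f f₃ f₄ : L2) :
    strForm f₁ (c • f) f₃ f₄ = c * strForm f₁ f f₃ f₄ := by
  simp only [strForm]
  rw [← integral_const_mul]
  refine integral_congr_ae ((quartic_congr (ae_eq_refl _) (rep_smul c f) (ae_eq_refl _)
    (ae_eq_refl _)).trans (Filter.Eventually.of_forall fun p => ?_))
  simp only [quartic, Pi.smul_apply, smul_eq_mul]; ring

theorem strForm_smul₃ (c : ℂ) (f₁ f₂ f f₄ : L2) :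
    strForm f₁ f₂ (c • f) f₄ = conj c * strForm f₁ f₂ f f₄ := by
  simp only [strForm]
  rw [← integral_const_mul]
  refine integral_congr_ae ((quartic_congr (ae_eq_refl _) (ae_eq_refl _) (rep_smul c f)
    (ae_eq_refl _)).trans (Filter.Eventually.of_forall fun p => ?_))
  simp only [quartic, Pi.smul_apply, smul_eq_mul, map_mul]; ring

theorem strForm_smul₄ (c : ℂ) (f₁ f₂ f₃ f : L2) :
    strForm f₁ f₂ f₃ (c • f) = conj c * strForm f₁ f₂ f₃ f := by
  simp only [strForm]
  rw [← integral_const_mul]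
  refine integral_congr_ae ((quartic_congr (ae_eq_refl _) (ae_eq_refl _) (ae_eq_refl _)
    (rep_smul c f)).trans (Filter.Eventually.of_forall fun p => ?_))
  simp only [quartic, Pi.smul_apply, smul_eq_mul, map_mul]; ring

end CR

namespace CR

/-! ### The quartic identity and the `L⁴` Strichartz estimate -/

theorem memLp_freeCoh_slice (b : Fin 2 → ℂ) (t : ℝ) (p : ℝ≥0∞) :
    MemLp (freeCoh b t) p volume :=
  (memLp_gauss (re_qt_half_pos t) (fun i => qt t * b i) p).const_mul _

theorem quartic_self {α : Type*} (u : α → ℂ) (p : α) :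
    quartic u u u u p = ((‖u p‖ ^ 4 : ℝ) : ℂ) := by
  have h := Complex.mul_conj' (u p)
  simp only [quartic]
  push_cast
  linear_combination (u p * conj (u p) + (‖u p‖ : ℂ) ^ 2) * h

theorem memLp_four_of_integrable_quartic {α : Type*} [MeasurableSpace α] {μ : Measure α}
    {u : α → ℂ} (hu : AEStronglyMeasurable u μ) (h : Integrable (quartic u u u u) μ) :
    MemLp u 4 μ := by
  rw [← integrable_norm_rpow_iff hu (by norm_num) (by norm_num)]
  refine h.norm.congr (Filter.Eventually.of_forall fun x => ?_)
  simp only [quartic_self, Complex.norm_real, Real.norm_eq_abs, abs_pow, abs_norm]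
  rw [← Real.rpow_natCast]; norm_num

theorem integrable_freeCoh_quartic_line (b₁ b₂ b₃ b₄ : Fin 2 → ℂ) : Integrable (fun t : ℝ =>
    ∫ x, freeCoh b₁ t x * freeCoh b₂ t x * conj (freeCoh b₃ t x) * conj (freeCoh b₄ t x)) := by
  simp_rw [integral_freeCoh_quartic b₁ b₂ b₃ b₄ _ _ rfl rfl]
  exact ((integrable_besselLine _ _).comp_mul_left' two_ne_zero).const_mul _

/-- With four equal factors the quartic product is |u|⁴, and its space integral is explicit: a
constant times the integrand of `besselLine` at λ = 2t, which is integrable in time. -/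
theorem memLp_freeCoh (b : Fin 2 → ℂ) :
    MemLp (fun p : ℝ × Plane => freeCoh b p.1 p.2) 4 volume := by
  have hc := continuous_freeCoh b
  refine memLp_four_of_integrable_quartic hc.aestronglyMeasurable ?_
  have hq : Continuous (quartic (fun p : ℝ × Plane => freeCoh b p.1 p.2)
      (fun p : ℝ × Plane => freeCoh b p.1 p.2) (fun p : ℝ × Plane => freeCoh b p.1 p.2)
      (fun p : ℝ × Plane => freeCoh b p.1 p.2)) := by
    unfold quartic
    exact ((hc.mul hc).mul (Complex.continuous_conj.comp hc)).mul (Complex.continuous_conj.comp hc)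
  rw [Measure.volume_eq_prod, integrable_prod_iff hq.aestronglyMeasurable]
  constructor
  · refine Filter.Eventually.of_forall fun t => ?_
    have := memLp_freeCoh_slice b t 4
    exact integrable_quartic this this this this
  · refine (integrable_freeCoh_quartic_line b b b b).norm.congr
      (Filter.Eventually.of_forall fun t => ?_)
    have h1 : ∀ x, freeCoh b t x * freeCoh b t x * conj (freeCoh b t x) * conj (freeCoh b t x) =
        ((‖freeCoh b t x‖ ^ 4 : ℝ) : ℂ) := fun x => quartic_self (freeCoh b t) x
    simp only [h1, quartic_self, integral_complex_ofReal, Complex.norm_real, Real.norm_eq_abs,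
      abs_pow, abs_norm]
    rw [abs_of_nonneg (integral_nonneg fun x => by positivity)]

theorem finiteL4_coh (b : Fin 2 → ℂ) : FiniteL4 (coh b) :=
  (memLp_congr_ae (rep_coh b)).2 (memLp_freeCoh b)

/-- The substitution λ = 2t costs a factor 1/2, and 4π · (π/2) · (1/2) = π² is the prefactor found
for `energy`. -/
theorem strForm_coh (b₁ b₂ b₃ b₄ : Fin 2 → ℂ) :
    energy (coh b₁) (coh b₂) (coh b₃) (coh b₄) =
      4 * Real.pi * strForm (coh b₁) (coh b₂) (coh b₃) (coh b₄) := by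
  have hae := quartic_congr (rep_coh b₁) (rep_coh b₂) (rep_coh b₃) (rep_coh b₄)
  have hi := integrable_quartic (memLp_freeCoh b₁) (memLp_freeCoh b₂) (memLp_freeCoh b₃)
    (memLp_freeCoh b₄)
  rw [energy_coh b₁ b₂ b₃ b₄ _ _ rfl rfl, strForm, integral_congr_ae hae]
  rw [Measure.volume_eq_prod] at hi ⊢
  rw [integral_prod _ hi]
  simp only [quartic]
  simp_rw [integral_freeCoh_quartic b₁ b₂ b₃ b₄ _ _ rfl rfl]
  rw [integral_const_mul]
  have h := Measure.integral_comp_mul_left (fun lam : ℝ => ((1 + lam ^ 2)⁻¹ : ℝ) •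
    exp (-dot (b₁ - b₂) (b₁ - b₂) / 8 * cayley lam +
      -dot ((fun i => conj (b₃ i)) - fun i => conj (b₄ i))
        ((fun i => conj (b₃ i)) - fun i => conj (b₄ i)) / 8 * (cayley lam)⁻¹)) 2
  rw [h, besselLine, abs_of_pos (by norm_num : (0 : ℝ) < 2⁻¹), Complex.real_smul]
  push_cast
  ring

theorem finiteL4_of_mem_cohSpan {f : L2} (hf : f ∈ cohSpan) : FiniteL4 f := by
  induction hf using Submodule.span_induction with
  | mem x hx => obtain ⟨b, rfl⟩ := hx; exact finiteL4_coh b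
  | zero => exact (memLp_congr_ae rep_zero).2 MemLp.zero
  | add f g _ _ hf hg => exact hf.add hg
  | smul c f _ hf => exact hf.smul c

/-- The slots are freed one at a time by (anti)linearity. Additivity of the space-time form needs
finite L⁴ norms, which at this stage are known only on the span; this is why the extension to L² has
to wait. -/
theorem energy_eq_strForm_of_mem_cohSpan {f₁ f₂ f₃ f₄ : L2} (h₁ : f₁ ∈ cohSpan)
    (h₂ : f₂ ∈ cohSpan) (h₃ : f₃ ∈ cohSpan) (h₄ : f₄ ∈ cohSpan) :
    energy f₁ f₂ f₃ f₄ = 4 * Real.pi * strForm f₁ f₂ f₃ f₄ := by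
  have L := @finiteL4_of_mem_cohSpan
  have L' := @finiteL4_coh
  have s₁ : ∀ b₂ b₃ b₄, energy f₁ (coh b₂) (coh b₃) (coh b₄) =
      4 * Real.pi * strForm f₁ (coh b₂) (coh b₃) (coh b₄) := by
    intro b₂ b₃ b₄
    induction h₁ using Submodule.span_induction with
    | mem x hx => obtain ⟨b, rfl⟩ := hx; exact strForm_coh _ _ _ _
    | zero => rw [← zero_smul ℂ (0 : L2), energy_smul₁, strForm_smul₁]; simp
    | add f g mf mg hf hg =>
      rw [energy_add₁, strForm_add₁ (L mf) (L mg) (L' _) (L' _) (L' _), hf, hg]; ring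
    | smul c f _ hf => rw [energy_smul₁, strForm_smul₁, hf]; ring
  have s₂ : ∀ b₃ b₄, energy f₁ f₂ (coh b₃) (coh b₄) =
      4 * Real.pi * strForm f₁ f₂ (coh b₃) (coh b₄) := by
    intro b₃ b₄
    induction h₂ using Submodule.span_induction with
    | mem x hx => obtain ⟨b, rfl⟩ := hx; exact s₁ _ _ _
    | zero => rw [← zero_smul ℂ (0 : L2), energy_smul₂, strForm_smul₂]; simp
    | add f g mf mg hf hg =>
      rw [energy_add₂, strForm_add₂ (L h₁) (L mf) (L mg) (L' _) (L' _), hf, hg]; ring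
    | smul c f _ hf => rw [energy_smul₂, strForm_smul₂, hf]; ring
  have s₃ : ∀ b₄, energy f₁ f₂ f₃ (coh b₄) =
      4 * Real.pi * strForm f₁ f₂ f₃ (coh b₄) := by
    intro b₄
    induction h₃ using Submodule.span_induction with
    | mem x hx => obtain ⟨b, rfl⟩ := hx; exact s₂ _ _
    | zero => rw [← zero_smul ℂ (0 : L2), energy_smul₃, strForm_smul₃]; simp
    | add f g mf mg hf hg =>
      rw [energy_add₃, strForm_add₃ (L h₁) (L h₂) (L mf) (L mg) (L' _), hf, hg]; ring
    | smul c f _ hf => rw [energy_smul₃, strForm_smul₃, hf]; ring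
  induction h₄ using Submodule.span_induction with
  | mem x hx => obtain ⟨b, rfl⟩ := hx; exact s₃ _
  | zero => rw [← zero_smul ℂ (0 : L2), energy_smul₄, strForm_smul₄]; simp
  | add f g mf mg hf hg =>
    rw [energy_add₄, strForm_add₄ (L h₁) (L h₂) (L h₃) (L mf) (L mg), hf, hg]; ring
  | smul c f _ hf => rw [energy_smul₄, strForm_smul₄, hf]; ring

/-- For equal arguments the identity reads 4π‖u‖₄⁴ = `energy` ≤ π‖f‖⁴. The Strichartz estimate thus
comes from the elementary bound on `energy`; the constant 1 is not optimal. -/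
theorem eLpNorm_rep_le_of_mem_cohSpan {f : L2} (hf : f ∈ cohSpan) :
    eLpNorm (rep f) 4 volume ≤ ENNReal.ofReal ‖f‖ := by
  have h4 := finiteL4_of_mem_cohSpan hf
  have h := energy_eq_strForm_of_mem_cohSpan hf hf hf hf
  have hn := norm_energy_le f f f f
  have hs : strForm f f f f = ((∫ p, ‖rep f p‖ ^ 4 : ℝ) : ℂ) := by
    simp only [strForm, quartic_self, integral_complex_ofReal]
  rw [h, hs, norm_mul, norm_mul, Complex.norm_real, Complex.norm_real, Real.norm_eq_abs,
    Real.norm_eq_abs, abs_of_pos Real.pi_pos,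
    abs_of_nonneg (integral_nonneg fun p => by positivity)] at hn
  have hI : ∫ p, ‖rep f p‖ ^ 4 ≤ ‖f‖ ^ 4 := by
    have h0 : 0 ≤ ‖f‖ ^ 4 := by positivity
    have : Real.pi * (4 * ∫ p, ‖rep f p‖ ^ 4) ≤ Real.pi * ‖f‖ ^ 4 := by
      norm_num at hn; linarith
    have := le_of_mul_le_mul_left this Real.pi_pos
    have h1 : 0 ≤ ∫ p, ‖rep f p‖ ^ 4 := integral_nonneg fun p => by positivity
    linarith
  rw [h4.eLpNorm_eq_integral_rpow_norm (by norm_num) (by norm_num)]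
  refine ENNReal.ofReal_le_ofReal ?_
  have e : ∫ p, ‖rep f p‖ ^ (4 : ℝ≥0∞).toReal = ∫ p, ‖rep f p‖ ^ 4 := by
    congr 1; ext p; rw [← Real.rpow_natCast]; norm_num
  rw [e]
  calc (∫ p, ‖rep f p‖ ^ 4) ^ ((4 : ℝ≥0∞).toReal⁻¹) ≤ (‖f‖ ^ 4) ^ ((4 : ℝ≥0∞).toReal⁻¹) :=
        Real.rpow_le_rpow (integral_nonneg fun p => by positivity) hI (by positivity)
    _ = ‖f‖ := by
        rw [← Real.rpow_natCast, ← Real.rpow_mul (norm_nonneg _)]; norm_num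

/-- Fatou along a sequence from the span whose evolutions converge almost everywhere in space-time.
-/
theorem eLpNorm_rep_le (f : L2) : eLpNorm (rep f) 4 volume ≤ ENNReal.ofReal ‖f‖ := by
  obtain ⟨g, hg, hlim, hae⟩ := exists_seq_rep_tendsto f
  refine (Lp.eLpNorm_lim_le_liminf_eLpNorm (fun n => (measurable_rep (g n)).aestronglyMeasurable)
    _ hae).trans ?_
  have h1 : Filter.Tendsto (fun n => ENNReal.ofReal ‖g n‖) Filter.atTop
      (nhds (ENNReal.ofReal ‖f‖)) := ENNReal.tendsto_ofReal hlim.norm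
  rw [← h1.liminf_eq]
  exact Filter.liminf_le_liminf (Filter.Eventually.of_forall fun n =>
    eLpNorm_rep_le_of_mem_cohSpan (hg n))

theorem finiteL4 (f : L2) : FiniteL4 f :=
  ⟨(measurable_rep f).aestronglyMeasurable, (eLpNorm_rep_le f).trans_lt ENNReal.ofReal_lt_top⟩

theorem norm_strForm_le (f₁ f₂ f₃ f₄ : L2) :
    ‖strForm f₁ f₂ f₃ f₄‖ ≤ ‖f₁‖ * ‖f₂‖ * (‖f₃‖ * ‖f₄‖) := by
  have m := fun f => (measurable_rep f).aestronglyMeasurable (μ := volume)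
  have h := (enorm_integral_le_lintegral_enorm (μ := volume)
    (quartic (rep f₁) (rep f₂) (rep f₃) (rep f₄))).trans
    ((lintegral_quartic_le (m f₁) (m f₂) (m f₃) (m f₄)).trans (mul_le_mul'
      (mul_le_mul' (eLpNorm_rep_le f₁) (eLpNorm_rep_le f₂))
      (mul_le_mul' (eLpNorm_rep_le f₃) (eLpNorm_rep_le f₄))))
  rw [← ofReal_norm, ← ENNReal.ofReal_mul (norm_nonneg _),
    ← ENNReal.ofReal_mul (norm_nonneg _), ← ENNReal.ofReal_mul (by positivity),
    ENNReal.ofReal_le_ofReal_iff (by positivity)] at h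
  exact h

/-- Now both forms are bounded on L², so their difference vanishes by density, one slot after
another. The criterion `eq_zero_of_coh` asks only that zeros be stable under scalars, so it also
covers the two antilinear slots. -/
theorem energy_eq_strForm (f₁ f₂ f₃ f₄ : L2) :
    energy f₁ f₂ f₃ f₄ = 4 * Real.pi * strForm f₁ f₂ f₃ f₄ := by
  have L := finiteL4
  -- 5π is π from `energy` plus 4π from the space-time form.
  have bd : ∀ f₁ f₂ f₃ f₄ : L2, ‖energy f₁ f₂ f₃ f₄ - 4 * Real.pi * strForm f₁ f₂ f₃ f₄‖ ≤
      5 * Real.pi * (‖f₁‖ * ‖f₂‖ * (‖f₃‖ * ‖f₄‖)) := by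
    intro f₁ f₂ f₃ f₄
    have h1 := norm_energy_le f₁ f₂ f₃ f₄
    have h2 := norm_strForm_le f₁ f₂ f₃ f₄
    refine (norm_sub_le _ _).trans ?_
    rw [norm_mul, norm_mul, Complex.norm_real, Real.norm_eq_abs, abs_of_pos Real.pi_pos]
    norm_num
    nlinarith [Real.pi_pos]
  have s₁ : ∀ (b₂ b₃ b₄ : Fin 2 → ℂ) (f₁ : L2), energy f₁ (coh b₂) (coh b₃) (coh b₄) -
      4 * Real.pi * strForm f₁ (coh b₂) (coh b₃) (coh b₄) = 0 := by
    intro b₂ b₃ b₄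
    refine eq_zero_of_coh (fun f g => ?_) (fun c f h => ?_)
      (5 * Real.pi * (‖coh b₂‖ * (‖coh b₃‖ * ‖coh b₄‖))) (fun f => ?_) (fun b => ?_)
    · rw [energy_add₁, strForm_add₁ (L _) (L _) (L _) (L _) (L _)]; ring
    · rw [energy_smul₁, strForm_smul₁]; linear_combination c * h
    · refine (bd _ _ _ _).trans (le_of_eq (by ring))
    · rw [strForm_coh, sub_self]
  have s₂ : ∀ (f₁ : L2) (b₃ b₄ : Fin 2 → ℂ) (f₂ : L2), energy f₁ f₂ (coh b₃) (coh b₄) -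
      4 * Real.pi * strForm f₁ f₂ (coh b₃) (coh b₄) = 0 := by
    intro f₁ b₃ b₄
    refine eq_zero_of_coh (fun f g => ?_) (fun c f h => ?_)
      (5 * Real.pi * (‖f₁‖ * (‖coh b₃‖ * ‖coh b₄‖))) (fun f => ?_) (fun b => s₁ _ _ _ _)
    · rw [energy_add₂, strForm_add₂ (L _) (L _) (L _) (L _) (L _)]; ring
    · rw [energy_smul₂, strForm_smul₂]; linear_combination c * h
    · refine (bd _ _ _ _).trans (le_of_eq (by ring))
  have s₃ : ∀ (f₁ f₂ : L2) (b₄ : Fin 2 → ℂ) (f₃ : L2), energy f₁ f₂ f₃ (coh b₄) -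
      4 * Real.pi * strForm f₁ f₂ f₃ (coh b₄) = 0 := by
    intro f₁ f₂ b₄
    refine eq_zero_of_coh (fun f g => ?_) (fun c f h => ?_)
      (5 * Real.pi * (‖f₁‖ * (‖f₂‖ * ‖coh b₄‖))) (fun f => ?_) (fun b => s₂ _ _ _ _)
    · rw [energy_add₃, strForm_add₃ (L _) (L _) (L _) (L _) (L _)]; ring
    · rw [energy_smul₃, strForm_smul₃]; linear_combination conj c * h
    · refine (bd _ _ _ _).trans (le_of_eq (by ring))
  refine sub_eq_zero.1 (eq_zero_of_coh (φ := fun f₄ => energy f₁ f₂ f₃ f₄ -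
    4 * Real.pi * strForm f₁ f₂ f₃ f₄) (fun f g => ?_) (fun c f h => ?_)
      (5 * Real.pi * (‖f₁‖ * (‖f₂‖ * ‖f₃‖))) (fun f => ?_) (fun b => s₃ _ _ _ _) f₄)
  · rw [energy_add₄, strForm_add₄ (L _) (L _) (L _) (L _) (L _)]; ring
  · rw [energy_smul₄, strForm_smul₄]; linear_combination conj c * h
  · refine (bd _ _ _ _).trans (le_of_eq (by ring))

end CR

namespace CR

/-! ### The dispersive estimate -/

/-- The free Schrödinger kernel `(4πit)⁻¹ exp (i|x|²/4t)`. -/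
noncomputable def freeKernel (t : ℝ) (x : Plane) : ℂ :=
  (4 * Real.pi * I * t)⁻¹ * exp (((‖x‖ ^ 2 / (4 * t) : ℝ) : ℂ) * I)

theorem continuous_freeKernel (t : ℝ) : Continuous (freeKernel t) := by
  unfold freeKernel; fun_prop

theorem norm_freeKernel (t : ℝ) (x : Plane) : ‖freeKernel t x‖ = (4 * Real.pi * |t|)⁻¹ := by
  rw [freeKernel, norm_mul, norm_exp_ofReal_mul_I, mul_one, norm_inv]
  simp [abs_of_pos Real.pi_pos]

/-- The oscillating kernel shifts the Gaussian parameter to 1/2 - i/(4t) = (1 + 2it)/(4it). Its real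
part is still 1/2, so the Gaussian integral formula applies. -/
theorem integral_gauss_mul_freeKernel {t : ℝ} (ht : t ≠ 0) (b : Fin 2 → ℂ) (y : Plane) :
    ∫ x, gauss (1 / 2) b x * freeKernel t (x - y) = freeCoh b t y := by
  have ht' : (t : ℂ) ≠ 0 := by exact_mod_cast ht
  have hpi : (Real.pi : ℂ) ≠ 0 := by exact_mod_cast Real.pi_ne_zero
  have hsplit : ∀ x, gauss (1 / 2) b x * freeKernel t (x - y) =
      ((4 * Real.pi * I * t)⁻¹ * exp (I / (4 * t) * (y 0 ^ 2 + y 1 ^ 2))) *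
      gauss (1 / 2 - I / (4 * t)) (fun i => b i - I / (2 * t) * y i) x := by
    intro x
    rw [freeKernel, gauss, gauss, mul_left_comm, ← Complex.exp_add, mul_assoc (_)⁻¹,
      ← Complex.exp_add]
    congr 2
    simp only [quad, normSq_plane, PiLp.sub_apply]
    push_cast
    field_simp
    ring
  have hre : 0 < (1 / 2 - I / (4 * t) : ℂ).re := by
    have : (I / (4 * t) : ℂ) = ((1 / (4 * t) : ℝ) : ℂ) * I := by push_cast; ring
    rw [this, Complex.sub_re, Complex.re_ofReal_mul]; simp
  simp_rw [hsplit]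
  rw [integral_const_mul, integral_gauss hre]
  have h1 := one_add_ne_zero t
  have hI : (I : ℂ) ≠ 0 := I_ne_zero
  have hI3 : (I : ℂ)⁻¹ = -I := Complex.inv_I
  have hden : (1 / 2 - I / (4 * t) : ℂ) = (1 + 2 * I * t) / (4 * t * I) := by
    field_simp
    linear_combination (-2 : ℂ) * Complex.I_sq
  have e : ∀ p₁ p₂ p₃ E₁ E₂ E₃ E₄ : ℂ, p₁ * p₂ = p₃ → E₁ + E₂ = E₃ + E₄ →
      p₁ * exp E₁ * (p₂ * exp E₂) = p₃ * exp E₃ * exp E₄ := by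
    intro p₁ p₂ p₃ E₁ E₂ E₃ E₄ hp hE
    rw [mul_mul_mul_comm, hp, ← Complex.exp_add, hE, Complex.exp_add, mul_assoc]
  rw [freeCoh, gauss, hden]
  apply e
  · rw [qt]; field_simp
  · have hu : qt t * (1 + 2 * I * t) = 1 := inv_mul_cancel₀ h1
    have hd : ∀ d : ℂ, d / (4 * ((1 + 2 * I * t) / (4 * t * I))) = d * (qt t * t * I) := by
      intro d; rw [qt]; field_simp
    rw [hd]
    simp only [quad, dot, normSq_plane]
    push_cast
    linear_combination (norm := (field_simp; ring)) (-(I / (4 * t)) *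
      ((y 0 : ℂ) ^ 2 + (y 1 : ℂ) ^ 2)) * hu + (-qt t * (b 0 * y 0 + b 1 * y 1) +
        (I * qt t / (4 * t) + qt t / 2) * ((y 0 : ℂ) ^ 2 + (y 1 : ℂ) ^ 2)) * Complex.I_sq

/-- The convolution with the free kernel. -/
noncomputable def freeConv (t : ℝ) (a : Plane → ℂ) (x : Plane) : ℂ :=
  ∫ y, freeKernel t (x - y) * a y

theorem norm_freeConv_le (t : ℝ) (a : Plane → ℂ) (x : Plane) :
    ‖freeConv t a x‖ ≤ (4 * Real.pi * |t|)⁻¹ * ∫ y, ‖a y‖ := by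
  rw [← integral_const_mul]
  refine (norm_integral_le_integral_norm _).trans (le_of_eq ?_)
  simp only [norm_mul, norm_freeKernel]

theorem stronglyMeasurable_freeConv (t : ℝ) {a : Plane → ℂ} (ha : Measurable a) :
    StronglyMeasurable (freeConv t a) := by
  have hk := (continuous_freeKernel t).measurable
  have : Measurable (fun p : Plane × Plane => freeKernel t (p.1 - p.2) * a p.2) := by fun_prop
  exact this.stronglyMeasurable.integral_prod_right'

/-- Gaussian moments determine a function, so it suffices to test against Gaussians. On one side the
evolution moves to the Gaussian by duality, on the other the kernel does by Fubini, and both give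
the explicit evolved coherent state. -/
theorem freeGroup_ae_eq_freeConv {t : ℝ} (ht : t ≠ 0) (a : L2) (ha : Integrable a) :
    freeGroup t a =ᵐ[volume] freeConv t a := by
  have hm := stronglyMeasurable_freeConv t (measurable_coe a)
  have hkm := (continuous_freeKernel t).measurable
  have hi1 : ∀ b, Integrable (fun x => gauss (1 / 2) b x * freeGroup t a x) := fun b =>
    MemLp.integrable_mul (memLp_gauss (by norm_num) b 2) (Lp.memLp (freeGroup t a))
  have hi2 : ∀ b, Integrable (fun x => gauss (1 / 2) b x * freeConv t a x) := fun b =>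
    (integrable_gauss (a := 1 / 2) (by norm_num) b).mul_of_top_left
      (memLp_top_of_bound hm.aestronglyMeasurable _
        (Filter.Eventually.of_forall (norm_freeConv_le t a)))
  have h0 : (fun x => freeGroup t a x - freeConv t a x) =ᵐ[volume] 0 := by
    refine ae_eq_zero_of_integral_gauss_mul ?_ fun b => ?_
    · simp only [mul_sub]; exact (hi1 0).sub (hi2 0)
    · simp only [mul_sub]
      rw [integral_sub (hi1 b) (hi2 b), sub_eq_zero]
      have e1 : ∫ x, gauss (1 / 2) b x * freeGroup t a x = ∫ y, freeCoh b t y * a y := by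
        have h := inner_coh_left (fun i => conj (b i)) (freeGroup t a)
        simp only [Complex.conj_conj] at h
        rw [← h]
        have h2 := inner_freeGroup (-t) (coh fun i => conj (b i)) a
        rw [neg_neg] at h2
        rw [← h2, L2.inner_def]
        refine integral_congr_ae ?_
        filter_upwards [coeFn_freeGroup_coh (-t) (fun i => conj (b i))] with x hx
        rw [RCLike.inner_apply, hx, mul_comm]
        congr 1
        simp only [freeCoh, map_mul, ← Complex.exp_conj, conj_gauss, conj_qt, map_div₀, map_ofNat,
          Complex.conj_I, Complex.conj_ofReal, dot, map_add, Complex.conj_conj, neg_neg]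
        push_cast
        ring_nf
      rw [e1]
      have hint : Integrable (fun p : Plane × Plane =>
          gauss (1 / 2) b p.1 * (freeKernel t (p.1 - p.2) * a p.2)) (volume.prod volume) := by
        have h1 := (integrable_gauss (a := 1 / 2) (by norm_num) b).mul_prod ha
        have h2 := h1.mul_of_top_left (memLp_top_of_bound
          (f := fun p : Plane × Plane => freeKernel t (p.1 - p.2))
          (Measurable.aestronglyMeasurable (by fun_prop)) _
          (Filter.Eventually.of_forall fun p => (norm_freeKernel t _).le))
        refine h2.congr (Filter.Eventually.of_forall fun p => ?_)
        simp only [Pi.mul_apply]; ring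
      have e2 : ∀ x, gauss (1 / 2) b x * freeConv t a x =
          ∫ y, gauss (1 / 2) b x * (freeKernel t (x - y) * a y) := fun x => by
        rw [freeConv, integral_const_mul]
      simp_rw [e2]
      rw [integral_integral_swap hint]
      refine integral_congr_ae (Filter.Eventually.of_forall fun y => ?_)
      simp only
      rw [← integral_gauss_mul_freeKernel ht b y, ← integral_mul_const]
      congr 1; ext x; ring
  filter_upwards [h0] with x hx
  exact sub_eq_zero.1 hx

theorem ae_norm_freeGroup_le {t : ℝ} (ht : t ≠ 0) (a : L2) (ha : Integrable a) :
    ∀ᵐ x, ‖freeGroup t a x‖ ≤ (4 * Real.pi * |t|)⁻¹ * ∫ y, ‖a y‖ := by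
  filter_upwards [freeGroup_ae_eq_freeConv ht a ha] with x hx
  rw [hx]; exact norm_freeConv_le t a x

end CR

namespace CR

/-! ### The interpolated dispersive estimate -/

/-- The level-set half of a Marcinkiewicz interpolation. Cut a at a height depending on α: the large
part is in L¹ and by dispersion evolves to something at most α/2, so only the small part can exceed
α/2, and Chebyshev in L² counts where. -/
theorem measure_level_le {t : ℝ} (ht : t ≠ 0) (a : L2) {M : ℝ} (hM : 0 < M)
    (hMa : ∫⁻ x, ‖a x‖ₑ ^ (6 / 5 : ℝ) ≤ ENNReal.ofReal M) {α : ℝ} (hα : 0 < α) :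
    volume {x | α < ‖freeGroup t a x‖} ≤ ENNReal.ofReal (4 / α ^ 2) *
      ∫⁻ x, {x | ‖a x‖ ≤ (2 * (4 * Real.pi * |t|)⁻¹ * M / α) ^ 5}.indicator
        (fun x => ‖a x‖ₑ ^ (2 : ℝ)) x := by
  have hpi := Real.pi_pos
  have htp : 0 < |t| := abs_pos.2 ht
  set D := (4 * Real.pi * |t|)⁻¹ with hD
  have hDp : 0 < D := by positivity
  -- Where |a| > β⁵ one has |a| ≤ β⁻¹|a|^{6/5}, so the large part has L¹ norm at most M/β. This β
  -- makes the dispersive bound DM/β equal to α/2.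
  set β := 2 * D * M / α with hβ
  have hβp : 0 < β := by positivity
  set s := {x | ‖a x‖ ≤ β ^ 5} with hs
  have hsm : MeasurableSet s := measurableSet_le (measurable_coe a).norm measurable_const
  have m₁ : MemLp (sᶜ.indicator a) 2 volume := (Lp.memLp a).indicator hsm.compl
  have m₂ : MemLp (s.indicator a) 2 volume := (Lp.memLp a).indicator hsm
  set a₁ : L2 := m₁.toLp _
  set a₂ : L2 := m₂.toLp _
  have hsum : a = a₁ + a₂ := by
    apply Lp.ext
    filter_upwards [m₁.coeFn_toLp, m₂.coeFn_toLp, Lp.coeFn_add a₁ a₂] with x h1 h2 h3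
    rw [h3, Pi.add_apply, h1, h2, add_comm]
    exact (congrFun (Set.indicator_self_add_compl s a) x).symm
  have hpt : ∀ x, ‖sᶜ.indicator a x‖ₑ ≤ ENNReal.ofReal β⁻¹ * ‖a x‖ₑ ^ (6 / 5 : ℝ) := by
    intro x
    by_cases hx : x ∈ s
    · simp [hx]
    · have hx' : β ^ 5 < ‖a x‖ := not_le.1 hx
      have hr : 0 < ‖a x‖ := lt_trans (by positivity) hx'
      rw [Set.indicator_of_mem (by exact hx), ← ofReal_norm,
        ENNReal.ofReal_rpow_of_nonneg (norm_nonneg _) (by norm_num),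
        ← ENNReal.ofReal_mul (by positivity)]
      refine ENNReal.ofReal_le_ofReal ?_
      have h1 : β ≤ ‖a x‖ ^ (1 / 5 : ℝ) := by
        have h2 : (β ^ 5) ^ (1 / 5 : ℝ) ≤ ‖a x‖ ^ (1 / 5 : ℝ) :=
          Real.rpow_le_rpow (by positivity) hx'.le (by norm_num)
        rwa [← Real.rpow_natCast, ← Real.rpow_mul hβp.le,
          show ((5 : ℕ) : ℝ) * (1 / 5) = 1 by norm_num, Real.rpow_one] at h2
      have h3 : ‖a x‖ ^ (6 / 5 : ℝ) = ‖a x‖ * ‖a x‖ ^ (1 / 5 : ℝ) := by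
        rw [show (6 / 5 : ℝ) = 1 + 1 / 5 by norm_num, Real.rpow_add hr, Real.rpow_one]
      rw [h3, inv_mul_eq_div, le_div_iff₀ hβp]
      gcongr
  have hint : ∫⁻ x, ‖sᶜ.indicator a x‖ₑ ≤ ENNReal.ofReal (β⁻¹ * M) := by
    refine (lintegral_mono hpt).trans ?_
    rw [lintegral_const_mul _ ((measurable_coe a).enorm.pow_const _),
      ENNReal.ofReal_mul (by positivity)]
    gcongr
  have i₁ : Integrable (sᶜ.indicator a) :=
    ⟨m₁.1, hint.trans_lt ENNReal.ofReal_lt_top⟩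
  have i₁' : Integrable a₁ := i₁.congr m₁.coeFn_toLp.symm
  have hn₁ : ∫ x, ‖a₁ x‖ ≤ β⁻¹ * M := by
    rw [integral_norm_eq_lintegral_enorm i₁'.1]
    refine ENNReal.toReal_le_of_le_ofReal (by positivity) (le_trans (le_of_eq ?_) hint)
    refine lintegral_congr_ae ?_
    filter_upwards [m₁.coeFn_toLp] with x hx
    rw [hx]
  have hb₁ : ∀ᵐ x, ‖freeGroup t a₁ x‖ ≤ α / 2 := by
    filter_upwards [ae_norm_freeGroup_le ht a₁ i₁'] with x hx
    refine hx.trans ?_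
    calc D * ∫ y, ‖a₁ y‖ ≤ D * (β⁻¹ * M) := by gcongr
      _ = α / 2 := by rw [hβ]; field_simp
  have hsub : {x | α < ‖freeGroup t a x‖} ≤ᵐ[volume]
      {x | ENNReal.ofReal ((α / 2) ^ 2) ≤ ‖freeGroup t a₂ x‖ₑ ^ (2 : ℝ)} := by
    have hadd := Lp.coeFn_add (freeGroup t a₁) (freeGroup t a₂)
    rw [← freeGroup_add_apply, ← hsum] at hadd
    filter_upwards [hb₁, hadd] with x h1 h2
    intro (hx : α < ‖freeGroup t a x‖)
    show ENNReal.ofReal ((α / 2) ^ 2) ≤ ‖freeGroup t a₂ x‖ₑ ^ (2 : ℝ)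
    rw [h2, Pi.add_apply] at hx
    have h3 : α / 2 ≤ ‖freeGroup t a₂ x‖ := by
      have := norm_add_le (freeGroup t a₁ x) (freeGroup t a₂ x)
      linarith
    rw [← ofReal_norm, ENNReal.ofReal_rpow_of_nonneg (norm_nonneg _) zero_le_two, Real.rpow_two]
    exact ENNReal.ofReal_le_ofReal (by gcongr)
  have hcheb := mul_meas_ge_le_lintegral (μ := (volume : Measure Plane))
    ((measurable_coe (freeGroup t a₂)).enorm.pow_const (2 : ℝ)) (ENNReal.ofReal ((α / 2) ^ 2))
  have hL2 : ∫⁻ x, ‖freeGroup t a₂ x‖ₑ ^ (2 : ℝ) =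
      ∫⁻ x, s.indicator (fun x => ‖a x‖ₑ ^ (2 : ℝ)) x := by
    rw [lintegral_sq_eq, eLpNorm_two_eq, norm_freeGroup, ← eLpNorm_two_eq, ← lintegral_sq_eq]
    refine lintegral_congr_ae ?_
    filter_upwards [m₂.coeFn_toLp] with x hx
    rw [hx]
    by_cases h : x ∈ s <;> simp [h]
  rw [hL2] at hcheb
  refine (measure_mono_ae hsub).trans ?_
  have h4 : ENNReal.ofReal (4 / α ^ 2) * ENNReal.ofReal ((α / 2) ^ 2) = 1 := by
    rw [← ENNReal.ofReal_mul (by positivity), ← ENNReal.ofReal_one]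
    congr 1; field_simp; norm_num
  calc volume {x | ENNReal.ofReal ((α / 2) ^ 2) ≤ ‖freeGroup t a₂ x‖ₑ ^ (2 : ℝ)}
      = ENNReal.ofReal (4 / α ^ 2) * (ENNReal.ofReal ((α / 2) ^ 2) *
        volume {x | ENNReal.ofReal ((α / 2) ^ 2) ≤ ‖freeGroup t a₂ x‖ₑ ^ (2 : ℝ)}) := by
        rw [← mul_assoc, h4, one_mul]
    _ ≤ _ := by gcongr

theorem lintegral_cube_le {c : ℝ} (hc : 0 ≤ c) :
    ∫⁻ α in Set.Ioi (0 : ℝ), (if α ≤ c then ENNReal.ofReal (4 * α ^ 3) else 0) =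
      ENNReal.ofReal (c ^ 4) := by
  have h1 : ∀ α : ℝ, (if α ≤ c then ENNReal.ofReal (4 * α ^ 3) else 0) =
      (Set.Iic c).indicator (fun α => ENNReal.ofReal (4 * α ^ 3)) α := fun α => by
    simp [Set.indicator_apply]
  simp_rw [h1]
  rw [setLIntegral_indicator measurableSet_Iic, Set.inter_comm, Set.Ioi_inter_Iic,
    ← ofReal_integral_eq_lintegral_ofReal, ← intervalIntegral.integral_of_le hc,
    intervalIntegral.integral_const_mul, integral_pow]
  · congr 1; norm_num; ring
  · exact (Continuous.integrableOn_Icc (by fun_prop)).mono_set Set.Ioc_subset_Icc_self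
  · filter_upwards [ae_restrict_mem measurableSet_Ioc] with α hα
    have := hα.1
    simp only [Pi.zero_apply]; positivity

/-- Insert the level-set bound into the layer cake formula with weight 6α⁵ and exchange the
integrals. The α-integral at x gives (2DM)⁴|a|^{-4/5}, which turns |a|² into |a|^{6/5}; the constant
is 6 · 2⁴ = 96. -/
theorem lintegral_freeGroup_rpow_six_le {t : ℝ} (ht : t ≠ 0) (a : L2) {M : ℝ} (hM : 0 < M)
    (hMa : ∫⁻ x, ‖a x‖ₑ ^ (6 / 5 : ℝ) ≤ ENNReal.ofReal M) :
    ∫⁻ x, ‖freeGroup t a x‖ₑ ^ (6 : ℝ) ≤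
      ENNReal.ofReal (96 * (4 * Real.pi * |t|)⁻¹ ^ 4 * M ^ 5) := by
  have hpi := Real.pi_pos
  have htp : 0 < |t| := abs_pos.2 ht
  set D := (4 * Real.pi * |t|)⁻¹ with hD
  have hDp : 0 < D := by positivity
  have ham := measurable_coe a
  have h1 := lintegral_rpow_eq_lintegral_meas_lt_mul (volume : Measure Plane)
    (f := fun x => ‖freeGroup t a x‖) (Filter.Eventually.of_forall fun x => norm_nonneg _)
    (measurable_coe _).norm.aemeasurable (p := 6) (by norm_num)
  have h2 : ∫⁻ x, ‖freeGroup t a x‖ₑ ^ (6 : ℝ) =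
      ∫⁻ x, ENNReal.ofReal (‖freeGroup t a x‖ ^ (6 : ℝ)) := by
    refine lintegral_congr fun x => ?_
    rw [← ofReal_norm, ENNReal.ofReal_rpow_of_nonneg (norm_nonneg _) (by norm_num)]
  set G : ℝ → Plane → ℝ≥0∞ := fun α x =>
    if ‖a x‖ ≤ (2 * D * M / α) ^ 5 then ENNReal.ofReal (4 * α ^ 3) * ‖a x‖ₑ ^ (2 : ℝ) else 0
    with hG
  have hGm : Measurable (Function.uncurry G) := by
    refine Measurable.ite (measurableSet_le (by fun_prop) (by fun_prop)) (by fun_prop)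
      measurable_const
  have h3 : ∫⁻ α in Set.Ioi (0 : ℝ), volume {x | α < ‖freeGroup t a x‖} *
      ENNReal.ofReal (α ^ ((6 : ℝ) - 1)) ≤ ∫⁻ α in Set.Ioi (0 : ℝ), ∫⁻ x, G α x := by
    refine setLIntegral_mono' measurableSet_Ioi fun α hα => ?_
    have hα' : 0 < α := hα
    refine (mul_le_mul_left (measure_level_le ht a hM hMa hα') _).trans (le_of_eq ?_)
    rw [mul_right_comm, ← ENNReal.ofReal_mul (by positivity), ← lintegral_const_mul]
    · refine lintegral_congr fun x => ?_
      have e : 4 / α ^ 2 * α ^ ((6 : ℝ) - 1) = 4 * α ^ 3 := by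
        rw [show (6 : ℝ) - 1 = ((5 : ℕ) : ℝ) by norm_num, Real.rpow_natCast]
        field_simp
      simp only [hG, Set.indicator_apply, Set.mem_ofPred_eq, e]
      split_ifs <;> simp
    · exact Measurable.indicator (by fun_prop) (measurableSet_le ham.norm measurable_const)
  have h4 : ∫⁻ α in Set.Ioi (0 : ℝ), ∫⁻ x, G α x ≤
      ENNReal.ofReal ((2 * D * M) ^ 4) * ∫⁻ x, ‖a x‖ₑ ^ (6 / 5 : ℝ) := by
    rw [lintegral_lintegral_swap hGm.aemeasurable, ← lintegral_const_mul _ (by fun_prop)]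
    refine lintegral_mono fun x => ?_
    by_cases hx : a x = 0
    · simp [hG, hx]
    · have hr : 0 < ‖a x‖ := norm_pos_iff.2 hx
      -- The cutoff |a(x)| ≤ (2DM/α)⁵ solved for α.
      set c := 2 * D * M * ‖a x‖ ^ (-(1 / 5) : ℝ) with hc
      have hcp : 0 < c := by positivity
      calc ∫⁻ α in Set.Ioi (0 : ℝ), G α x
          ≤ ∫⁻ α in Set.Ioi (0 : ℝ), (if α ≤ c then ENNReal.ofReal (4 * α ^ 3) else 0) *
              ‖a x‖ₑ ^ (2 : ℝ) := by
            refine setLIntegral_mono' measurableSet_Ioi fun α hα => ?_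
            have hα' : 0 < α := hα
            simp only [hG]
            split_ifs with h5 h6
            · exact le_rfl
            · exfalso
              apply h6
              have h7 : ‖a x‖ ^ (1 / 5 : ℝ) ≤ 2 * D * M / α := by
                have h8 := Real.rpow_le_rpow hr.le h5 (by norm_num : (0 : ℝ) ≤ 1 / 5)
                rwa [← Real.rpow_natCast, ← Real.rpow_mul (by positivity),
                  show ((5 : ℕ) : ℝ) * (1 / 5) = 1 by norm_num, Real.rpow_one] at h8
              rw [hc, Real.rpow_neg hr.le, ← div_eq_mul_inv, le_div_iff₀ (by positivity)]
              rw [le_div_iff₀ hα'] at h7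
              linarith
            · exact zero_le
            · simp
        _ = ENNReal.ofReal (c ^ 4) * ‖a x‖ₑ ^ (2 : ℝ) := by
            rw [lintegral_mul_const _ (by
              exact Measurable.ite measurableSet_Iic (by fun_prop) measurable_const),
              lintegral_cube_le hcp.le]
        _ = ENNReal.ofReal ((2 * D * M) ^ 4) * ‖a x‖ₑ ^ (6 / 5 : ℝ) := by
            rw [← ofReal_norm, ENNReal.ofReal_rpow_of_nonneg hr.le (by norm_num),
              ENNReal.ofReal_rpow_of_nonneg hr.le (by norm_num),
              ← ENNReal.ofReal_mul (by positivity), ← ENNReal.ofReal_mul (by positivity), hc,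
              mul_pow, mul_assoc, ← Real.rpow_natCast (_ ^ (-(1 / 5) : ℝ)),
              ← Real.rpow_mul hr.le, ← Real.rpow_add hr]
            norm_num
  rw [h2, h1]
  calc ENNReal.ofReal 6 * _ ≤ ENNReal.ofReal 6 *
        (ENNReal.ofReal ((2 * D * M) ^ 4) * ENNReal.ofReal M) := by
        gcongr
        exact h3.trans (h4.trans (by gcongr))
    _ = _ := by
        rw [← ENNReal.ofReal_mul (by positivity), ← ENNReal.ofReal_mul (by positivity)]
        congr 1; ring

/-- Hölder with exponents 6 and 6/5. The constant is at most 1 because (4π)⁴ exceeds 96. The case M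
= 0 is apart since the interpolation bound divides by M. -/
theorem enorm_inner_freeGroup_le {t : ℝ} (ht : t ≠ 0) (a b : L2) {M : ℝ} (hM : 0 ≤ M)
    (hMa : ∫⁻ x, ‖a x‖ₑ ^ (6 / 5 : ℝ) = ENNReal.ofReal M) :
    ‖inner ℂ (freeGroup t a) b‖ₑ ≤ ENNReal.ofReal (|t| ^ (-(2 / 3) : ℝ)) *
      (ENNReal.ofReal (M ^ (5 / 6 : ℝ)) * (∫⁻ x, ‖b x‖ₑ ^ (6 / 5 : ℝ)) ^ (5 / 6 : ℝ)) := by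
  rcases hM.eq_or_lt with rfl | hM
  · have h0 : a = 0 := by
      rw [ENNReal.ofReal_zero, lintegral_eq_zero_iff (by have := measurable_coe a; fun_prop)] at hMa
      rw [Lp.eq_zero_iff_ae_eq_zero]
      filter_upwards [hMa] with x hx
      simpa using hx
    have : freeGroup t 0 = 0 := (freeLI t).map_zero
    rw [h0, this, inner_zero_left]; simp
  · have hpi := Real.pi_pos
    have htp : 0 < |t| := abs_pos.2 ht
    have h6 := lintegral_freeGroup_rpow_six_le ht a hM hMa.le
    have hH := ENNReal.lintegral_mul_le_Lp_mul_Lq (volume : Measure Plane) (p := 6) (q := 6 / 5)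
      (by rw [Real.holderConjugate_iff]; norm_num) (measurable_coe (freeGroup t a)).enorm.aemeasurable
      (measurable_coe b).enorm.aemeasurable
    have h1 : ‖inner ℂ (freeGroup t a) b‖ₑ ≤ ∫⁻ x, ((fun x => ‖freeGroup t a x‖ₑ) *
        fun x => ‖b x‖ₑ) x := by
      rw [L2.inner_def]
      refine (enorm_integral_le_lintegral_enorm _).trans (le_of_eq (lintegral_congr fun x => ?_))
      rw [RCLike.inner_apply, enorm_mul, Pi.mul_apply, mul_comm]
      congr 1
      rw [← ofReal_norm, ← ofReal_norm, RCLike.norm_conj]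
    refine h1.trans (hH.trans ?_)
    rw [← mul_assoc, show (1 / (6 / 5) : ℝ) = 5 / 6 by norm_num]
    gcongr
    calc (∫⁻ x, ‖freeGroup t a x‖ₑ ^ (6 : ℝ)) ^ (1 / 6 : ℝ)
        ≤ (ENNReal.ofReal ((|t| ^ (-(2 / 3) : ℝ) * M ^ (5 / 6 : ℝ)) ^ (6 : ℝ))) ^ (1 / 6 : ℝ) := by
          refine ENNReal.rpow_le_rpow (h6.trans (ENNReal.ofReal_le_ofReal ?_)) (by norm_num)
          rw [Real.mul_rpow (by positivity) (by positivity), ← Real.rpow_mul htp.le,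
            ← Real.rpow_mul hM.le, show (5 / 6 * 6 : ℝ) = ((5 : ℕ) : ℝ) by norm_num,
            Real.rpow_natCast, show (-(2 / 3) * 6 : ℝ) = -((4 : ℕ) : ℝ) by norm_num,
            Real.rpow_neg htp.le, Real.rpow_natCast]
          gcongr
          rw [inv_pow, mul_pow, mul_inv, ← mul_assoc]
          refine mul_le_of_le_one_left (by positivity) ?_
          rw [← div_eq_mul_inv, div_le_one (by positivity)]
          calc (96 : ℝ) ≤ (4 * 3) ^ 4 := by norm_num
            _ ≤ (4 * Real.pi) ^ 4 := by gcongr; exact Real.pi_gt_three.le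
      _ = _ := by
          rw [ENNReal.ofReal_rpow_of_nonneg (by positivity) (by norm_num),
            ← Real.rpow_mul (by positivity), ← ENNReal.ofReal_mul (by positivity)]
          norm_num

end CR

namespace CR

/-! ### A bilinear Hardy-Littlewood-Sobolev inequality -/

theorem lintegral_comp_abs (f : ℝ → ℝ≥0∞) :
    ∫⁻ u, f |u| = 2 * ∫⁻ u in Set.Ioi (0 : ℝ), f u := by
  rw [← lintegral_add_compl (fun u => f |u|) (measurableSet_Ioi (a := (0 : ℝ))), Set.compl_Ioi,
    two_mul]
  congr 1
  · exact setLIntegral_congr_fun measurableSet_Ioi fun u (hu : 0 < u) => by simp [abs_of_pos hu]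
  · rw [setLIntegral_congr (Iio_ae_eq_Iic (a := (0 : ℝ))).symm]
    have h := (Measure.measurePreserving_neg (volume : Measure ℝ)).setLIntegral_comp_emb
      (MeasurableEquiv.neg ℝ).measurableEmbedding (fun u => f |u|) (Set.Ioi 0)
    have e : Set.Iio (0 : ℝ) = Neg.neg '' Set.Ioi (0 : ℝ) := by simp
    rw [e, ← h]
    exact setLIntegral_congr_fun measurableSet_Ioi fun u (hu : 0 < u) => by
      simp [abs_of_pos hu]

theorem lintegral_near_kernel {r : ℝ} (hr : 0 < r) :
    ∫⁻ u : ℝ, (if |u| ≤ r then ENNReal.ofReal (|u| ^ (-(2 / 3) : ℝ)) else 0) =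
      ENNReal.ofReal (6 * r ^ (1 / 3 : ℝ)) := by
  rw [lintegral_comp_abs (fun u => if u ≤ r then ENNReal.ofReal (u ^ (-(2 / 3) : ℝ)) else 0)]
  have h1 : ∀ u : ℝ, (if u ≤ r then ENNReal.ofReal (u ^ (-(2 / 3) : ℝ)) else 0) =
      (Set.Iic r).indicator (fun u => ENNReal.ofReal (u ^ (-(2 / 3) : ℝ))) u := fun u => by
    simp [Set.indicator_apply]
  simp_rw [h1]
  rw [setLIntegral_indicator measurableSet_Iic, Set.inter_comm, Set.Ioi_inter_Iic,
    ← ofReal_integral_eq_lintegral_ofReal, ← intervalIntegral.integral_of_le hr.le,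
    integral_rpow (Or.inl (by norm_num)), show (2 : ℝ≥0∞) = ENNReal.ofReal 2 by simp,
    ← ENNReal.ofReal_mul zero_le_two]
  · congr 1
    rw [Real.zero_rpow (by norm_num)]; norm_num; ring
  · exact (intervalIntegral.intervalIntegrable_rpow' (by norm_num)).1
  · filter_upwards [ae_restrict_mem measurableSet_Ioc] with α hα
    exact Real.rpow_nonneg hα.1.le _

theorem lintegral_far_kernel {r : ℝ} (hr : 0 < r) :
    ∫⁻ u : ℝ, (if |u| ≤ r then 0 else ENNReal.ofReal (|u| ^ (-(2 / 3) : ℝ))) ^ (3 : ℝ) =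
      ENNReal.ofReal (2 / r) := by
  rw [lintegral_comp_abs
    (fun u => (if u ≤ r then 0 else ENNReal.ofReal (u ^ (-(2 / 3) : ℝ))) ^ (3 : ℝ))]
  have h1 : ∀ u ∈ Set.Ioi (0 : ℝ),
      (if u ≤ r then 0 else ENNReal.ofReal (u ^ (-(2 / 3) : ℝ))) ^ (3 : ℝ) =
      (Set.Ioi r).indicator (fun u => ENNReal.ofReal (u ^ (-2 : ℝ))) u := by
    intro u (hu : 0 < u)
    by_cases h : u ≤ r
    · simp [h]
    · rw [if_neg h, Set.indicator_of_mem (by exact not_le.1 h),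
        ENNReal.ofReal_rpow_of_nonneg (by positivity) (by norm_num), ← Real.rpow_mul hu.le]
      norm_num
  rw [setLIntegral_congr_fun measurableSet_Ioi h1, setLIntegral_indicator measurableSet_Ioi,
    Set.inter_eq_left.2 (Set.Ioi_subset_Ioi hr.le),
    ← ofReal_integral_eq_lintegral_ofReal (integrableOn_Ioi_rpow_of_lt (by norm_num) hr),
    integral_Ioi_rpow_of_lt (by norm_num) hr, show (2 : ℝ≥0∞) = ENNReal.ofReal 2 by simp,
    ← ENNReal.ofReal_mul zero_le_two]
  · congr 1
    norm_num [Real.rpow_neg_one]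
    rfl
  · filter_upwards [ae_restrict_mem measurableSet_Ioi] with α hα
    exact Real.rpow_nonneg (hr.trans hα).le _

variable {A : ℝ → ℝ} {N : ℝ}

/-- Restricting to A(t) ≤ A(s) gives a pointwise bound near the diagonal. Near s, replace A(t) by
A(s) and integrate the kernel; away from s, use Hölder with the kernel in L³ and A in L^{3/2}. -/
theorem lintegral_kernel_mul_le_of_le (hA : Measurable A) (hA0 : ∀ t, 0 ≤ A t) (hN : 0 < N)
    (h : ∫⁻ t, ENNReal.ofReal (A t) ^ (3 / 2 : ℝ) ≤ ENNReal.ofReal N) (s : ℝ) :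
    ∫⁻ t, (if A t ≤ A s then ENNReal.ofReal (|t - s| ^ (-(2 / 3) : ℝ)) *
      (ENNReal.ofReal (A s) * ENNReal.ofReal (A t)) else 0) ≤
      ENNReal.ofReal (8 * N ^ (1 / 3 : ℝ)) * ENNReal.ofReal (A s) ^ (3 / 2 : ℝ) := by
  rcases (hA0 s).eq_or_lt with h0 | ha
  · simp [← h0]
  set a := A s with has
  -- This radius balances the two regions: they give 6 and 2^{1/3} times N^{1/3} a^{3/2}, whence the
  -- constant 8.
  set r := N * a ^ (-(3 / 2) : ℝ) with hr
  have hrp : 0 < r := by positivity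
  set k₁ : ℝ → ℝ≥0∞ := fun u => if |u| ≤ r then ENNReal.ofReal (|u| ^ (-(2 / 3) : ℝ)) else 0
    with hk₁
  set k₂ : ℝ → ℝ≥0∞ := fun u => if |u| ≤ r then 0 else ENNReal.ofReal (|u| ^ (-(2 / 3) : ℝ))
    with hk₂
  have mk₁ : Measurable k₁ := Measurable.ite (measurableSet_le (by fun_prop) (by fun_prop))
    (by fun_prop) measurable_const
  have mk₂ : Measurable k₂ := Measurable.ite (measurableSet_le (by fun_prop) (by fun_prop))
    measurable_const (by fun_prop)
  have hpt : ∀ t, (if A t ≤ a then ENNReal.ofReal (|t - s| ^ (-(2 / 3) : ℝ)) *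
      (ENNReal.ofReal a * ENNReal.ofReal (A t)) else 0) ≤
      ENNReal.ofReal (a ^ 2) * k₁ (t - s) +
        ENNReal.ofReal a * (k₂ (t - s) * ENNReal.ofReal (A t)) := by
    intro t
    by_cases h1 : A t ≤ a
    · rw [if_pos h1]
      by_cases h2 : |t - s| ≤ r
      · simp only [hk₁, hk₂, if_pos h2, zero_mul, mul_zero, add_zero]
        rw [mul_comm, pow_two, ENNReal.ofReal_mul ha.le]
        gcongr
      · simp only [hk₁, hk₂, if_neg h2, mul_zero, zero_add]
        exact le_of_eq (by ring)
    · simp [h1]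
  have t₁ : ∫⁻ t, k₁ (t - s) = ENNReal.ofReal (6 * r ^ (1 / 3 : ℝ)) := by
    rw [lintegral_sub_right_eq_self k₁ s]; exact lintegral_near_kernel hrp
  have t₂ : ∫⁻ t, k₂ (t - s) * ENNReal.ofReal (A t) ≤
      ENNReal.ofReal ((2 / r) ^ (1 / 3 : ℝ) * N ^ (2 / 3 : ℝ)) := by
    have hol := ENNReal.lintegral_mul_le_Lp_mul_Lq (volume : Measure ℝ)
      (p := 3) (q := 3 / 2) (by constructor <;> norm_num)
      (f := fun t => k₂ (t - s)) (g := fun t => ENNReal.ofReal (A t))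
      (by fun_prop) (by fun_prop)
    refine hol.trans ?_
    rw [lintegral_sub_right_eq_self (fun t => k₂ t ^ (3 : ℝ)) s]
    have e : ∫⁻ u : ℝ, k₂ u ^ (3 : ℝ) = ENNReal.ofReal (2 / r) := lintegral_far_kernel hrp
    rw [e, ENNReal.ofReal_rpow_of_nonneg (by positivity) (by norm_num),
      ENNReal.ofReal_mul (by positivity), ← ENNReal.ofReal_rpow_of_nonneg hN.le (by norm_num)]
    norm_num
    gcongr
  calc _ ≤ ∫⁻ t, (ENNReal.ofReal (a ^ 2) * k₁ (t - s) +
        ENNReal.ofReal a * (k₂ (t - s) * ENNReal.ofReal (A t))) := lintegral_mono hpt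
    _ = ENNReal.ofReal (a ^ 2) * (∫⁻ t, k₁ (t - s)) +
        ENNReal.ofReal a * ∫⁻ t, k₂ (t - s) * ENNReal.ofReal (A t) := by
        rw [lintegral_add_left (by fun_prop), lintegral_const_mul _ (by fun_prop),
          lintegral_const_mul _ (by fun_prop)]
    _ ≤ ENNReal.ofReal (a ^ 2) * ENNReal.ofReal (6 * r ^ (1 / 3 : ℝ)) + ENNReal.ofReal a *
        ENNReal.ofReal ((2 / r) ^ (1 / 3 : ℝ) * N ^ (2 / 3 : ℝ)) := by rw [t₁]; gcongr
    _ = ENNReal.ofReal (a ^ 2 * (6 * r ^ (1 / 3 : ℝ)) +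
          a * ((2 / r) ^ (1 / 3 : ℝ) * N ^ (2 / 3 : ℝ))) := by
        rw [← ENNReal.ofReal_mul (by positivity), ← ENNReal.ofReal_mul (by positivity),
          ← ENNReal.ofReal_add (by positivity) (by positivity)]
    _ ≤ ENNReal.ofReal (8 * N ^ (1 / 3 : ℝ) * a ^ (3 / 2 : ℝ)) := by
        refine ENNReal.ofReal_le_ofReal ?_
        have e1 : r ^ (1 / 3 : ℝ) = N ^ (1 / 3 : ℝ) * a ^ (-(1 / 2) : ℝ) := by
          rw [hr, Real.mul_rpow hN.le (by positivity), ← Real.rpow_mul ha.le]; norm_num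
        have e2 : a ^ 2 * a ^ (-(1 / 2) : ℝ) = a ^ (3 / 2 : ℝ) := by
          rw [← Real.rpow_natCast, ← Real.rpow_add ha]; norm_num
        have e3 : a * (a ^ (-(1 / 2) : ℝ))⁻¹ = a ^ (3 / 2 : ℝ) := by
          rw [← Real.rpow_neg ha.le]
          nth_rewrite 1 [← Real.rpow_one a]
          rw [← Real.rpow_add ha]; norm_num
        have e4 : N ^ (2 / 3 : ℝ) = N ^ (1 / 3 : ℝ) * N ^ (1 / 3 : ℝ) := by
          rw [← Real.rpow_add hN]; norm_num
        have e5 : (2 : ℝ) ^ (1 / 3 : ℝ) ≤ 2 := by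
          nth_rewrite 2 [← Real.rpow_one 2]
          exact Real.rpow_le_rpow_of_exponent_le (by norm_num) (by norm_num)
        have hNp : 0 < N ^ (1 / 3 : ℝ) := by positivity
        rw [Real.div_rpow zero_le_two hrp.le, e1, e4]
        have e6 : a * (2 ^ (1 / 3 : ℝ) / (N ^ (1 / 3 : ℝ) * a ^ (-(1 / 2) : ℝ)) *
            (N ^ (1 / 3 : ℝ) * N ^ (1 / 3 : ℝ))) =
            2 ^ (1 / 3 : ℝ) * N ^ (1 / 3 : ℝ) * a ^ (3 / 2 : ℝ) := by
          rw [← e3]; field_simp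
        have e7 : a ^ 2 * (6 * (N ^ (1 / 3 : ℝ) * a ^ (-(1 / 2) : ℝ))) =
            6 * N ^ (1 / 3 : ℝ) * a ^ (3 / 2 : ℝ) := by rw [← e2]; ring
        rw [e6, e7, ← add_mul, ← add_mul]
        gcongr
        linarith
    _ = _ := by
        rw [ENNReal.ofReal_mul (by positivity), ENNReal.ofReal_rpow_of_nonneg ha.le (by norm_num)]

/-- The Hardy-Littlewood-Sobolev inequality for the kernel `|t - s|^{-2/3}` on `L^{3/2}`. -/
theorem lintegral_lintegral_kernel_le (hA : Measurable A) (hA0 : ∀ t, 0 ≤ A t) (hN : 0 < N)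
    (h : ∫⁻ t, ENNReal.ofReal (A t) ^ (3 / 2 : ℝ) ≤ ENNReal.ofReal N) :
    ∫⁻ s, ∫⁻ t, ENNReal.ofReal (|t - s| ^ (-(2 / 3) : ℝ)) *
      (ENNReal.ofReal (A s) * ENNReal.ofReal (A t)) ≤
      ENNReal.ofReal (16 * N ^ (4 / 3 : ℝ)) := by
  set K : ℝ → ℝ → ℝ≥0∞ := fun s t => if A t ≤ A s then
    ENNReal.ofReal (|t - s| ^ (-(2 / 3) : ℝ)) * (ENNReal.ofReal (A s) * ENNReal.ofReal (A t))
    else 0 with hK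
  have mK : Measurable (Function.uncurry K) := Measurable.ite
    (measurableSet_le (by fun_prop) (by fun_prop)) (by fun_prop) measurable_const
  -- The integrand is symmetric, so ordering the values A(s), A(t) splits it into two copies of the
  -- case already bounded.
  have hpt : ∀ s t, ENNReal.ofReal (|t - s| ^ (-(2 / 3) : ℝ)) *
      (ENNReal.ofReal (A s) * ENNReal.ofReal (A t)) ≤ K s t + K t s := by
    intro s t
    rcases le_total (A t) (A s) with h1 | h1
    · refine le_trans ?_ le_self_add
      simp only [hK, if_pos h1]; exact le_rfl
    · refine le_trans ?_ le_add_self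
      simp only [hK, if_pos h1]
      rw [abs_sub_comm, mul_comm (ENNReal.ofReal (A s))]
  have hhalf : ∫⁻ s, ∫⁻ t, K s t ≤ ENNReal.ofReal (8 * N ^ (4 / 3 : ℝ)) := by
    calc ∫⁻ s, ∫⁻ t, K s t
        ≤ ∫⁻ s, ENNReal.ofReal (8 * N ^ (1 / 3 : ℝ)) * ENNReal.ofReal (A s) ^ (3 / 2 : ℝ) :=
          lintegral_mono fun s => lintegral_kernel_mul_le_of_le hA hA0 hN h s
      _ ≤ ENNReal.ofReal (8 * N ^ (1 / 3 : ℝ)) * ENNReal.ofReal N := by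
          rw [lintegral_const_mul _ (by fun_prop)]; gcongr
      _ = _ := by
          rw [← ENNReal.ofReal_mul (by positivity), mul_assoc, show (4 / 3 : ℝ) = 1 / 3 + 1 by
            norm_num, Real.rpow_add hN, Real.rpow_one]
  have hswap : ∫⁻ s, ∫⁻ t, K t s = ∫⁻ s, ∫⁻ t, K s t :=
    lintegral_lintegral_swap (mK.comp measurable_swap).aemeasurable
  calc _ ≤ ∫⁻ s, ∫⁻ t, (K s t + K t s) := lintegral_mono fun s => lintegral_mono fun t => hpt s t
    _ = (∫⁻ s, ∫⁻ t, K s t) + ∫⁻ s, ∫⁻ t, K t s := by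
        rw [← lintegral_add_left (show Measurable fun s => ∫⁻ t, K s t from
          mK.lintegral_prod_right')]
        refine lintegral_congr fun s => ?_
        exact lintegral_add_left (mK.comp measurable_prodMk_left) _
    _ ≤ ENNReal.ofReal (8 * N ^ (4 / 3 : ℝ)) + ENNReal.ofReal (8 * N ^ (4 / 3 : ℝ)) := by
        rw [hswap]; gcongr
    _ = _ := by
        rw [← ENNReal.ofReal_add (by positivity) (by positivity)]; congr 1; ring

end CR

namespace CR

/-! ### Measurability of curves in `L²` -/

/-- As L² is separable, every open set is a countable union of balls, and the preimage of a ball is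
a sublevel set of a distance. -/
theorem stronglyMeasurable_of_measurable_norm_sub {α : Type*} [MeasurableSpace α] {g : α → L2}
    (h : ∀ k : L2, Measurable fun t => ‖g t - k‖) : StronglyMeasurable g := by
  borelize L2
  have : Fact ((2 : ℝ≥0∞) ≠ ∞) := ⟨ENNReal.ofNat_ne_top⟩
  refine Measurable.stronglyMeasurable (measurable_of_isOpen fun U hU => ?_)
  have hcov : U = ⋃ q : {q : L2 × ℝ // Metric.ball q.1 q.2 ⊆ U}, Metric.ball q.1.1 q.1.2 := by
    ext x
    simp only [Set.mem_iUnion]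
    constructor
    · intro hx
      obtain ⟨ε, hε, hb⟩ := Metric.isOpen_iff.1 hU x hx
      exact ⟨⟨(x, ε), hb⟩, Metric.mem_ball_self hε⟩
    · rintro ⟨q, hq⟩; exact q.2 hq
  obtain ⟨T, hT, hTU⟩ := TopologicalSpace.isOpen_iUnion_countable
    (fun q : {q : L2 × ℝ // Metric.ball q.1 q.2 ⊆ U} => Metric.ball q.1.1 q.1.2)
    fun q => Metric.isOpen_ball
  rw [hcov, ← hTU, Set.preimage_iUnion₂]
  refine MeasurableSet.biUnion hT fun q _ => ?_
  have e : g ⁻¹' Metric.ball q.1.1 q.1.2 = {t | ‖g t - q.1.1‖ < q.1.2} := by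
    ext t; simp [dist_eq_norm]
  rw [e]
  exact measurableSet_lt (h _) measurable_const

theorem memLp_two_iff {g : Plane → ℂ} (hg : AEStronglyMeasurable g volume) :
    MemLp g 2 volume ↔ ∫⁻ x, ‖g x‖ₑ ^ (2 : ℝ) < ∞ := by
  rw [lintegral_sq_eq, ENNReal.rpow_lt_top_iff_of_pos zero_lt_two]
  exact ⟨fun h => h.2, fun h => ⟨hg, h⟩⟩

theorem toL2_of_memLp {g : Plane → ℂ} (hg : MemLp g 2 volume) : toL2 g = hg.toLp g := dif_pos hg

theorem coeFn_toL2 {g : Plane → ℂ} (hg : MemLp g 2 volume) : toL2 g =ᵐ[volume] g := by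
  rw [toL2_of_memLp hg]; exact hg.coeFn_toLp

theorem toL2_congr {g h : Plane → ℂ} (e : g =ᵐ[volume] h) : toL2 g = toL2 h := by
  by_cases hg : MemLp g 2 volume
  · rw [toL2_of_memLp hg, toL2_of_memLp ((memLp_congr_ae e).1 hg)]
    exact (MemLp.toLp_eq_toLp_iff _ _).2 e
  · rw [toL2, toL2, dif_neg hg, dif_neg fun h' => hg ((memLp_congr_ae e).2 h')]

theorem norm_L2_eq (a : L2) : ‖a‖ = ((∫⁻ x, ‖a x‖ₑ ^ (2 : ℝ)) ^ (1 / 2 : ℝ)).toReal := by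
  rw [lintegral_sq_eq, eLpNorm_two_eq, ← ENNReal.rpow_mul]
  norm_num

theorem norm_toL2_le {g : Plane → ℂ} :
    ‖toL2 g‖ₑ ≤ (∫⁻ x, ‖g x‖ₑ ^ (2 : ℝ)) ^ (1 / 2 : ℝ) := by
  by_cases hg : MemLp g 2 volume
  · rw [toL2_of_memLp hg, lintegral_sq_eq, ← ENNReal.rpow_mul, Lp.enorm_def,
      eLpNorm_congr_ae hg.coeFn_toLp]
    norm_num
  · rw [toL2, dif_neg hg]; simp

theorem norm_freeGroup_neg_sub (t : ℝ) (a h : L2) :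
    ‖freeGroup (-t) a - h‖ = ‖a - freeGroup t h‖ := by
  have : h = freeGroup (-t) (freeGroup t h) := by
    rw [freeGroup_freeGroup, neg_add_cancel, freeGroup_zero]
  nth_rewrite 1 [this]
  rw [← freeGroup_sub, norm_freeGroup]

/-- By unitarity the distance from e^{-itΔ}F(t) to h is that from F(t) to e^{itΔ}h, an integral over
x of a jointly measurable function. At times when the slice is not in L², `toL2` is 0 and the
distance is ‖h‖. -/
theorem stronglyMeasurable_freeGroup_toL2 {F : ℝ × Plane → ℂ} (hF : Measurable F) :
    StronglyMeasurable fun t => freeGroup (-t) (toL2 fun x => F (t, x)) := by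
  refine stronglyMeasurable_of_measurable_norm_sub fun h => ?_
  have hs : ∀ t, AEStronglyMeasurable (fun x => F (t, x)) volume := fun t =>
    (hF.comp measurable_prodMk_left).aestronglyMeasurable
  have e : ∀ t, ‖freeGroup (-t) (toL2 fun x => F (t, x)) - h‖ =
      if ∫⁻ x, ‖F (t, x)‖ₑ ^ (2 : ℝ) < ∞ then
        ((∫⁻ x, ‖F (t, x) - rep h (t, x)‖ₑ ^ (2 : ℝ)) ^ (1 / 2 : ℝ)).toReal else ‖h‖ := by
    intro t
    rw [norm_freeGroup_neg_sub]
    split_ifs with hm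
    · have hm' := (memLp_two_iff (hs t)).2 hm
      rw [norm_L2_eq]
      congr 2
      refine lintegral_congr_ae ?_
      filter_upwards [Lp.coeFn_sub (toL2 fun x => F (t, x)) (freeGroup t h), coeFn_toL2 hm',
        rep_ae h t] with x h1 h2 h3
      rw [h1, Pi.sub_apply, h2, h3]
    · rw [toL2, dif_neg fun h' => hm ((memLp_two_iff (hs t)).1 h'), zero_sub, norm_neg,
        norm_freeGroup]
  simp_rw [e]
  have m₁ : Measurable fun t => ∫⁻ x, ‖F (t, x)‖ₑ ^ (2 : ℝ) :=
    Measurable.lintegral_prod_right' (f := fun p => ‖F p‖ₑ ^ (2 : ℝ)) (by fun_prop)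
  have m₂ : Measurable fun t => ∫⁻ x, ‖F (t, x) - rep h (t, x)‖ₑ ^ (2 : ℝ) :=
    Measurable.lintegral_prod_right' (f := fun p => ‖F p - rep h p‖ₑ ^ (2 : ℝ))
      ((hF.sub (measurable_rep h)).enorm.pow_const _)
  exact Measurable.ite (measurableSet_lt m₁ measurable_const)
    ((m₂.pow_const _).ennreal_toReal) measurable_const

/-! ### Duality and the `L³L⁶` Strichartz estimate -/

/-- The dual estimate: `‖∫ e^{-itΔ} F(t) dt‖² ≤ 16 N^{4/3}` if `∫ ‖F(t)‖_{6/5}^{3/2} dt ≤ N`. -/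
theorem norm_integral_freeGroup_sq_le {F : ℝ → L2} {A : ℝ → ℝ} {N : ℝ}
    (hG : Integrable fun t => freeGroup (-t) (F t)) (hA : Measurable A) (hA0 : ∀ t, 0 ≤ A t)
    (hFA : ∀ t, ∫⁻ x, ‖F t x‖ₑ ^ (6 / 5 : ℝ) = ENNReal.ofReal (A t ^ (6 / 5 : ℝ)))
    (hN : 0 < N) (h : ∫⁻ t, ENNReal.ofReal (A t) ^ (3 / 2 : ℝ) ≤ ENNReal.ofReal N) :
    ‖∫ t, freeGroup (-t) (F t)‖ ^ 2 ≤ 16 * N ^ (4 / 3 : ℝ) := by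
  set G := fun t => freeGroup (-t) (F t) with hGdef
  have key : ∀ k : L2, ‖inner ℂ k (∫ t, G t)‖ₑ ≤ ∫⁻ t, ‖inner ℂ k (G t)‖ₑ := fun k => by
    rw [← integral_inner hG k]; exact enorm_integral_le_lintegral_enorm _
  have hsymm : ∀ a b : L2, ‖inner ℂ a b‖ₑ = ‖inner ℂ b a‖ₑ := fun a b => by
    rw [← inner_conj_symm a b, RCLike.enorm_conj]
  -- The squared norm is bounded by the double integral of these inner products. By unitarity each
  -- involves only the evolution over t - s, to which the decay estimate applies; the diagonal is
  -- null.
  have hpair : ∀ s t, s ≠ t → ‖inner ℂ (G s) (G t)‖ₑ ≤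
      ENNReal.ofReal (|t - s| ^ (-(2 / 3) : ℝ)) * (ENNReal.ofReal (A s) * ENNReal.ofReal (A t)) := by
    intro s t hst
    have e : inner ℂ (G s) (G t) = inner ℂ (freeGroup (t - s) (F s)) (F t) := by
      simp only [hGdef]
      rw [← inner_freeGroup, freeGroup_freeGroup, sub_eq_add_neg]
    rw [e]
    refine (enorm_inner_freeGroup_le (sub_ne_zero.2 hst.symm) (F s) (F t)
      (Real.rpow_nonneg (hA0 s) _) (hFA s)).trans (le_of_eq ?_)
    rw [hFA t, ENNReal.ofReal_rpow_of_nonneg (Real.rpow_nonneg (hA0 t) _) (by norm_num),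
      ← Real.rpow_mul (hA0 s), ← Real.rpow_mul (hA0 t)]
    norm_num
  have h1 : ‖inner ℂ (∫ t, G t) (∫ t, G t)‖ₑ ≤ ENNReal.ofReal (16 * N ^ (4 / 3 : ℝ)) := by
    refine (key _).trans (le_trans ?_ (lintegral_lintegral_kernel_le hA hA0 hN h))
    refine lintegral_mono fun s => ?_
    rw [hsymm]
    refine (key (G s)).trans (lintegral_mono_ae ?_)
    filter_upwards [Measure.ae_ne volume s] with t ht
    exact hpair s t ht.symm
  rw [inner_self_eq_norm_sq_to_K, ← ofReal_norm, ENNReal.ofReal_le_ofReal_iff (by positivity)] at h1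
  simpa using h1

end CR

namespace CR

/-! ### Truncated evolutions and their extremal dual functions -/

section Truncation

variable (f : L2) (R : ℝ)

/-- The set on which the space-time variables and the evolution are bounded by `R`. -/
def truncSet : Set (ℝ × Plane) := {p | |p.1| ≤ R ∧ ‖p.2‖ ≤ R ∧ ‖rep f p‖ ≤ R}

/-- The truncated evolution. -/
noncomputable def trunc : ℝ × Plane → ℂ := (truncSet f R).indicator (rep f)

/-- The sixth power of the `L⁶` norm of the truncated evolution. -/
noncomputable def truncSix (t : ℝ) : ℝ≥0∞ := ∫⁻ x, ‖trunc f R (t, x)‖ₑ ^ (6 : ℝ)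

/-- The `L⁶` norm squared of the truncated evolution, cut off where it is small. -/
noncomputable def truncAmp (t : ℝ) : ℝ :=
  if R⁻¹ ≤ (truncSix f R t).toReal then (truncSix f R t).toReal ^ (1 / 3 : ℝ) else 0

/-- The weight that makes the truncation extremal. -/
noncomputable def truncWeight (t : ℝ) : ℝ :=
  if R⁻¹ ≤ (truncSix f R t).toReal then (truncSix f R t).toReal ^ (-(1 / 2) : ℝ) else 0

/-- The dual function of the truncated evolution. -/
noncomputable def truncDual (p : ℝ × Plane) : ℂ :=
  ((truncWeight f R p.1 * ‖trunc f R p‖ ^ 4 : ℝ) : ℂ) * trunc f R p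

theorem measurableSet_truncSet : MeasurableSet (truncSet f R) := by
  have := measurable_rep f
  have h : Measurable fun p : ℝ × Plane => |p.1| := by fun_prop
  exact (measurableSet_le h measurable_const).inter
    ((measurableSet_le measurable_snd.norm measurable_const).inter
      (measurableSet_le this.norm measurable_const))

theorem measurable_trunc : Measurable (trunc f R) :=
  (measurable_rep f).indicator (measurableSet_truncSet f R)

theorem measurable_trunc_slice (t : ℝ) : Measurable fun x => trunc f R (t, x) :=
  (measurable_trunc f R).comp measurable_prodMk_left

theorem measurable_truncSix : Measurable (truncSix f R) :=
  Measurable.lintegral_prod_right' (f := fun p => ‖trunc f R p‖ₑ ^ (6 : ℝ))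
    ((measurable_trunc f R).enorm.pow_const _)

theorem measurable_truncAmp : Measurable (truncAmp f R) := by
  have := measurable_truncSix f R
  exact Measurable.ite (measurableSet_le measurable_const (by fun_prop)) (by fun_prop)
    measurable_const

theorem measurable_truncWeight : Measurable (truncWeight f R) := by
  have := measurable_truncSix f R
  exact Measurable.ite (measurableSet_le measurable_const (by fun_prop)) (by fun_prop)
    measurable_const

theorem measurable_truncDual : Measurable (truncDual f R) := by
  have := measurable_truncWeight f R
  have := measurable_trunc f R
  unfold truncDual
  fun_prop

theorem measurable_truncDual_slice (t : ℝ) : Measurable fun x => truncDual f R (t, x) :=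
  (measurable_truncDual f R).comp measurable_prodMk_left

theorem truncAmp_nonneg (t : ℝ) : 0 ≤ truncAmp f R t := by
  unfold truncAmp; split_ifs <;> positivity

theorem truncWeight_nonneg (t : ℝ) : 0 ≤ truncWeight f R t := by
  unfold truncWeight; split_ifs <;> positivity

variable {R}

theorem norm_trunc_le (hR : 0 < R) (p : ℝ × Plane) : ‖trunc f R p‖ ≤ R := by
  by_cases h : p ∈ truncSet f R
  · rw [trunc, Set.indicator_of_mem h]; exact h.2.2
  · rw [trunc, Set.indicator_of_notMem h, norm_zero]; exact hR.le

theorem truncSix_lt_top (hR : 0 < R) (t : ℝ) : truncSix f R t < ∞ := by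
  have h : ∀ x, ‖trunc f R (t, x)‖ₑ ^ (6 : ℝ) ≤
      (Metric.closedBall (0 : Plane) R).indicator (fun _ => ENNReal.ofReal R ^ (6 : ℝ)) x := by
    intro x
    by_cases hx : x ∈ Metric.closedBall (0 : Plane) R
    · rw [Set.indicator_of_mem hx, ← ofReal_norm]
      gcongr
      exact norm_trunc_le f hR _
    · rw [Set.indicator_of_notMem hx, trunc, Set.indicator_of_notMem]
      · simp
      · rintro ⟨-, h, -⟩; exact hx (by simpa using h)
  refine (lintegral_mono h).trans_lt ?_
  rw [lintegral_indicator Metric.isClosed_closedBall.measurableSet, setLIntegral_const]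
  exact ENNReal.mul_lt_top (by simp) measure_closedBall_lt_top

/-- The weight is a negative power, so it is bounded only because small values of the L⁶ norm are
cut off. -/
theorem truncWeight_le (hR : 0 < R) (t : ℝ) : truncWeight f R t ≤ R ^ (1 / 2 : ℝ) := by
  unfold truncWeight
  split_ifs with h
  · calc (truncSix f R t).toReal ^ (-(1 / 2) : ℝ) ≤ R⁻¹ ^ (-(1 / 2) : ℝ) :=
        Real.rpow_le_rpow_of_nonpos (by positivity) h (by norm_num)
      _ = R ^ (1 / 2 : ℝ) := by rw [Real.inv_rpow hR.le, Real.rpow_neg hR.le, inv_inv]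
  · positivity

theorem truncWeight_mul (hR : 0 < R) (t : ℝ) :
    truncWeight f R t * (truncSix f R t).toReal = truncAmp f R t ^ (3 / 2 : ℝ) := by
  unfold truncWeight truncAmp
  split_ifs with h
  · have hp : 0 < (truncSix f R t).toReal := (inv_pos.2 hR).trans_le h
    rw [← Real.rpow_mul hp.le]
    nth_rewrite 2 [← Real.rpow_one (truncSix f R t).toReal]
    rw [← Real.rpow_add hp]; norm_num
  · rw [Real.zero_rpow (by norm_num), zero_mul]

theorem norm_truncDual_le (hR : 0 < R) (p : ℝ × Plane) :
    ‖truncDual f R p‖ ≤ R ^ (1 / 2 : ℝ) * R ^ 4 * R := by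
  rw [truncDual, norm_mul, Complex.norm_real, Real.norm_eq_abs,
    abs_of_nonneg (mul_nonneg (truncWeight_nonneg f R _) (by positivity))]
  have h1 := norm_trunc_le f hR p
  have h2 := truncWeight_le f hR p.1
  have h3 := truncWeight_nonneg f R p.1
  gcongr

theorem truncDual_eq_zero {p : ℝ × Plane} (h : ¬ (|p.1| ≤ R ∧ ‖p.2‖ ≤ R)) :
    truncDual f R p = 0 := by
  rw [truncDual, trunc, Set.indicator_of_notMem, mul_zero]
  exact fun h' => h ⟨h'.1, h'.2.1⟩

theorem enorm_truncDual_slice_le (hR : 0 < R) (t : ℝ) :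
    ∫⁻ x, ‖truncDual f R (t, x)‖ₑ ^ (2 : ℝ) ≤
      (Set.Icc (-R) R).indicator (fun _ => ENNReal.ofReal (R ^ (1 / 2 : ℝ) * R ^ 4 * R) ^ (2 : ℝ) *
        volume (Metric.closedBall (0 : Plane) R)) t := by
  by_cases ht : t ∈ Set.Icc (-R) R
  · rw [Set.indicator_of_mem ht, ← setLIntegral_const,
      ← lintegral_indicator Metric.isClosed_closedBall.measurableSet]
    refine lintegral_mono fun x => ?_
    by_cases hx : x ∈ Metric.closedBall (0 : Plane) R
    · rw [Set.indicator_of_mem hx, ← ofReal_norm]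
      gcongr
      exact norm_truncDual_le f hR _
    · rw [truncDual_eq_zero f fun h => hx (by simpa using h.2)]; simp
  · rw [Set.indicator_of_notMem ht]
    have h0 : ∀ x, truncDual f R (t, x) = 0 := fun x =>
      truncDual_eq_zero f fun h => ht (abs_le.1 h.1)
    simp [h0]

theorem memLp_truncDual (hR : 0 < R) (t : ℝ) : MemLp (fun x => truncDual f R (t, x)) 2 volume := by
  rw [memLp_two_iff (measurable_truncDual_slice f R t).aestronglyMeasurable]
  refine (enorm_truncDual_slice_le f hR t).trans_lt ?_
  by_cases ht : t ∈ Set.Icc (-R) R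
  · rw [Set.indicator_of_mem ht]
    exact ENNReal.mul_lt_top (by simp) measure_closedBall_lt_top
  · rw [Set.indicator_of_notMem ht]; simp

theorem integrable_freeGroup_truncDual (hR : 0 < R) :
    Integrable fun t => freeGroup (-t) (toL2 fun x => truncDual f R (t, x)) := by
  refine ⟨(stronglyMeasurable_freeGroup_toL2 (measurable_truncDual f R)).aestronglyMeasurable, ?_⟩
  have h : ∀ t, ‖freeGroup (-t) (toL2 fun x => truncDual f R (t, x))‖ₑ ≤
      (Set.Icc (-R) R).indicator (fun _ => (ENNReal.ofReal (R ^ (1 / 2 : ℝ) * R ^ 4 * R) ^ (2 : ℝ) *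
        volume (Metric.closedBall (0 : Plane) R)) ^ (1 / 2 : ℝ)) t := by
    intro t
    rw [← ofReal_norm, norm_freeGroup, ofReal_norm]
    refine norm_toL2_le.trans ?_
    refine (ENNReal.rpow_le_rpow (enorm_truncDual_slice_le f hR t) (by norm_num)).trans ?_
    by_cases ht : t ∈ Set.Icc (-R) R
    · rw [Set.indicator_of_mem ht, Set.indicator_of_mem ht]
    · rw [Set.indicator_of_notMem ht, Set.indicator_of_notMem ht]; simp
  refine (lintegral_mono h).trans_lt ?_
  rw [lintegral_indicator measurableSet_Icc, setLIntegral_const]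
  refine ENNReal.mul_lt_top (ENNReal.rpow_lt_top_of_nonneg (by norm_num) ?_) (by simp)
  exact (ENNReal.mul_lt_top (by simp) measure_closedBall_lt_top).ne

/-- Write S for the sixth power of the L⁶ norm at time t. Where S passes the cutoff, the dual
function S^{-1/2}|u|⁴u pairs with the evolution to S^{1/2}, while its L^{6/5} norm is
S^{-1/2}S^{5/6} = S^{1/3}. The pairing is therefore the 3/2 power of that norm, as the duality
argument in L^{3/2} requires. -/
theorem inner_freeGroup_truncDual (hR : 0 < R) (t : ℝ) :
    inner ℂ f (freeGroup (-t) (toL2 fun x => truncDual f R (t, x))) =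
      ((truncAmp f R t ^ (3 / 2 : ℝ) : ℝ) : ℂ) := by
  rw [← inner_freeGroup, L2.inner_def]
  have e : ∫ x, inner ℂ (freeGroup t f x) ((toL2 fun x => truncDual f R (t, x)) x) =
      ∫ x, ((truncWeight f R t * ‖trunc f R (t, x)‖ ^ 6 : ℝ) : ℂ) := by
    refine integral_congr_ae ?_
    filter_upwards [rep_ae f t, coeFn_toL2 (memLp_truncDual f hR t)] with x h1 h2
    rw [h2, ← h1, RCLike.inner_apply, truncDual]
    by_cases h : (t, x) ∈ truncSet f R
    · have hc := Complex.mul_conj' (rep f (t, x))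
      simp only [trunc, Set.indicator_of_mem h]
      push_cast
      linear_combination (truncWeight f R t * ‖rep f (t, x)‖ ^ 4 : ℂ) * hc
    · simp [trunc, Set.indicator_of_notMem h]
  rw [e, integral_complex_ofReal, integral_const_mul, ← truncWeight_mul f hR]
  congr 3
  rw [integral_eq_lintegral_of_nonneg_ae (Filter.Eventually.of_forall fun x => by positivity)
    ((measurable_trunc_slice f R t).norm.pow_const 6).aestronglyMeasurable]
  congr 1
  refine lintegral_congr fun x => ?_
  rw [← ofReal_norm, ENNReal.ofReal_rpow_of_nonneg (norm_nonneg _) (by norm_num)]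
  congr 1
  rw [← Real.rpow_natCast]; norm_num

theorem lintegral_truncDual_rpow (hR : 0 < R) (t : ℝ) :
    ∫⁻ x, ‖(toL2 fun x => truncDual f R (t, x)) x‖ₑ ^ (6 / 5 : ℝ) =
      ENNReal.ofReal (truncAmp f R t ^ (6 / 5 : ℝ)) := by
  have e : ∫⁻ x, ‖(toL2 fun x => truncDual f R (t, x)) x‖ₑ ^ (6 / 5 : ℝ) =
      ∫⁻ x, ENNReal.ofReal (truncWeight f R t ^ (6 / 5 : ℝ)) * ‖trunc f R (t, x)‖ₑ ^ (6 : ℝ) := by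
    refine lintegral_congr_ae ?_
    filter_upwards [coeFn_toL2 (memLp_truncDual f hR t)] with x h2
    have hw := truncWeight_nonneg f R t
    rw [h2, ← ofReal_norm, ← ofReal_norm, ENNReal.ofReal_rpow_of_nonneg (norm_nonneg _)
      (by norm_num), ENNReal.ofReal_rpow_of_nonneg (norm_nonneg _) (by norm_num),
      ← ENNReal.ofReal_mul (by positivity), truncDual, norm_mul, Complex.norm_real,
      Real.norm_eq_abs, abs_of_nonneg (by positivity), mul_assoc, ← pow_succ,
      Real.mul_rpow hw (by positivity), ← Real.rpow_natCast, ← Real.rpow_mul (norm_nonneg _)]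
    norm_num
  rw [e, lintegral_const_mul _
    ((measurable_trunc_slice f R t).enorm.pow_const _),
    ← ENNReal.ofReal_toReal (truncSix_lt_top f hR t).ne (a := ∫⁻ x, ‖trunc f R (t, x)‖ₑ ^ (6 : ℝ))]
  have hw := truncWeight_nonneg f R t
  rw [← ENNReal.ofReal_mul (by positivity)]
  congr 1
  change truncWeight f R t ^ (6 / 5 : ℝ) * (truncSix f R t).toReal = _
  unfold truncWeight truncAmp
  split_ifs with h
  · have hp : 0 < (truncSix f R t).toReal := (inv_pos.2 hR).trans_le h
    rw [← Real.rpow_mul hp.le, ← Real.rpow_mul hp.le]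
    nth_rewrite 2 [← Real.rpow_one (truncSix f R t).toReal]
    rw [← Real.rpow_add hp]; norm_num
  · rw [Real.zero_rpow (by norm_num), zero_mul]

/-- If N is the integral on the left, duality and the dual estimate give N ≤ ‖f‖ · 4N^{2/3}, hence
N^{1/3} ≤ 4‖f‖. Dividing by N^{2/3} is legitimate because truncation makes N finite. -/
theorem lintegral_truncAmp_le (hR : 0 < R) :
    ∫⁻ t, ENNReal.ofReal (truncAmp f R t) ^ (3 / 2 : ℝ) ≤ ENNReal.ofReal (64 * ‖f‖ ^ 3) := by
  have hG := integrable_freeGroup_truncDual f hR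
  have hA0 := truncAmp_nonneg f R
  have hi : Integrable fun t => truncAmp f R t ^ (3 / 2 : ℝ) := by
    have := (hG.const_inner (𝕜 := ℂ) f).norm
    simp only [inner_freeGroup_truncDual f hR] at this
    refine this.congr (Filter.Eventually.of_forall fun t => ?_)
    have := hA0 t
    simp only [Complex.norm_real, Real.norm_eq_abs]
    exact abs_of_nonneg (by positivity)
  set N := ∫ t, truncAmp f R t ^ (3 / 2 : ℝ) with hNdef
  have hN0 : 0 ≤ N := integral_nonneg fun t => Real.rpow_nonneg (hA0 t) _
  have hlin : ∫⁻ t, ENNReal.ofReal (truncAmp f R t) ^ (3 / 2 : ℝ) = ENNReal.ofReal N := by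
    rw [hNdef, ofReal_integral_eq_lintegral_ofReal hi
      (Filter.Eventually.of_forall fun t => Real.rpow_nonneg (hA0 t) _)]
    exact lintegral_congr fun t => ENNReal.ofReal_rpow_of_nonneg (hA0 t) (by norm_num)
  rw [hlin]
  refine ENNReal.ofReal_le_ofReal ?_
  rcases hN0.eq_or_lt with h0 | hN
  · rw [← h0]; positivity
  have hsq := norm_integral_freeGroup_sq_le hG (measurable_truncAmp f R) hA0
    (lintegral_truncDual_rpow f hR) hN hlin.le
  set Φ := ∫ t, freeGroup (-t) (toL2 fun x => truncDual f R (t, x)) with hΦ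
  have hin : inner ℂ f Φ = (N : ℂ) := by
    rw [hΦ, ← integral_inner hG, hNdef, ← integral_complex_ofReal]
    exact integral_congr_ae (Filter.Eventually.of_forall fun t => inner_freeGroup_truncDual f hR t)
  have hle : N ≤ ‖f‖ * ‖Φ‖ := by
    have := norm_inner_le_norm (𝕜 := ℂ) f Φ
    rwa [hin, Complex.norm_real, Real.norm_eq_abs, abs_of_nonneg hN0] at this
  have h3 : N ^ 2 ≤ 16 * ‖f‖ ^ 2 * N ^ (4 / 3 : ℝ) := by
    calc N ^ 2 ≤ (‖f‖ * ‖Φ‖) ^ 2 := by gcongr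
      _ = ‖f‖ ^ 2 * ‖Φ‖ ^ 2 := by ring
      _ ≤ ‖f‖ ^ 2 * (16 * N ^ (4 / 3 : ℝ)) := by gcongr
      _ = _ := by ring
  set y := N ^ (1 / 3 : ℝ) with hy
  have hyp : 0 < y := by positivity
  have hNy : N = y ^ 3 := by rw [hy, ← Real.rpow_natCast, ← Real.rpow_mul hN0]; norm_num
  have hNy4 : N ^ (4 / 3 : ℝ) = y ^ 4 := by
    rw [hy, ← Real.rpow_natCast, ← Real.rpow_mul hN0]; norm_num
  rw [hNy4, hNy] at h3
  have h4 : y ^ 2 ≤ (4 * ‖f‖) ^ 2 := by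
    have : y ^ 4 * y ^ 2 ≤ y ^ 4 * (4 * ‖f‖) ^ 2 := by nlinarith
    exact le_of_mul_le_mul_left this (by positivity)
  have h5 : y ≤ 4 * ‖f‖ := (sq_le_sq₀ hyp.le (by positivity)).1 h4
  calc N = y ^ 3 := hNy
    _ ≤ (4 * ‖f‖) ^ 3 := by gcongr
    _ = _ := by ring

end Truncation

/-- The `L³_t L⁶_x` Strichartz estimate. -/
theorem lintegral_rep_six_le (f : L2) :
    ∫⁻ t, (∫⁻ x, ‖rep f (t, x)‖ₑ ^ (6 : ℝ)) ^ (1 / 2 : ℝ) ≤ ENNReal.ofReal (64 * ‖f‖ ^ 3) := by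
  have hRp : ∀ n : ℕ, (0 : ℝ) < n + 1 := fun n => by positivity
  -- Monotone convergence: the truncation sets increase and exhaust space-time.
  have hlim : ∀ t, Filter.Tendsto (fun n : ℕ => truncSix f (n + 1) t) Filter.atTop
      (nhds (∫⁻ x, ‖rep f (t, x)‖ₑ ^ (6 : ℝ))) := by
    intro t
    refine lintegral_tendsto_of_tendsto_of_monotone
      (fun n => ((measurable_trunc_slice f _ t).enorm.pow_const _).aemeasurable)
      (Filter.Eventually.of_forall fun x => ?_) (Filter.Eventually.of_forall fun x => ?_)
    · intro n m hnm
      have hnm' : (n : ℝ) ≤ m := by exact_mod_cast hnm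
      simp only [trunc]
      by_cases h : (t, x) ∈ truncSet f (n + 1)
      · have h' : (t, x) ∈ truncSet f (m + 1) :=
          ⟨h.1.trans (by linarith), h.2.1.trans (by linarith), h.2.2.trans (by linarith)⟩
        simp only [Set.indicator_of_mem h, Set.indicator_of_mem h', le_refl]
      · simp [Set.indicator_of_notMem h]
    · refine tendsto_const_nhds.congr' ?_
      filter_upwards [Filter.eventually_ge_atTop ⌈max |t| (max ‖x‖ ‖rep f (t, x)‖)⌉₊] with n hn
      have hn' : max |t| (max ‖x‖ ‖rep f (t, x)‖) ≤ n := Nat.ceil_le.1 hn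
      have h : (t, x) ∈ truncSet f (n + 1) := by
        simp only [max_le_iff] at hn'
        exact ⟨by linarith [hn'.1], by linarith [hn'.2.1], by linarith [hn'.2.2]⟩
      simp only [trunc, Set.indicator_of_mem h]
  have hle : ∀ t, (∫⁻ x, ‖rep f (t, x)‖ₑ ^ (6 : ℝ)) ^ (1 / 2 : ℝ) ≤
      Filter.liminf (fun n : ℕ => ENNReal.ofReal (truncAmp f (n + 1) t) ^ (3 / 2 : ℝ))
        Filter.atTop := by
    intro t
    set m := ∫⁻ x, ‖rep f (t, x)‖ₑ ^ (6 : ℝ) with hm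
    rcases eq_or_ne m 0 with h0 | h0
    · rw [h0, ENNReal.zero_rpow_of_pos (by norm_num)]; exact zero_le
    have hT : Filter.Tendsto (fun n : ℕ => ENNReal.ofReal (truncAmp f (n + 1) t) ^ (3 / 2 : ℝ))
        Filter.atTop (nhds (m ^ (1 / 2 : ℝ))) := by
      refine ((ENNReal.continuous_rpow_const.tendsto m).comp (hlim t)).congr' ?_
      -- A finite positive c below m exists even if m = ∞. The truncated values eventually exceed c,
      -- hence the cutoff (n + 1)⁻¹.
      obtain ⟨c, hc0, hcm⟩ := exists_between (pos_iff_ne_zero.2 h0)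
      have hctop : c ≠ ∞ := (hcm.trans_le le_top).ne
      have hcr : 0 < c.toReal := ENNReal.toReal_pos hc0.ne' hctop
      have h1 : ∀ᶠ n : ℕ in Filter.atTop, ((n : ℝ) + 1)⁻¹ < c.toReal := by
        have := tendsto_one_div_add_atTop_nhds_zero_nat (𝕜 := ℝ)
        filter_upwards [this.eventually_lt_const hcr] with n hn
        simpa using hn
      filter_upwards [(hlim t).eventually_const_lt hcm, h1] with n h2 h3
      have hfin := (truncSix_lt_top f (hRp n) t).ne
      have h4 : ((n : ℝ) + 1)⁻¹ ≤ (truncSix f (n + 1) t).toReal :=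
        h3.le.trans ((ENNReal.toReal_le_toReal hctop hfin).2 h2.le)
      simp only [Function.comp, truncAmp, if_pos h4]
      rw [← ENNReal.ofReal_rpow_of_nonneg ENNReal.toReal_nonneg (by norm_num),
        ENNReal.ofReal_toReal hfin, ← ENNReal.rpow_mul]
      norm_num
    exact hT.liminf_eq.ge
  calc _ ≤ ∫⁻ t, Filter.liminf
        (fun n : ℕ => ENNReal.ofReal (truncAmp f (n + 1) t) ^ (3 / 2 : ℝ)) Filter.atTop :=
        lintegral_mono hle
    _ ≤ Filter.liminf (fun n : ℕ => ∫⁻ t, ENNReal.ofReal (truncAmp f (n + 1) t) ^ (3 / 2 : ℝ))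
        Filter.atTop := lintegral_liminf_le fun n =>
          (measurable_truncAmp f _).ennreal_ofReal.pow_const _
    _ ≤ Filter.liminf (fun _ : ℕ => ENNReal.ofReal (64 * ‖f‖ ^ 3)) Filter.atTop :=
        Filter.liminf_le_liminf (Filter.Eventually.of_forall fun n =>
          lintegral_truncAmp_le f (hRp n))
    _ = _ := by rw [Filter.liminf_const]

end CR

namespace CR

/-! ### The trilinear form of the free evolution in `L²` -/

/-- The product `u₁ u₂ conj(u₃)` of three free evolutions. -/
noncomputable def cubic (f₁ f₂ f₃ : L2) (p : ℝ × Plane) : ℂ :=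
  rep f₁ p * rep f₂ p * conj (rep f₃ p)

theorem measurable_cubic (f₁ f₂ f₃ : L2) : Measurable (cubic f₁ f₂ f₃) :=
  ((measurable_rep f₁).mul (measurable_rep f₂)).mul
    (Complex.continuous_conj.measurable.comp (measurable_rep f₃))

theorem cubic_ae (f₁ f₂ f₃ : L2) (t : ℝ) : (fun x => cubic f₁ f₂ f₃ (t, x)) =ᵐ[volume]
    fun x => freeGroup t f₁ x * freeGroup t f₂ x * conj (freeGroup t f₃ x) := by
  filter_upwards [rep_ae f₁ t, rep_ae f₂ t, rep_ae f₃ t] with x h1 h2 h3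
  simp only [cubic, h1, h2, h3]

/-- Compare with the maximum of the three. This crude substitute for Hölder is enough, since only
finiteness is needed. -/
theorem mul_mul_rpow_two_le (a b c : ℝ≥0∞) :
    (a * b * c) ^ (2 : ℝ) ≤ a ^ (6 : ℝ) + b ^ (6 : ℝ) + c ^ (6 : ℝ) := by
  have key : ∀ m : ℝ≥0∞, a ≤ m → b ≤ m → c ≤ m → (a * b * c) ^ (2 : ℝ) ≤ m ^ (6 : ℝ) := by
    intro m ha hb hc
    calc (a * b * c) ^ (2 : ℝ) ≤ (m * m * m) ^ (2 : ℝ) := by gcongr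
      _ = m ^ (6 : ℝ) := by
        rw [← pow_two, ← pow_succ, ← ENNReal.rpow_natCast, ← ENNReal.rpow_mul]; norm_num
  rcases le_total a b with h1 | h1 <;> rcases le_total b c with h2 | h2
  · exact (key c (h1.trans h2) h2 le_rfl).trans le_add_self
  · exact (key b h1 le_rfl h2).trans (le_add_self.trans le_self_add)
  · rcases le_total a c with h3 | h3
    · exact (key c h3 h2 le_rfl).trans le_add_self
    · exact (key a le_rfl h1 h3).trans (le_self_add.trans le_self_add)
  · exact (key a le_rfl h1 (h2.trans h1)).trans (le_self_add.trans le_self_add)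

theorem measurable_lintegral_cubic (f₁ f₂ f₃ : L2) :
    Measurable fun t => ∫⁻ x, ‖cubic f₁ f₂ f₃ (t, x)‖ₑ ^ (2 : ℝ) :=
  Measurable.lintegral_prod_right' (f := fun p => ‖cubic f₁ f₂ f₃ p‖ₑ ^ (2 : ℝ))
    ((measurable_cubic f₁ f₂ f₃).enorm.pow_const _)

/-- The square root is subadditive, so the L² norm of the product at time t is at most the sum of
the cubes of the three L⁶ norms, each integrable in time by the L³L⁶ estimate. -/
theorem lintegral_cubic_lt_top (f₁ f₂ f₃ : L2) :
    ∫⁻ t, (∫⁻ x, ‖cubic f₁ f₂ f₃ (t, x)‖ₑ ^ (2 : ℝ)) ^ (1 / 2 : ℝ) < ∞ := by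
  have m : ∀ f : L2, Measurable fun t => ∫⁻ x, ‖rep f (t, x)‖ₑ ^ (6 : ℝ) := fun f =>
    Measurable.lintegral_prod_right' (f := fun p => ‖rep f p‖ₑ ^ (6 : ℝ))
      ((measurable_rep f).enorm.pow_const _)
  have hs : ∀ (f : L2) (t : ℝ), Measurable fun x => ‖rep f (t, x)‖ₑ ^ (6 : ℝ) := fun f t =>
    ((measurable_rep f).comp measurable_prodMk_left).enorm.pow_const _
  have hpt : ∀ t, (∫⁻ x, ‖cubic f₁ f₂ f₃ (t, x)‖ₑ ^ (2 : ℝ)) ^ (1 / 2 : ℝ) ≤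
      (∫⁻ x, ‖rep f₁ (t, x)‖ₑ ^ (6 : ℝ)) ^ (1 / 2 : ℝ) +
      (∫⁻ x, ‖rep f₂ (t, x)‖ₑ ^ (6 : ℝ)) ^ (1 / 2 : ℝ) +
      (∫⁻ x, ‖rep f₃ (t, x)‖ₑ ^ (6 : ℝ)) ^ (1 / 2 : ℝ) := by
    intro t
    have h1 : ∫⁻ x, ‖cubic f₁ f₂ f₃ (t, x)‖ₑ ^ (2 : ℝ) ≤ (∫⁻ x, ‖rep f₁ (t, x)‖ₑ ^ (6 : ℝ)) +
        (∫⁻ x, ‖rep f₂ (t, x)‖ₑ ^ (6 : ℝ)) + ∫⁻ x, ‖rep f₃ (t, x)‖ₑ ^ (6 : ℝ) := by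
      rw [← lintegral_add_right _ (hs f₂ t), ← lintegral_add_right _ (hs f₃ t)]
      refine lintegral_mono fun x => ?_
      rw [cubic, enorm_mul, enorm_mul, RCLike.enorm_conj]
      exact mul_mul_rpow_two_le _ _ _
    refine (ENNReal.rpow_le_rpow h1 (by norm_num)).trans ?_
    refine (ENNReal.rpow_add_le_add_rpow _ _ (by norm_num) (by norm_num)).trans ?_
    gcongr
    exact ENNReal.rpow_add_le_add_rpow _ _ (by norm_num) (by norm_num)
  refine (lintegral_mono hpt).trans_lt ?_
  rw [lintegral_add_right _ ((m f₃).pow_const _), lintegral_add_right _ ((m f₂).pow_const _)]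
  have hf : ∀ f, ∫⁻ t, (∫⁻ x, ‖rep f (t, x)‖ₑ ^ (6 : ℝ)) ^ (1 / 2 : ℝ) < ∞ := fun f =>
    (lintegral_rep_six_le f).trans_lt ENNReal.ofReal_lt_top
  exact ENNReal.add_lt_top.2 ⟨ENNReal.add_lt_top.2 ⟨hf f₁, hf f₂⟩, hf f₃⟩

theorem ae_memLp_cubic (f₁ f₂ f₃ : L2) :
    ∀ᵐ t, MemLp (fun x => cubic f₁ f₂ f₃ (t, x)) 2 volume := by
  filter_upwards [ae_lt_top ((measurable_lintegral_cubic f₁ f₂ f₃).pow_const _)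
    (lintegral_cubic_lt_top f₁ f₂ f₃).ne] with t ht
  refine (memLp_two_iff ((measurable_cubic f₁ f₂ f₃).comp
    (measurable_prodMk_left (x := t))).aestronglyMeasurable).2 ?_
  exact (ENNReal.rpow_lt_top_iff_of_pos (by norm_num)).1 ht

theorem integrable_freeGroup_cubic (f₁ f₂ f₃ : L2) :
    Integrable fun t => freeGroup (-t) (toL2 fun x => cubic f₁ f₂ f₃ (t, x)) := by
  refine ⟨(stronglyMeasurable_freeGroup_toL2 (measurable_cubic f₁ f₂ f₃)).aestronglyMeasurable, ?_⟩
  refine (lintegral_mono fun t => ?_).trans_lt (lintegral_cubic_lt_top f₁ f₂ f₃)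
  rw [← ofReal_norm, norm_freeGroup, ofReal_norm]
  exact norm_toL2_le

/-- The product `u₁ u₂ conj(u₃)` of three free evolutions at time `t`. -/
noncomputable def freeCubic (f₁ f₂ f₃ : L2) (t : ℝ) (x : Plane) : ℂ :=
  freeGroup t f₁ x * freeGroup t f₂ x * conj (freeGroup t f₃ x)

theorem toL2_freeCubic (f₁ f₂ f₃ : L2) (t : ℝ) :
    toL2 (freeCubic f₁ f₂ f₃ t) = toL2 fun x => cubic f₁ f₂ f₃ (t, x) :=
  toL2_congr (cubic_ae f₁ f₂ f₃ t).symm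

theorem ae_memLp_freeCubic (f₁ f₂ f₃ : L2) : ∀ᵐ t, MemLp (freeCubic f₁ f₂ f₃ t) 2 volume := by
  filter_upwards [ae_memLp_cubic f₁ f₂ f₃] with t ht
  exact (memLp_congr_ae (cubic_ae f₁ f₂ f₃ t)).1 ht

theorem integrable_freeGroup_freeCubic (f₁ f₂ f₃ : L2) :
    Integrable fun t => freeGroup (-t) (toL2 (freeCubic f₁ f₂ f₃ t)) := by
  simp_rw [toL2_freeCubic]; exact integrable_freeGroup_cubic f₁ f₂ f₃

/-- The product of four free evolutions at time `t`. -/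
noncomputable def freeQuartic (f₁ f₂ f₃ f₄ : L2) (t : ℝ) (x : Plane) : ℂ :=
  freeGroup t f₁ x * freeGroup t f₂ x * conj (freeGroup t f₃ x) * conj (freeGroup t f₄ x)

theorem quartic_slice_ae (f₁ f₂ f₃ f₄ : L2) (t : ℝ) :
    (fun x => quartic (rep f₁) (rep f₂) (rep f₃) (rep f₄) (t, x)) =ᵐ[volume]
      freeQuartic f₁ f₂ f₃ f₄ t := by
  filter_upwards [rep_ae f₁ t, rep_ae f₂ t, rep_ae f₃ t, rep_ae f₄ t] with x h1 h2 h3 h4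
  simp only [quartic, freeQuartic, h1, h2, h3, h4]

theorem integrable_quartic_rep (f₁ f₂ f₃ f₄ : L2) :
    Integrable (quartic (rep f₁) (rep f₂) (rep f₃) (rep f₄)) volume :=
  integrable_quartic (finiteL4 f₁) (finiteL4 f₂) (finiteL4 f₃) (finiteL4 f₄)

theorem absConvergent_freeQuartic (f₁ f₂ f₃ f₄ : L2) :
    AbsConvergent volume (freeQuartic f₁ f₂ f₃ f₄) := by
  have h := integrable_quartic_rep f₁ f₂ f₃ f₄
  rw [Measure.volume_eq_prod] at h
  refine ⟨?_, ?_, ?_⟩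
  · filter_upwards [h.prod_right_ae] with t ht
    exact ht.congr (quartic_slice_ae f₁ f₂ f₃ f₄ t)
  · refine h.norm.integral_prod_left.congr (Filter.Eventually.of_forall fun t => ?_)
    refine integral_congr_ae ?_
    filter_upwards [quartic_slice_ae f₁ f₂ f₃ f₄ t] with x hx
    rw [hx]
  · exact h.integral_prod_left.congr (Filter.Eventually.of_forall fun t =>
      integral_congr_ae (quartic_slice_ae f₁ f₂ f₃ f₄ t))

theorem strForm_eq (f₁ f₂ f₃ f₄ : L2) :
    strForm f₁ f₂ f₃ f₄ = ∫ t, ∫ x, freeQuartic f₁ f₂ f₃ f₄ t x := by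
  have h := integrable_quartic_rep f₁ f₂ f₃ f₄
  rw [strForm, Measure.volume_eq_prod] at *
  rw [integral_prod _ h]
  exact integral_congr_ae (Filter.Eventually.of_forall fun t =>
      integral_congr_ae (quartic_slice_ae f₁ f₂ f₃ f₄ t))

/-- Pair with an arbitrary v. Bochner integrability lets the inner product pass under the time
integral, and unitarity turns the integrand into the product of four evolutions. -/
theorem toL2_T_eq (f₁ f₂ f₃ : L2) :
    toL2 (T f₁ f₂ f₃) = (4 * Real.pi : ℂ) • ∫ t, freeGroup (-t) (toL2 (freeCubic f₁ f₂ f₃ t)) := by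
  have hT : MemLp (T f₁ f₂ f₃) 2 volume := memLp_T (measurable_coe _) (measurable_coe _) (measurable_coe _) (Lp.memLp f₁) (Lp.memLp f₂)
      (Lp.memLp f₃)
  refine ext_inner_left ℂ fun v => ?_
  rw [inner_smul_right, ← integral_inner (integrable_freeGroup_freeCubic f₁ f₂ f₃)]
  have h1 : inner ℂ v (toL2 (T f₁ f₂ f₃)) = energy f₁ f₂ f₃ v := by
    rw [L2.inner_def, energy]
    refine integral_congr_ae ?_
    filter_upwards [coeFn_toL2 hT] with x hx
    rw [hx, RCLike.inner_apply]
  rw [h1, energy_eq_strForm, strForm_eq]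
  congr 1
  refine integral_congr_ae ?_
  filter_upwards [ae_memLp_freeCubic f₁ f₂ f₃] with t ht
  rw [← inner_freeGroup, L2.inner_def]
  refine integral_congr_ae ?_
  filter_upwards [coeFn_toL2 ht] with x hx
  rw [hx, RCLike.inner_apply]
  rfl

end CR

namespace CR

/-! ### The harmonic oscillator on coherent states -/

theorem quad_add_smul (a : ℂ) (b : Fin 2 → ℂ) (x : Plane) (i : Fin 2) (s : ℝ) :
    quad a b (x + s • EuclideanSpace.basisFun (Fin 2) ℝ i) =
      quad a b x + (s * (b i - 2 * a * x i) - a * s ^ 2) := by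
  simp only [quad, normSq_plane, PiLp.add_apply, PiLp.smul_apply, EuclideanSpace.basisFun_apply,
    smul_eq_mul]
  fin_cases i <;> simp <;> ring

theorem hasDerivAt_exp_quadratic (p a : ℂ) (s : ℝ) :
    HasDerivAt (fun s : ℝ => exp (s * p - a * s ^ 2)) ((p - 2 * a * s) * exp (s * p - a * s ^ 2))
      s := by
  have h1 : HasDerivAt (fun s : ℝ => (s : ℂ)) 1 s := Complex.ofRealCLM.hasDerivAt
  have h2 := ((h1.mul_const p).sub ((h1.pow 2).const_mul a)).cexp
  convert! h2 using 1
  simp; ring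

theorem lineDeriv_gaussS (a : ℂ) (b : Fin 2 → ℂ) (ha : 0 < a.re) (i : Fin 2) (x : Plane) :
    LineDeriv.lineDerivOp (EuclideanSpace.basisFun (Fin 2) ℝ i) (gaussS a b ha) x =
      (b i - 2 * a * x i) * gauss a b x := by
  rw [lineDerivOp_apply, lineDeriv]
  have e : (fun s : ℝ => (gaussS a b ha) (x + s • EuclideanSpace.basisFun (Fin 2) ℝ i)) =
      fun s : ℝ => gauss a b x * exp (s * (b i - 2 * a * x i) - a * s ^ 2) := by
    ext s
    rw [gaussS_apply, gauss, quad_add_smul, Complex.exp_add, gauss]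
  rw [e, ((hasDerivAt_exp_quadratic _ a 0).const_mul _).deriv]
  simp; ring

theorem lineDeriv_lineDeriv_gaussS (a : ℂ) (b : Fin 2 → ℂ) (ha : 0 < a.re) (i : Fin 2)
    (x : Plane) :
    LineDeriv.lineDerivOp (EuclideanSpace.basisFun (Fin 2) ℝ i)
      (LineDeriv.lineDerivOp (EuclideanSpace.basisFun (Fin 2) ℝ i) (gaussS a b ha)) x =
      ((b i - 2 * a * x i) ^ 2 - 2 * a) * gauss a b x := by
  rw [lineDerivOp_apply, lineDeriv]
  set p := b i - 2 * a * x i with hp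
  have e : (fun s : ℝ => (LineDeriv.lineDerivOp (EuclideanSpace.basisFun (Fin 2) ℝ i)
      (gaussS a b ha)) (x + s • EuclideanSpace.basisFun (Fin 2) ℝ i)) =
      fun s : ℝ => gauss a b x * ((p - 2 * a * s) * exp (s * p - a * s ^ 2)) := by
    ext s
    rw [lineDeriv_gaussS, gauss, quad_add_smul, Complex.exp_add, gauss, hp]
    simp only [PiLp.add_apply, PiLp.smul_apply, EuclideanSpace.basisFun_apply, smul_eq_mul]
    simp
    ring
  have h1 : HasDerivAt (fun s : ℝ => p - 2 * a * (s : ℂ)) (-(2 * a)) 0 := by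
    simpa using ((Complex.ofRealCLM.hasDerivAt (x := 0)).const_mul (2 * a)).const_sub p
  have h2 : HasDerivAt (fun s : ℝ => gauss a b x * ((p - 2 * a * s) * exp (s * p - a * s ^ 2))) _ 0 :=
    (h1.mul (hasDerivAt_exp_quadratic p a 0)).const_mul _
  rw [e, h2.deriv]
  simp; ring

theorem laplacian_gaussS (a : ℂ) (b : Fin 2 → ℂ) (ha : 0 < a.re) (x : Plane) :
    Laplacian.laplacian (gaussS a b ha : Plane → ℂ) x =
      ((b 0 - 2 * a * x 0) ^ 2 + (b 1 - 2 * a * x 1) ^ 2 - 4 * a) * gauss a b x := by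
  rw [← SchwartzMap.laplacian_apply,
    SchwartzMap.laplacian_eq_sum (EuclideanSpace.basisFun (Fin 2) ℝ), Fin.sum_univ_two, add_apply,
    lineDeriv_lineDeriv_gaussS, lineDeriv_lineDeriv_gaussS]
  ring

/-- The bilinear pairing of `b ∈ ℂ²` with `x ∈ ℝ²`. -/
def lin (b : Fin 2 → ℂ) (x : Plane) : ℂ := b 0 * (x 0 : ℂ) + b 1 * (x 1 : ℂ)

theorem oscillator_gaussS (b : Fin 2 → ℂ) (h : 0 < (1 / 2 : ℂ).re) (x : Plane) :
    oscillator (gaussS (1 / 2) b h) x = (2 + 2 * lin b x - dot b b) * gauss (1 / 2) b x := by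
  rw [oscillator_apply, laplacian_gaussS, gaussS_apply, normSq_plane, lin, dot]
  push_cast; ring

theorem half_re_pos : 0 < (1 / 2 : ℂ).re := by norm_num

/-- The normalized coherent state with parameter `w b`, as a function. -/
noncomputable def cohFun (b : Fin 2 → ℂ) (w : ℂ) (x : Plane) : ℂ :=
  exp (-(w ^ 2 * dot b b / 4)) * gauss (1 / 2) (fun i => w * b i) x

/-- The derivative of the normalized coherent state in the parameter `w`. -/
noncomputable def cohFunDeriv (b : Fin 2 → ℂ) (w : ℂ) (x : Plane) : ℂ :=
  (lin b x - w * dot b b / 2) * cohFun b w x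

/-- The normalized coherent state as a Schwartz function. -/
noncomputable def cohS (b : Fin 2 → ℂ) (w : ℂ) : 𝓢(Plane, ℂ) :=
  exp (-(w ^ 2 * dot b b / 4)) • gaussS (1 / 2) (fun i => w * b i) half_re_pos

/-- The normalized coherent state in `L²`. -/
noncomputable def cohState (b : Fin 2 → ℂ) (w : ℂ) : L2 :=
  exp (-(w ^ 2 * dot b b / 4)) • coh (fun i => w * b i)

theorem cohS_apply (b : Fin 2 → ℂ) (w : ℂ) (x : Plane) : cohS b w x = cohFun b w x := by
  simp [cohS, cohFun]

theorem coeFn_cohState (b : Fin 2 → ℂ) (w : ℂ) : cohState b w =ᵐ[volume] cohFun b w := by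
  filter_upwards [Lp.coeFn_smul (exp (-(w ^ 2 * dot b b / 4))) (coh fun i => w * b i),
    coeFn_coh fun i => w * b i] with x h1 h2
  rw [cohState, h1, Pi.smul_apply, h2, smul_eq_mul, cohFun]

/-- The factor exp(-w² b·b/4) is chosen so that H acts as 2 + 2w∂_w: the states are a generating
function of eigenfunctions in powers of w. -/
theorem oscillator_cohS (b : Fin 2 → ℂ) (w : ℂ) (x : Plane) :
    oscillator (cohS b w) x = 2 * cohFun b w x + 2 * w * cohFunDeriv b w x := by
  rw [cohS, map_smul, smul_apply, oscillator_gaussS, smul_eq_mul, cohFunDeriv, cohFun]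
  simp only [lin, dot]
  ring

theorem hasDerivAt_cohFun (b : Fin 2 → ℂ) (x : Plane) (w : ℂ) :
    HasDerivAt (fun w => cohFun b w x) (cohFunDeriv b w x) w := by
  have e : (fun w => cohFun b w x) =
      fun w => exp (-(w ^ 2 * dot b b / 4) + (-(1 / 2) * ((‖x‖ ^ 2 : ℝ) : ℂ) + w * lin b x)) := by
    ext w
    simp only [cohFun, gauss, quad, ← Complex.exp_add, lin]
    congr 1; ring
  have h1 : HasDerivAt (fun w : ℂ => -(w ^ 2 * dot b b / 4) +
      (-(1 / 2) * ((‖x‖ ^ 2 : ℝ) : ℂ) + w * lin b x)) (lin b x - w * dot b b / 2) w := by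
    have h := ((((hasDerivAt_id w).pow 2).mul_const (dot b b)).div_const 4).neg.add
      (((hasDerivAt_id w).mul_const (lin b x)).const_add (-(1 / 2) * ((‖x‖ ^ 2 : ℝ) : ℂ)))
    convert! h using 1
    simp; ring
  have h2 := h1.cexp
  rw [← e] at h2
  have h3 : cohFunDeriv b w x = exp (-(w ^ 2 * dot b b / 4) +
      (-(1 / 2) * ((‖x‖ ^ 2 : ℝ) : ℂ) + w * lin b x)) * (lin b x - w * dot b b / 2) := by
    rw [cohFunDeriv, mul_comm, show cohFun b w x = _ from congrFun e w]
  rw [h3]; exact h2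

theorem continuous_cohFun (b : Fin 2 → ℂ) (w : ℂ) : Continuous (cohFun b w) :=
  (continuous_gauss _ _).const_mul _

theorem continuous_cohFunDeriv (b : Fin 2 → ℂ) (w : ℂ) : Continuous (cohFunDeriv b w) := by
  have := continuous_cohFun b w
  unfold cohFunDeriv lin
  fun_prop

theorem norm_lin_le (b : Fin 2 → ℂ) (x : Plane) : ‖lin b x‖ ≤ (‖b 0‖ + ‖b 1‖) * ‖x‖ := by
  have hx : ∀ i : Fin 2, ‖(x i : ℂ)‖ ≤ ‖x‖ := fun i => by
    rw [Complex.norm_real]; exact PiLp.norm_apply_le x i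
  calc ‖lin b x‖ ≤ ‖b 0‖ * ‖(x 0 : ℂ)‖ + ‖b 1‖ * ‖(x 1 : ℂ)‖ := by
        rw [← norm_mul, ← norm_mul]; exact norm_add_le _ _
    _ ≤ ‖b 0‖ * ‖x‖ + ‖b 1‖ * ‖x‖ := by gcongr <;> exact hx _
    _ = _ := by ring

/-- Half of the decay exp(-|x|²/2) absorbs the linear exponent and the factor 1 + |x|; the other
half remains as a dominating Gaussian, uniformly in w on bounded sets. -/
theorem exists_norm_cohFun_le (b : Fin 2 → ℂ) (R : ℝ) : ∃ C : ℝ, ∀ w : ℂ, ‖w‖ ≤ R → ∀ x,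
    ‖cohFun b w x‖ ≤ C * ‖gauss (1 / 4) 0 x‖ ∧ ‖cohFunDeriv b w x‖ ≤ C * ‖gauss (1 / 4) 0 x‖ := by
  set B := ‖b 0‖ + ‖b 1‖ with hB
  set E := ‖dot b b‖ with hE
  set D := Real.exp (R ^ 2 * E / 4) with hD
  set M := (Nat.factorial 1 : ℝ) * Real.exp (1 + (R * B + 1) ^ 2 / (4 * (1 / 4 : ℝ))) with hM
  refine ⟨(1 + B + |R| * E) * D * M, fun w hw x => ?_⟩
  have hR : 0 ≤ R := (norm_nonneg w).trans hw
  have hr := norm_nonneg x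
  have hg : ‖gauss (1 / 4) 0 x‖ = Real.exp (-(1 / 4) * ‖x‖ ^ 2) := by
    rw [gauss, Complex.norm_exp]
    congr 1
    simp only [quad, Pi.zero_apply, zero_mul, add_zero, Complex.re_mul_ofReal]
    norm_num
  have h1 : ‖exp (-(w ^ 2 * dot b b / 4))‖ ≤ D := by
    rw [Complex.norm_exp, hD, Real.exp_le_exp]
    refine (Complex.re_le_norm _).trans ?_
    rw [norm_neg, norm_div, norm_mul, norm_pow]
    norm_num
    gcongr
  have h2 : (1 + ‖x‖) * ‖gauss (1 / 2) (fun i => w * b i) x‖ ≤ M * ‖gauss (1 / 4) 0 x‖ := by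
    have h3 := norm_gauss_le (1 / 2) (fun i => w * b i) x
    have h4 := one_add_pow_mul_exp_le (α := 1 / 4) (β := R * B) (by norm_num) 1 hr
    rw [pow_one] at h4
    rw [hg]
    calc (1 + ‖x‖) * ‖gauss (1 / 2) (fun i => w * b i) x‖
        ≤ (1 + ‖x‖) * (Real.exp (-(1 / 4) * ‖x‖ ^ 2 + R * B * ‖x‖) *
          Real.exp (-(1 / 4) * ‖x‖ ^ 2)) := by
          gcongr
          refine h3.trans ?_
          rw [← Real.exp_add, Real.exp_le_exp, norm_mul, norm_mul, ← mul_add]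
          have : ‖w‖ * B * ‖x‖ ≤ R * B * ‖x‖ := by gcongr
          norm_num
          linarith
      _ ≤ _ := by rw [← mul_assoc]; gcongr
  have h5 : ‖cohFun b w x‖ * (1 + ‖x‖) ≤ D * (M * ‖gauss (1 / 4) 0 x‖) := by
    rw [cohFun, norm_mul, mul_assoc, mul_comm ‖gauss _ _ _‖]
    gcongr
  have hBp : 0 ≤ B := by positivity
  have hEp : 0 ≤ E := norm_nonneg _
  have hc := norm_nonneg (cohFun b w x)
  have h6 : ‖cohFun b w x‖ ≤ D * (M * ‖gauss (1 / 4) 0 x‖) := by nlinarith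
  have h7 : 0 ≤ D * (M * ‖gauss (1 / 4) 0 x‖) := hc.trans h6
  rw [abs_of_nonneg hR]
  have hRE : 0 ≤ R * E := by positivity
  refine ⟨by nlinarith [mul_nonneg hBp h7, mul_nonneg hRE h7], ?_⟩
  have h8 : ‖lin b x - w * dot b b / 2‖ ≤ B * ‖x‖ + R * E := by
    refine (norm_sub_le _ _).trans (add_le_add (norm_lin_le b x) ?_)
    rw [norm_div, norm_mul]
    norm_num
    have : ‖w‖ * E ≤ R * E := by gcongr
    linarith
  rw [cohFunDeriv, norm_mul]
  calc ‖lin b x - w * dot b b / 2‖ * ‖cohFun b w x‖ ≤ (B * ‖x‖ + R * E) * ‖cohFun b w x‖ := by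
        gcongr
    _ ≤ (B + R * E) * (‖cohFun b w x‖ * (1 + ‖x‖)) := by
        nlinarith [mul_nonneg hBp hc, mul_nonneg (mul_nonneg hRE hc) hr]
    _ ≤ (B + R * E) * (D * (M * ‖gauss (1 / 4) 0 x‖)) := by gcongr
    _ ≤ _ := by nlinarith

theorem hasDerivAt_integral_cohFun (b : Fin 2 → ℂ) {g : Plane → ℂ} (hg : MemLp g 2 volume)
    (w : ℂ) : HasDerivAt (fun w => ∫ x, cohFun b w x * g x) (∫ x, cohFunDeriv b w x * g x) w := by
  obtain ⟨C, hC⟩ := exists_norm_cohFun_le b (‖w‖ + 1)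
  have hdom : Integrable (fun x => C * ‖gauss (1 / 4) 0 x‖ * ‖g x‖) := by
    have h := ((memLp_gauss (a := 1 / 4) (by norm_num) 0 2).integrable_mul hg).norm.const_mul C
    refine h.congr (Filter.Eventually.of_forall fun x => ?_)
    simp [mul_assoc]
  have hmeas : ∀ w, AEStronglyMeasurable (fun x => cohFun b w x * g x) volume := fun w =>
    (continuous_cohFun b w).aestronglyMeasurable.mul hg.1
  have hb : ∀ w' ∈ Metric.ball w 1, ‖w'‖ ≤ ‖w‖ + 1 := by
    intro w' hw'
    rw [mem_ball_iff_norm] at hw'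
    have := norm_le_norm_add_norm_sub' w' w
    linarith
  refine (hasDerivAt_integral_of_dominated_loc_of_deriv_le (μ := volume)
    (F := fun w x => cohFun b w x * g x) (F' := fun w x => cohFunDeriv b w x * g x)
    (bound := fun x => C * ‖gauss (1 / 4) 0 x‖ * ‖g x‖) (Metric.ball_mem_nhds w one_pos)
    (Filter.Eventually.of_forall hmeas) ?_ ?_ ?_ hdom ?_).2
  · refine hdom.mono' (hmeas w) (Filter.Eventually.of_forall fun x => ?_)
    rw [norm_mul]
    gcongr
    exact (hC w (by linarith) x).1
  · exact (continuous_cohFunDeriv b w).aestronglyMeasurable.mul hg.1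
  · refine Filter.Eventually.of_forall fun x w' hw' => ?_
    rw [norm_mul]
    gcongr
    exact (hC w' (hb w' hw') x).2
  · exact Filter.Eventually.of_forall fun x w' _ => (hasDerivAt_cohFun b x w').mul_const _

end CR

namespace CR

/-! ### Eigenspaces of the oscillator and coherent states -/

theorem memLp_cohFun (b : Fin 2 → ℂ) (w : ℂ) : MemLp (cohFun b w) 2 volume := by
  obtain ⟨C, hC⟩ := exists_norm_cohFun_le b ‖w‖
  exact ((memLp_gauss (a := 1 / 4) (by norm_num) 0 2).norm.const_mul C).mono'
    (continuous_cohFun b w).aestronglyMeasurable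
    (Filter.Eventually.of_forall fun x => (hC w le_rfl x).1)

theorem memLp_cohFunDeriv (b : Fin 2 → ℂ) (w : ℂ) : MemLp (cohFunDeriv b w) 2 volume := by
  obtain ⟨C, hC⟩ := exists_norm_cohFun_le b ‖w‖
  exact ((memLp_gauss (a := 1 / 4) (by norm_num) 0 2).norm.const_mul C).mono'
    (continuous_cohFunDeriv b w).aestronglyMeasurable
    (Filter.Eventually.of_forall fun x => (hC w le_rfl x).2)

theorem memLp_conj_coe (v : L2) : MemLp (fun x => conj (v x)) 2 volume := memLp_conj (Lp.memLp v)

theorem inner_cohState (v : L2) (b : Fin 2 → ℂ) (w : ℂ) :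
    inner ℂ v (cohState b w) = ∫ x, cohFun b w x * conj (v x) := by
  rw [L2.inner_def]
  refine integral_congr_ae ?_
  filter_upwards [coeFn_cohState b w] with x hx
  rw [RCLike.inner_apply, hx]

theorem hasDerivAt_inner_cohState (v : L2) (b : Fin 2 → ℂ) (w : ℂ) :
    HasDerivAt (fun w => inner ℂ v (cohState b w)) (∫ x, cohFunDeriv b w x * conj (v x)) w := by
  simp_rw [inner_cohState]
  exact hasDerivAt_integral_cohFun b (memLp_conj_coe v) w

theorem differentiable_inner_cohState (v : L2) (b : Fin 2 → ℂ) :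
    Differentiable ℂ fun w => inner ℂ v (cohState b w) := fun w =>
  (hasDerivAt_inner_cohState v b w).differentiableAt

theorem integral_oscillator_cohS_mul (b : Fin 2 → ℂ) (w : ℂ) {g : Plane → ℂ}
    (hg : MemLp g 2 volume) : ∫ x, oscillator (cohS b w) x * g x =
      2 * (∫ x, cohFun b w x * g x) + 2 * w * ∫ x, cohFunDeriv b w x * g x := by
  have i₁ : Integrable fun x => cohFun b w x * g x := (memLp_cohFun b w).integrable_mul hg
  have i₂ : Integrable fun x => cohFunDeriv b w x * g x := (memLp_cohFunDeriv b w).integrable_mul hg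
  rw [← integral_const_mul, ← integral_const_mul,
    ← integral_add (i₁.const_mul 2) (i₂.const_mul (2 * w))]
  refine integral_congr_ae (Filter.Eventually.of_forall fun x => ?_)
  simp only [oscillator_cohS]; ring

/-- Testing the weak eigenvalue equation on a coherent state replaces H by 2 + 2w∂_w, and 2 + 2wk'/k
= 2(m + 1) is Euler's equation for degree m. -/
theorem mul_deriv_inner_cohState {m : ℕ} {v : L2} (hv : v ∈ eigenspace m) (b : Fin 2 → ℂ) (w : ℂ) :
    w * ∫ x, cohFunDeriv b w x * conj (v x) = m * inner ℂ v (cohState b w) := by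
  have h := congrArg conj ((mem_eigenspace_iff m v).1 hv (cohS b w))
  rw [map_mul, ← integral_conj, ← integral_conj] at h
  simp only [map_mul, map_add, map_ofNat, map_natCast, map_one, Complex.conj_conj] at h
  rw [integral_oscillator_cohS_mul b w (memLp_conj_coe v)] at h
  simp only [cohS_apply, ← inner_cohState] at h
  linear_combination h / 2

theorem hasDerivAt_circle (θ : ℝ) :
    HasDerivAt (fun θ : ℝ => exp (θ * I)) (exp (θ * I) * I) θ := by
  simpa using ((Complex.ofRealCLM.hasDerivAt (x := θ)).mul_const I).cexp

theorem hasDerivAt_inner_cohState_circle (v : L2) (b : Fin 2 → ℂ) (n : ℕ) (θ : ℝ) :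
    HasDerivAt (fun θ : ℝ => exp (-(n * θ * I)) * inner ℂ v (cohState b (exp (θ * I))))
      (exp (-(n * θ * I)) * (-(n * I) * inner ℂ v (cohState b (exp (θ * I))) +
        (∫ x, cohFunDeriv b (exp (θ * I)) x * conj (v x)) * (exp (θ * I) * I))) θ := by
  have h1 := (hasDerivAt_inner_cohState v b (exp (θ * I))).comp θ (hasDerivAt_circle θ)
  have h2 : HasDerivAt (fun θ : ℝ => exp (-(n * θ * I))) (exp (-(n * θ * I)) * -(n * I)) θ := by
    have := ((((Complex.ofRealCLM.hasDerivAt (x := θ)).const_mul (n : ℂ)).mul_const I).neg).cexp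
    simpa using this
  refine (h2.mul h1).congr_deriv ?_
  simp only [Function.comp]
  ring

/-- By Euler's equation e^{-imθ}k(e^{iθ}) has zero derivative in θ. -/
theorem inner_cohState_of_mem {m : ℕ} {v : L2} (hv : v ∈ eigenspace m) (b : Fin 2 → ℂ) (θ : ℝ) :
    inner ℂ v (cohState b (exp (θ * I))) = exp (θ * I) ^ m * inner ℂ v (cohState b 1) := by
  have hd : ∀ θ : ℝ, HasDerivAt (fun θ : ℝ => exp (-(m * θ * I)) *
      inner ℂ v (cohState b (exp (θ * I)))) 0 θ := by
    intro θ
    refine (hasDerivAt_inner_cohState_circle v b m θ).congr_deriv ?_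
    linear_combination (exp (-(m * θ * I)) * I) * mul_deriv_inner_cohState hv b (exp (θ * I))
  have h := is_const_of_deriv_eq_zero (fun θ => (hd θ).differentiableAt) (fun θ => (hd θ).deriv) θ 0
  simp only [ofReal_zero, zero_mul, mul_zero, neg_zero, Complex.exp_zero, one_mul] at h
  rw [← h, ← Complex.exp_nat_mul, ← mul_assoc, ← Complex.exp_add, mul_assoc, add_neg_cancel,
    Complex.exp_zero, one_mul]

theorem integral_conj_oscillator_mul (φ ψ : 𝓢(Plane, ℂ)) :
    ∫ x, conj (oscillator φ x) * ψ x = ∫ x, conj (φ x) * oscillator ψ x := by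
  have h := integral_bilinear_laplacian_right_eq_left (μ := (volume : Measure Plane)) φ ψ
    ((ContinuousLinearMap.mul ℝ ℂ).comp (Complex.conjCLE : ℂ →L[ℝ] ℂ))
  simp only [ContinuousLinearMap.comp_apply, ContinuousLinearMap.mul_apply',
    ContinuousLinearEquiv.coe_coe, Complex.conjCLE_apply] at h
  have hg : (fun x : Plane => ((‖x‖ ^ 2 : ℝ) : ℂ)).HasTemperateGrowth := by fun_prop
  have hi : ∀ φ ψ : 𝓢(Plane, ℂ), Integrable fun x => conj (φ x) * ψ x := fun φ ψ =>
    (memLp_conj (φ.memLp 2 volume)).integrable_mul (ψ.memLp 2 volume)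
  have e : ∀ φ : 𝓢(Plane, ℂ), ∀ x, oscillator φ x = -(Δ φ) x +
      smulLeftCLM ℂ (fun x : Plane => ((‖x‖ ^ 2 : ℝ) : ℂ)) φ x := fun φ x => by
    rw [oscillator_apply, SchwartzMap.laplacian_apply, smulLeftCLM_apply_apply hg, smul_eq_mul]
  simp only [e, map_add, map_neg, add_mul, mul_add, neg_mul, mul_neg]
  have hn : ∀ φ ψ : 𝓢(Plane, ℂ), Integrable fun x => -(conj (φ x) * ψ x) := fun φ ψ =>
    (hi φ ψ).neg
  rw [integral_add (hn _ _) (hi _ _), integral_add (hn _ _) (hi _ _), integral_neg,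
    integral_neg, h]
  congr 1
  refine integral_congr_ae (Filter.Eventually.of_forall fun x => ?_)
  simp only [smulLeftCLM_apply_apply hg, smul_eq_mul, map_mul, Complex.conj_ofReal]
  ring

/-! ### Continuity of coherent states -/

theorem inner_coh_coh (b c : Fin 2 → ℂ) : inner ℂ (coh b) (coh c) =
    Real.pi * exp (dot (fun i => conj (b i) + c i) (fun i => conj (b i) + c i) / 4) := by
  rw [inner_coh_left]
  have e : ∫ x, gauss (1 / 2) (fun i => conj (b i)) x * (coh c) x =
      ∫ x, gauss 1 (fun i => conj (b i) + c i) x := by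
    refine integral_congr_ae ?_
    filter_upwards [coeFn_coh c] with x hx
    rw [hx, gauss, gauss, gauss, ← Complex.exp_add]
    congr 1
    simp only [quad]; ring
  rw [e, integral_gauss (by norm_num)]
  norm_num

/-- The norm of a difference is expressed through inner products, which are explicit continuous
functions of the parameters. -/
theorem continuous_coh : Continuous coh := by
  rw [continuous_iff_continuousAt]
  intro b
  rw [ContinuousAt, tendsto_iff_norm_sub_tendsto_zero]
  have h1 : ∀ c, ‖coh c - coh b‖ = √(RCLike.re (inner ℂ (coh c) (coh c) - inner ℂ (coh c) (coh b) -
      (inner ℂ (coh b) (coh c) - inner ℂ (coh b) (coh b)))) := by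
    intro c
    rw [norm_eq_sqrt_re_inner (𝕜 := ℂ), inner_sub_sub_self]
    congr 2; ring
  simp_rw [h1, inner_coh_coh]
  have hc : Continuous fun c : Fin 2 → ℂ => √(RCLike.re
      (Real.pi * exp (dot (fun i => conj (c i) + c i) (fun i => conj (c i) + c i) / 4) -
      Real.pi * exp (dot (fun i => conj (c i) + b i) (fun i => conj (c i) + b i) / 4) -
      (Real.pi * exp (dot (fun i => conj (b i) + c i) (fun i => conj (b i) + c i) / 4) -
      Real.pi * exp (dot (fun i => conj (b i) + b i) (fun i => conj (b i) + b i) / 4)) : ℂ)) := by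
    have := Complex.continuous_conj
    refine Real.continuous_sqrt.comp (RCLike.continuous_re.comp ?_)
    unfold dot
    fun_prop
  have h2 := hc.tendsto b
  simpa using h2

theorem continuous_cohState (b : Fin 2 → ℂ) : Continuous (cohState b) := by
  unfold cohState
  exact (by fun_prop : Continuous fun w : ℂ => exp (-(w ^ 2 * dot b b / 4))).smul
    (continuous_coh.comp (by fun_prop))

/-! ### Circle averages of coherent states are eigenfunctions -/

/-- The `n`-th Fourier coefficient of `θ ↦ cohState b e^{iθ}`. -/
noncomputable def circleCoeff (b : Fin 2 → ℂ) (n : ℕ) : L2 :=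
  ∫ θ in (0 : ℝ)..(2 * Real.pi), exp (-(n * θ * I)) • cohState b (exp (θ * I))

theorem inner_circleCoeff (v : L2) (b : Fin 2 → ℂ) (n : ℕ) :
    inner ℂ v (circleCoeff b n) = ∫ θ in (0 : ℝ)..(2 * Real.pi),
      exp (-(n * θ * I)) * inner ℂ v (cohState b (exp (θ * I))) := by
  have hc : Continuous fun θ : ℝ => exp (-(n * θ * I)) • cohState b (exp (θ * I)) :=
    (by fun_prop : Continuous fun θ : ℝ => exp (-(n * θ * I))).smul
      ((continuous_cohState b).comp (by fun_prop))
  have h := (innerSL ℂ v).intervalIntegral_comp_comm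
    (hc.intervalIntegrable (μ := volume) 0 (2 * Real.pi))
  rw [circleCoeff, ← innerSL_apply_apply, ← h]
  simp

theorem continuous_deriv_inner_cohState (v : L2) (b : Fin 2 → ℂ) :
    Continuous fun w => ∫ x, cohFunDeriv b w x * conj (v x) := by
  have h := (differentiable_inner_cohState v b).contDiff (n := 1) |>.continuous_deriv le_rfl
  have e : deriv (fun w => inner ℂ v (cohState b w)) =
      fun w => ∫ x, cohFunDeriv b w x * conj (v x) := by
    ext w; exact (hasDerivAt_inner_cohState v b w).deriv
  rwa [e] at h

/-- Symmetry moves H from the test function to the coherent state, where it is 2 + 2w∂_w.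
Integration by parts over the circle, with no boundary term by periodicity, turns w∂_w into
multiplication by n. -/
theorem circleCoeff_mem_eigenspace (b : Fin 2 → ℂ) (n : ℕ) : circleCoeff b n ∈ eigenspace n := by
  rw [mem_eigenspace_iff]
  intro φ
  have key : ∀ (ψ : 𝓢(Plane, ℂ)) (u : L2),
      ∫ x, conj (ψ x) * u x = inner ℂ (ψ.toLp 2 volume : L2) u := by
    intro ψ u
    rw [L2.inner_def]
    refine integral_congr_ae ?_
    filter_upwards [ψ.coeFn_toLp 2 (volume : Measure Plane)] with x hx
    simp only [RCLike.inner_apply, hx]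
    ring
  set p : L2 := φ.toLp 2 volume with hp
  set k : ℂ → ℂ := fun w => inner ℂ p (cohState b w) with hk
  set k' : ℂ → ℂ := fun w => ∫ x, cohFunDeriv b w x * conj (p x) with hk'
  have hH : ∀ w, inner ℂ ((oscillator φ).toLp 2 volume : L2) (cohState b w) =
      2 * k w + 2 * w * k' w := by
    intro w
    rw [← key]
    have e1 : ∫ x, conj (oscillator φ x) * cohState b w x =
        ∫ x, conj (oscillator φ x) * cohS b w x := by
      refine integral_congr_ae ?_
      filter_upwards [coeFn_cohState b w] with x hx
      rw [hx, cohS_apply]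
    rw [e1, integral_conj_oscillator_mul]
    simp only [hk, hk']
    rw [inner_cohState, ← integral_oscillator_cohS_mul b w (memLp_conj_coe p)]
    refine integral_congr_ae ?_
    filter_upwards [φ.coeFn_toLp 2 (volume : Measure Plane)] with x hx
    rw [hp, hx, mul_comm]
  rw [key, key, inner_circleCoeff, inner_circleCoeff, ← hp]
  have hcont : Continuous fun θ : ℝ => exp (-(n * θ * I)) * (-(n * I) * k (exp (θ * I)) +
      k' (exp (θ * I)) * (exp (θ * I) * I)) := by
    have h1 : Continuous k := (differentiable_inner_cohState p b).continuous
    have h2 : Continuous k' := continuous_deriv_inner_cohState p b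
    fun_prop
  have hcont₂ : Continuous fun θ : ℝ => exp (-(n * θ * I)) * k (exp (θ * I)) := by
    have h1 : Continuous k := (differentiable_inner_cohState p b).continuous
    fun_prop
  have hzero := intervalIntegral.integral_eq_sub_of_hasDerivAt (a := 0) (b := 2 * Real.pi)
    (fun θ _ => hasDerivAt_inner_cohState_circle p b n θ) (hcont.intervalIntegrable _ _)
  have hper : exp (((2 * Real.pi : ℝ) : ℂ) * I) = 1 := by
    push_cast; exact Complex.exp_two_pi_mul_I
  have hper₂ : exp (-(n * ((2 * Real.pi : ℝ) : ℂ) * I)) = 1 := by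
    rw [Complex.exp_neg, mul_assoc, Complex.exp_nat_mul, hper, one_pow, inv_one]
  rw [hper, hper₂] at hzero
  simp only [ofReal_zero, zero_mul, mul_zero, neg_zero, Complex.exp_zero, sub_self] at hzero
  have hsplit : ∀ θ : ℝ, exp (-(n * θ * I)) *
      inner ℂ ((oscillator φ).toLp 2 volume : L2) (cohState b (exp (θ * I))) =
      2 * ((n : ℂ) + 1) * (exp (-(n * θ * I)) * k (exp (θ * I))) +
      (-2 * I) * (exp (-(n * θ * I)) * (-(n * I) * k (exp (θ * I)) +
      k' (exp (θ * I)) * (exp (θ * I) * I))) := by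
    intro θ
    rw [hH]
    linear_combination (-2 * exp (-(n * θ * I)) * (k' (exp (θ * I)) * exp (θ * I) -
      n * k (exp (θ * I)))) * -Complex.I_sq
  simp_rw [hsplit]
  rw [intervalIntegral.integral_add ((hcont₂.const_mul _).intervalIntegrable _ _)
    ((hcont.const_mul _).intervalIntegrable _ _), intervalIntegral.integral_const_mul,
    intervalIntegral.integral_const_mul, hzero, mul_zero, add_zero]

theorem eq_zero_of_inner_coh {v : L2} (h : ∀ b, inner ℂ v (coh b) = 0) : v = 0 := by
  have h1 : innerSL ℂ v = 0 := clm_ext_coh fun b => by simpa using h b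
  have h2 := congrArg (fun A : L2 →L[ℂ] ℂ => A v) h1
  simpa using h2

/-- The eigenfunctions of the oscillator are complete. -/
theorem eq_zero_of_orthogonal_eigenspaces {v : L2}
    (h : ∀ n, ∀ u ∈ eigenspace n, inner ℂ v u = 0) : v = 0 := by
  refine eq_zero_of_inner_coh fun c => ?_
  -- The given coherent state becomes the value at w = 1/2, strictly inside the unit disc where the
  -- Cauchy series converges.
  set b : Fin 2 → ℂ := fun i => 2 * c i with hb
  set k : ℂ → ℂ := fun w => inner ℂ v (cohState b w) with hk
  have hd : Differentiable ℂ k := differentiable_inner_cohState v b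
  have hs := (hd.diffContOnCl (s := Metric.ball 0 ((1 : NNReal) : ℝ))).hasFPowerSeriesOnBall
    (R := 1) one_pos |>.hasSum (y := 1 / 2) (by
      rw [Metric.eball_coe, Metric.mem_ball, dist_zero_right]; norm_num)
  -- The Taylor coefficients of k are, up to constants, its pairings with the circle averages, which
  -- are eigenfunctions.
  have hcoef : ∀ n : ℕ, (cauchyPowerSeries k 0 ((1 : NNReal) : ℝ) n fun _ => (1 / 2 : ℂ)) = 0 := by
    intro n
    rw [cauchyPowerSeries_apply, circleIntegral]
    have h0 := h n _ (circleCoeff_mem_eigenspace b n)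
    rw [inner_circleCoeff] at h0
    have e : ∀ θ : ℝ, deriv (circleMap 0 ((1 : NNReal) : ℝ)) θ •
        (((1 / 2 : ℂ) / (circleMap 0 ((1 : NNReal) : ℝ) θ - 0)) ^ n •
        (circleMap 0 ((1 : NNReal) : ℝ) θ - 0)⁻¹ • k (circleMap 0 ((1 : NNReal) : ℝ) θ)) =
        (I * (1 / 2) ^ n) * (exp (-(n * θ * I)) * inner ℂ v (cohState b (exp (θ * I)))) := by
      intro θ
      have hne := Complex.exp_ne_zero (θ * I)
      have e1 : exp (-(n * θ * I)) = (exp (θ * I) ^ n)⁻¹ := by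
        rw [Complex.exp_neg, mul_assoc, Complex.exp_nat_mul]
      rw [deriv_circleMap, e1]
      simp only [circleMap, zero_add, sub_zero, NNReal.coe_one, ofReal_one, one_mul, smul_eq_mul,
        div_pow, hk]
      field_simp
    simp_rw [e]
    rw [intervalIntegral.integral_const_mul, h0, mul_zero, smul_zero]
  simp only [hcoef, zero_add] at hs
  have h2 : k (1 / 2) = 0 := hs.unique hasSum_zero
  have e2 : (fun i => (1 / 2 : ℂ) * b i) = c := by ext i; simp [hb]
  simp only [hk, cohState, e2, inner_smul_right] at h2
  exact (mul_eq_zero.1 h2).resolve_left (Complex.exp_ne_zero _)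

end CR

namespace CR

/-! ### The lens transform -/

/-- The lens transform `g ↦ C⁻¹ e^{-is|x|²/2} g(x / C)` on functions. -/
noncomputable def lensFun (C s : ℝ) (g : Plane → ℂ) (x : Plane) : ℂ :=
  (C : ℂ)⁻¹ * exp (((-(s * ‖x‖ ^ 2 / 2) : ℝ) : ℂ) * I) * g (C⁻¹ • x)

variable {C : ℝ}

theorem quasiMeasurePreserving_inv_smul (hC : 0 < C) :
    Measure.QuasiMeasurePreserving (fun x : Plane => C⁻¹ • x) volume volume :=
  Measure.quasiMeasurePreserving_smul volume (inv_ne_zero hC.ne')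

theorem lensFun_congr (hC : 0 < C) (s : ℝ) {g h : Plane → ℂ} (e : g =ᵐ[volume] h) :
    lensFun C s g =ᵐ[volume] lensFun C s h := by
  filter_upwards [(quasiMeasurePreserving_inv_smul hC).ae_eq_comp e] with x hx
  simp only [Function.comp] at hx
  rw [lensFun, lensFun, hx]

theorem norm_lensFun (hC : 0 < C) (s : ℝ) (g : Plane → ℂ) (x : Plane) :
    ‖lensFun C s g x‖ = C⁻¹ * ‖g (C⁻¹ • x)‖ := by
  rw [lensFun, norm_mul, norm_mul, norm_exp_ofReal_mul_I, norm_inv, Complex.norm_real,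
    Real.norm_eq_abs, abs_of_pos hC, mul_one]

theorem integral_comp_inv_smul_plane {E : Type*} [NormedAddCommGroup E] [NormedSpace ℝ E]
    (hC : 0 < C) (g : Plane → E) : ∫ x, g (C⁻¹ • x) = C ^ 2 • ∫ x, g x := by
  rw [Measure.integral_comp_inv_smul_of_nonneg volume g hC.le, finrank_euclideanSpace_fin]

theorem memLp_lensFun (hC : 0 < C) (s : ℝ) {g : Plane → ℂ} (hg : MemLp g 2 volume) :
    MemLp (lensFun C s g) 2 volume := by
  have hm : AEStronglyMeasurable (lensFun C s g) volume :=
    (Continuous.aestronglyMeasurable (by fun_prop)).mul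
      (hg.1.comp_quasiMeasurePreserving (quasiMeasurePreserving_inv_smul hC))
  rw [memLp_two_iff_integrable_sq_norm hm]
  have h := (((memLp_two_iff_integrable_sq_norm hg.1).1 hg).comp_smul
    (inv_ne_zero hC.ne')).const_mul (C⁻¹ ^ 2)
  refine h.congr (Filter.Eventually.of_forall fun x => ?_)
  simp only [norm_lensFun hC, mul_pow]

/-- The lens transform as a linear isometry of `L²`. -/
noncomputable def lensLI (hC : 0 < C) (s : ℝ) : L2 →ₗᵢ[ℂ] L2 where
  toFun g := (memLp_lensFun hC s (Lp.memLp g)).toLp _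
  map_add' f g := by
    apply Lp.ext
    filter_upwards [(memLp_lensFun hC s (Lp.memLp (f + g))).coeFn_toLp,
      (memLp_lensFun hC s (Lp.memLp f)).coeFn_toLp, (memLp_lensFun hC s (Lp.memLp g)).coeFn_toLp,
      Lp.coeFn_add ((memLp_lensFun hC s (Lp.memLp f)).toLp _)
        ((memLp_lensFun hC s (Lp.memLp g)).toLp _),
      (quasiMeasurePreserving_inv_smul hC).ae_eq_comp (Lp.coeFn_add f g)] with x h1 h2 h3 h4 h5
    simp only [Function.comp] at h5
    rw [h1, h4, Pi.add_apply, h2, h3, lensFun, h5, Pi.add_apply, mul_add]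
    rfl
  map_smul' c f := by
    apply Lp.ext
    filter_upwards [(memLp_lensFun hC s (Lp.memLp (c • f))).coeFn_toLp,
      (memLp_lensFun hC s (Lp.memLp f)).coeFn_toLp,
      Lp.coeFn_smul c ((memLp_lensFun hC s (Lp.memLp f)).toLp _),
      (quasiMeasurePreserving_inv_smul hC).ae_eq_comp (Lp.coeFn_smul c f)] with x h1 h2 h4 h5
    simp only [Function.comp] at h5
    rw [h1, RingHom.id_apply, h4, Pi.smul_apply, h2, lensFun, h5, Pi.smul_apply, lensFun,
      smul_eq_mul, smul_eq_mul]
    ring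
  norm_map' f := by
    have key : ∀ g : L2, ‖g‖ ^ 2 = ∫ x, ‖g x‖ ^ 2 := by
      intro g
      have h : inner ℂ g g = ((∫ x, ‖g x‖ ^ 2 : ℝ) : ℂ) := by
        rw [L2.inner_def, ← integral_complex_ofReal]
        congr 1; ext x
        rw [inner_self_eq_norm_sq_to_K]; push_cast; rfl
      rw [inner_self_eq_norm_sq_to_K] at h
      rw [← RCLike.ofReal_pow] at h
      exact Complex.ofReal_injective h
    have h : ‖(memLp_lensFun hC s (Lp.memLp f)).toLp _‖ ^ 2 = ‖f‖ ^ 2 := by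
      rw [key, key]
      have e : ∫ x, ‖((memLp_lensFun hC s (Lp.memLp f)).toLp _) x‖ ^ 2 =
          ∫ x, C⁻¹ ^ 2 * ‖f (C⁻¹ • x)‖ ^ 2 := by
        refine integral_congr_ae ?_
        filter_upwards [(memLp_lensFun hC s (Lp.memLp f)).coeFn_toLp] with x h1
        rw [h1, norm_lensFun hC, mul_pow]
      rw [e, integral_const_mul, integral_comp_inv_smul_plane hC (fun x => ‖f x‖ ^ 2), smul_eq_mul,
        ← mul_assoc, ← mul_pow, inv_mul_cancel₀ hC.ne', one_pow, one_mul]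
    exact (sq_eq_sq₀ (norm_nonneg _) (norm_nonneg _)).1 h

theorem coeFn_lensLI (hC : 0 < C) (s : ℝ) (g : L2) : lensLI hC s g =ᵐ[volume] lensFun C s g :=
  (memLp_lensFun hC s (Lp.memLp g)).coeFn_toLp

theorem lensLI_toL2 (hC : 0 < C) (s : ℝ) {g : Plane → ℂ} (hg : MemLp g 2 volume) :
    lensLI hC s (toL2 g) = toL2 (lensFun C s g) := by
  apply Lp.ext
  exact (coeFn_lensLI hC s _).trans ((lensFun_congr hC s (coeFn_toL2 hg)).trans
    (coeFn_toL2 (memLp_lensFun hC s hg)).symm)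

/-! ### The lens transform of the free evolution -/

theorem cos_two_mul_pos {τ : ℝ} (hτ : |τ| < Real.pi / 4) : 0 < Real.cos (2 * τ) := by
  have := abs_lt.1 hτ
  exact Real.cos_pos_of_mem_Ioo ⟨by linarith, by linarith⟩

/-- The time of the free evolution that corresponds to the time `τ` of the oscillator. -/
noncomputable def lensTime (τ : ℝ) : ℝ := Real.tan (2 * τ) / 2

/-- The lens transform of the free evolution. -/
noncomputable def lensGroup {τ : ℝ} (hτ : |τ| < Real.pi / 4) : L2 →ₗᵢ[ℂ] L2 :=
  (lensLI (cos_two_mul_pos hτ) (Real.tan (2 * τ))).comp (freeLI (lensTime τ))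

theorem lensGroup_apply {τ : ℝ} (hτ : |τ| < Real.pi / 4) (f : L2) : lensGroup hτ f =
    lensLI (cos_two_mul_pos hτ) (Real.tan (2 * τ)) (freeGroup (lensTime τ) f) := rfl

/-- Because 2t = tan 2τ, the denominator is 1 + i tan 2τ = e^{2iτ}/cos 2τ. -/
theorem qt_lensTime {τ : ℝ} (hτ : |τ| < Real.pi / 4) :
    qt (lensTime τ) = Real.cos (2 * τ) * exp (((-(2 * τ) : ℝ) : ℂ) * I) := by
  have hc := (cos_two_mul_pos hτ).ne'
  have hc' : ((Real.cos (2 * τ) : ℝ) : ℂ) ≠ 0 := by exact_mod_cast hc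
  have h1 : (1 + 2 * I * lensTime τ : ℂ) = exp (((2 * τ : ℝ) : ℂ) * I) / Real.cos (2 * τ) := by
    rw [Complex.exp_mul_I, ← Complex.ofReal_cos, ← Complex.ofReal_sin, lensTime,
      Real.tan_eq_sin_div_cos]
    push_cast
    push_cast at hc'
    field_simp
  rw [qt, h1, inv_div, ofReal_neg, neg_mul, Complex.exp_neg, div_eq_mul_inv]

theorem cohState_one (b : Fin 2 → ℂ) : cohState b 1 = exp (-(dot b b / 4)) • coh b := by
  simp [cohState]

theorem cohState_smul (b : Fin 2 → ℂ) (z w : ℂ) :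
    cohState (fun i => z * b i) w = cohState b (w * z) := by
  simp only [cohState, dot]
  congr 1
  · congr 1; ring
  · congr 1; ext i; ring

/-- After rescaling, the evolved Gaussian has parameter 1/2 - (i/2) tan 2τ, and the quadratic phase
of the lens transform removes the imaginary part. The amplitude q(t)/cos 2τ is e^{-2iτ}. -/
theorem lensFun_freeCoh {τ : ℝ} (hτ : |τ| < Real.pi / 4) (b : Fin 2 → ℂ) (x : Plane) :
    exp (-(dot b b / 4)) *
      lensFun (Real.cos (2 * τ)) (Real.tan (2 * τ)) (freeCoh b (lensTime τ)) x =
      exp (((-(2 * τ) : ℝ) : ℂ) * I) * cohFun b (exp (((-(2 * τ) : ℝ) : ℂ) * I)) x := by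
  have hc := cos_two_mul_pos hτ
  set w := exp (((-(2 * τ) : ℝ) : ℂ) * I) with hw
  rw [lensFun, freeCoh, qt_lensTime hτ, ← hw, cohFun, gauss, gauss]
  set c := Real.cos (2 * τ) with hcdef
  set s := Real.sin (2 * τ) with hs
  have hc' : (c : ℂ) ≠ 0 := by exact_mod_cast hc.ne'
  have hws : w = c - s * I := by
    rw [hw, Complex.exp_mul_I, ← Complex.ofReal_cos, ← Complex.ofReal_sin, Real.cos_neg,
      Real.sin_neg, ← hcdef, ← hs]
    push_cast; ring
  have hcs : (c : ℂ) ^ 2 + (s : ℂ) ^ 2 = 1 := by exact_mod_cast Real.cos_sq_add_sin_sq (2 * τ)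
  have ht : lensTime τ = s / (2 * c) := by
    rw [lensTime, Real.tan_eq_sin_div_cos, ← hs, ← hcdef]; field_simp
  have htan : Real.tan (2 * τ) = s / c := Real.tan_eq_sin_div_cos _
  have e : ∀ A B D E : ℂ, A * ((c : ℂ)⁻¹ * B * (c * w * D * E)) = w * (A * B * D * E) := by
    intro A B D E; field_simp
  clear_value w
  rw [e, ← Complex.exp_add, ← Complex.exp_add, ← Complex.exp_add, ← Complex.exp_add, ht, htan]
  congr 2
  simp only [quad, norm_smul, PiLp.smul_apply, smul_eq_mul, Real.norm_eq_abs, abs_inv,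
    abs_of_pos hc]
  push_cast
  field_simp
  rw [hws]
  linear_combination 2 * dot b b * c * hcs - 2 * dot b b * c * s ^ 2 * Complex.I_sq

end CR

namespace CR

/-! ### The lens transform of the free evolution is the oscillator group -/

/-- The phase `e^{-2iτ}`. -/
noncomputable def lensPhase (τ : ℝ) : ℂ := exp (((-(2 * τ) : ℝ) : ℂ) * I)

theorem norm_lensPhase (τ : ℝ) : ‖lensPhase τ‖ = 1 := norm_exp_ofReal_mul_I _

theorem lensPhase_neg_mul (τ : ℝ) : lensPhase (-τ) * lensPhase τ = 1 := by
  rw [lensPhase, lensPhase, ← Complex.exp_add, ← Complex.exp_zero]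
  congr 1; push_cast; ring

variable {τ : ℝ} (hτ : |τ| < Real.pi / 4)

theorem lensGroup_cohState_one (b : Fin 2 → ℂ) :
    lensGroup hτ (cohState b 1) = lensPhase τ • cohState b (lensPhase τ) := by
  rw [cohState_one, map_smul, lensGroup_apply]
  apply Lp.ext
  filter_upwards [Lp.coeFn_smul (exp (-(dot b b / 4))) (lensLI (cos_two_mul_pos hτ)
      (Real.tan (2 * τ)) (freeGroup (lensTime τ) (coh b))),
    (coeFn_lensLI (cos_two_mul_pos hτ) (Real.tan (2 * τ)) (freeGroup (lensTime τ) (coh b))).trans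
      (lensFun_congr (cos_two_mul_pos hτ) (Real.tan (2 * τ)) (coeFn_freeGroup_coh (lensTime τ) b)),
    Lp.coeFn_smul (lensPhase τ) (cohState b (lensPhase τ)), coeFn_cohState b (lensPhase τ)]
    with x h1 h2 h3 h4
  rw [h1, h3, Pi.smul_apply, Pi.smul_apply, h2, h4, smul_eq_mul, smul_eq_mul]
  exact lensFun_freeCoh hτ b x

theorem lensGroup_cohState (b : Fin 2 → ℂ) (z : ℂ) :
    lensGroup hτ (cohState b z) = lensPhase τ • cohState b (lensPhase τ * z) := by
  have h := lensGroup_cohState_one hτ fun i => z * b i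
  rwa [cohState_smul, cohState_smul, one_mul] at h

theorem clm_ext_cohState {E : Type*} [NormedAddCommGroup E] [NormedSpace ℂ E] {A B : L2 →L[ℂ] E}
    (h : ∀ b, A (cohState b 1) = B (cohState b 1)) : A = B := by
  refine clm_ext_coh fun b => ?_
  have h1 := h b
  rw [cohState_one, map_smul, map_smul] at h1
  exact smul_right_injective E (Complex.exp_ne_zero _) h1

theorem abs_neg_lt (h : |τ| < Real.pi / 4) : |-τ| < Real.pi / 4 := by rwa [abs_neg]

theorem lensGroup_neg_lensGroup (f : L2) : lensGroup (abs_neg_lt hτ) (lensGroup hτ f) = f := by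
  have h : (lensGroup (abs_neg_lt hτ)).toContinuousLinearMap ∘L
      (lensGroup hτ).toContinuousLinearMap = ContinuousLinearMap.id ℂ L2 := by
    refine clm_ext_cohState fun b => ?_
    simp only [ContinuousLinearMap.comp_apply, LinearIsometry.coe_toContinuousLinearMap,
      ContinuousLinearMap.id_apply, lensGroup_cohState, map_smul, smul_smul,
      lensPhase_neg_mul, mul_one]
    rw [mul_comm, lensPhase_neg_mul, one_smul]
  exact congrArg (fun A : L2 →L[ℂ] L2 => A f) h

/-- It suffices to check coherent states: homogeneity along the circle gives m factors of the phase,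
and the scalar in front gives one more. -/
theorem inner_lensGroup_of_mem {m : ℕ} {v : L2} (hv : v ∈ eigenspace m) (f : L2) :
    inner ℂ v (lensGroup hτ f) = lensPhase τ ^ (m + 1) * inner ℂ v f := by
  have h : (innerSL ℂ v) ∘L (lensGroup hτ).toContinuousLinearMap =
      (lensPhase τ ^ (m + 1)) • innerSL ℂ v := by
    refine clm_ext_cohState fun b => ?_
    simp only [ContinuousLinearMap.comp_apply, LinearIsometry.coe_toContinuousLinearMap,
      innerSL_apply_apply, smul_apply, lensGroup_cohState_one, inner_smul_right, smul_eq_mul]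
    rw [lensPhase, inner_cohState_of_mem hv, pow_succ]
    ring
  exact congrArg (fun A : L2 →L[ℂ] ℂ => A f) h

/-- Equality case of Cauchy-Schwarz: expanding the squared norm of the difference, isometry and the
known inner product with v make all terms cancel. -/
theorem lensGroup_of_mem {m : ℕ} {v : L2} (hv : v ∈ eigenspace m) :
    lensGroup hτ v = lensPhase τ ^ (m + 1) • v := by
  set z := lensPhase τ ^ (m + 1) with hz
  have hzn : ‖z‖ = 1 := by rw [hz, norm_pow, norm_lensPhase, one_pow]
  have hzz : conj z * z = 1 := by rw [Complex.conj_mul', hzn]; norm_num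
  have h1 := inner_lensGroup_of_mem hτ hv v
  have h2 : inner ℂ (z • v) (lensGroup hτ v) = inner ℂ v v := by
    rw [inner_smul_left, h1, ← hz, ← mul_assoc, hzz, one_mul]
  have h3 : inner ℂ (lensGroup hτ v) (z • v) = inner ℂ v v := by
    rw [← inner_conj_symm, h2, inner_conj_symm]
  have h4 : inner ℂ (z • v) (z • v) = inner ℂ v v := by
    rw [inner_smul_left, inner_smul_right, ← mul_assoc, hzz, one_mul]
  rw [← sub_eq_zero, ← inner_self_eq_zero (𝕜 := ℂ), inner_sub_sub_self, h2, h3, h4,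
    LinearIsometry.inner_map_map]
  ring

/-- The eigenvectors are only weak solutions, so orthogonality is read off from the isometries, for
which they are genuine eigenvectors, rather than from the symmetry of H. -/
theorem orthogonalFamily_eigenspace :
    OrthogonalFamily ℂ (fun n => eigenspace n) fun n => (eigenspace n).subtypeₗᵢ := by
  intro m n hmn v u
  simp only [Submodule.coe_subtypeₗᵢ, Submodule.subtype_apply]
  -- At τ = 1/2 the eigenvalues are e^{-i(m+1)}, pairwise distinct because π is irrational.
  have hτ : |(1 / 2 : ℝ)| < Real.pi / 4 := by
    rw [abs_of_pos (by norm_num)]; linarith [Real.pi_gt_three]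
  have h1 := inner_lensGroup_of_mem hτ v.2 (u : L2)
  rw [lensGroup_of_mem hτ u.2, inner_smul_right] at h1
  by_contra h0
  have h2 := mul_right_cancel₀ h0 h1
  rw [lensPhase, ← Complex.exp_nat_mul, ← Complex.exp_nat_mul, Complex.exp_eq_exp_iff_exists_int] at h2
  obtain ⟨k, hk⟩ := h2
  have h3 := congrArg Complex.im hk
  simp at h3
  have h4 : (k : ℝ) * (2 * Real.pi) = (m : ℝ) - n := by linarith
  rcases eq_or_ne k 0 with rfl | hk0
  · rw [Int.cast_zero, zero_mul, eq_comm, sub_eq_zero] at h4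
    exact hmn (by exact_mod_cast h4)
  · refine irrational_pi ⟨((m : ℚ) - n) / (2 * k), ?_⟩
    have hk' : (k : ℝ) ≠ 0 := by exact_mod_cast hk0
    push_cast
    rw [← h4]; field_simp

theorem hasSum_proj (f : L2) : HasSum (fun n => proj n f) f := by
  have : ∀ n, CompleteSpace (eigenspace n) := fun n => by unfold eigenspace; infer_instance
  have htot : (⨆ n, eigenspace n).topologicalClosure = ⊤ := by
    rw [Submodule.topologicalClosure_eq_top_iff, Submodule.eq_bot_iff]
    intro v hv
    refine eq_zero_of_orthogonal_eigenspaces fun n u hu => ?_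
    exact (Submodule.mem_orthogonal' _ _).1 hv u (Submodule.mem_iSup_of_mem n hu)
  have hH := IsHilbertSum.mkInternal _ orthogonalFamily_eigenspace htot.ge
  have hs := hH.hasSum_linearIsometryEquiv_symm (hH.linearIsometryEquiv f)
  rw [LinearIsometryEquiv.symm_apply_apply] at hs
  set c := hH.linearIsometryEquiv f with hc
  have hp : ∀ n, proj n f = (c n : L2) := by
    intro n
    have h1 := (proj n).hasSum hs
    have h2 : ∀ k, k ≠ n → (proj n) ((eigenspace k).subtypeₗᵢ (c k)) = 0 := by
      intro k hk
      refine (Submodule.starProjection_apply_eq_zero_iff _).2 ?_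
      rw [Submodule.mem_orthogonal]
      intro u hu
      exact orthogonalFamily_eigenspace hk.symm ⟨u, hu⟩ (c k)
    have h3 := h1.unique (hasSum_single n h2)
    rw [h3]
    exact Submodule.starProjection_eq_self_iff.2 (c n).2
  simp_rw [hp]
  exact hs

theorem proj_lensGroup (n : ℕ) (f : L2) :
    proj n (lensGroup hτ f) = lensPhase τ ^ (n + 1) • proj n f := by
  refine (Submodule.eq_starProjection_of_mem_of_inner_eq_zero (K := eigenspace n)
    (Submodule.smul_mem _ _ (Submodule.starProjection_apply_mem (eigenspace n) f)) fun v hv => ?_)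
  have h := Submodule.starProjection_inner_eq_zero (K := eigenspace n) f v hv
  have h1 := inner_lensGroup_of_mem hτ hv f
  rw [← inner_conj_symm, map_eq_zero, inner_sub_right, sub_eq_zero] at h ⊢
  rw [h1, h, inner_smul_right]
  rfl

theorem oscillatorGroup_neg_eq (f : L2) : oscillatorGroup (-τ) f = lensGroup hτ f := by
  have h := (hasSum_proj (lensGroup hτ f)).tsum_eq
  rw [← h, oscillatorGroup]
  congr 1; ext1 n
  rw [proj_lensGroup hτ, lensPhase, ← Complex.exp_nat_mul]
  congr 2
  push_cast; ring

theorem oscillatorGroup_eq (f : L2) : oscillatorGroup τ f = lensGroup (abs_neg_lt hτ) f := by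
  have h := oscillatorGroup_neg_eq (abs_neg_lt hτ) f
  rwa [neg_neg] at h

end CR

namespace CR

/-! ### Change of variables between the two time scales -/

/-- The open interval of times of the oscillator. -/
def lensInterval : Set ℝ := Set.Ioo (-(Real.pi / 4)) (Real.pi / 4)

theorem abs_lt_of_mem_lensInterval {τ : ℝ} (h : τ ∈ lensInterval) : |τ| < Real.pi / 4 :=
  abs_lt.2 h

theorem restrict_Icc_eq :
    (volume : Measure ℝ).restrict (Set.Icc (-(Real.pi / 4)) (Real.pi / 4)) =
      volume.restrict lensInterval :=
  (Measure.restrict_congr_set Ioo_ae_eq_Icc).symm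

theorem hasDerivAt_lensTime {τ : ℝ} (h : τ ∈ lensInterval) :
    HasDerivAt lensTime ((Real.cos (2 * τ) ^ 2)⁻¹) τ := by
  have hc := (cos_two_mul_pos (abs_lt_of_mem_lensInterval h)).ne'
  have h1 := ((Real.hasDerivAt_tan hc).comp τ ((hasDerivAt_id τ).const_mul 2)).div_const 2
  refine h1.congr_deriv ?_
  field_simp

theorem injOn_lensTime : Set.InjOn lensTime lensInterval := by
  intro a ha b hb hab
  have h1 : Real.tan (2 * a) = Real.tan (2 * b) := by
    simp only [lensTime] at hab; linarith
  have h2 := Real.injOn_tan (x₁ := 2 * a) (x₂ := 2 * b) ⟨by linarith [ha.1], by linarith [ha.2]⟩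
    ⟨by linarith [hb.1], by linarith [hb.2]⟩ h1
  linarith

theorem image_lensTime : lensTime '' lensInterval = Set.univ := by
  refine Set.eq_univ_of_forall fun t => ⟨Real.arctan (2 * t) / 2, ⟨?_, ?_⟩, ?_⟩
  · linarith [Real.neg_pi_div_two_lt_arctan (2 * t)]
  · linarith [Real.arctan_lt_pi_div_two (2 * t)]
  · rw [lensTime, mul_div_cancel₀ _ two_ne_zero, Real.tan_arctan]; ring

theorem measurableSet_lensInterval : MeasurableSet lensInterval := measurableSet_Ioo

section
variable {E : Type*} [NormedAddCommGroup E] [NormedSpace ℝ E]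

theorem integrableOn_lensTime_iff (Ψ : ℝ → E) :
    IntegrableOn (fun τ => (Real.cos (2 * τ) ^ 2)⁻¹ • Ψ (lensTime τ)) lensInterval ↔
      Integrable Ψ := by
  have h := integrableOn_image_iff_integrableOn_abs_deriv_smul measurableSet_lensInterval
    (fun τ hτ => (hasDerivAt_lensTime hτ).hasDerivWithinAt) injOn_lensTime Ψ
  rw [image_lensTime, integrableOn_univ] at h
  rw [h]
  refine integrableOn_congr_fun (fun τ _ => ?_) measurableSet_lensInterval
  simp only [abs_of_nonneg (inv_nonneg.2 (sq_nonneg (Real.cos (2 * τ))))]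

theorem integral_lensTime (Ψ : ℝ → E) :
    ∫ τ in lensInterval, (Real.cos (2 * τ) ^ 2)⁻¹ • Ψ (lensTime τ) = ∫ t, Ψ t := by
  have h := integral_image_eq_integral_abs_deriv_smul measurableSet_lensInterval
    (fun τ hτ => (hasDerivAt_lensTime hτ).hasDerivWithinAt) injOn_lensTime Ψ
  rw [image_lensTime, setIntegral_univ] at h
  rw [h]
  refine setIntegral_congr_fun measurableSet_lensInterval fun τ _ => ?_
  simp only [abs_of_nonneg (inv_nonneg.2 (sq_nonneg (Real.cos (2 * τ))))]

end

/-- The inverse time change arctan(2t)/2 is differentiable, hence maps null sets to null sets. -/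
theorem ae_lensTime {P : ℝ → Prop} (h : ∀ᵐ t, P t) :
    ∀ᵐ τ ∂(volume.restrict lensInterval), P (lensTime τ) := by
  rw [ae_restrict_iff' measurableSet_lensInterval, ae_iff]
  have hd : DifferentiableOn ℝ (fun t : ℝ => Real.arctan (2 * t) / 2) {t | ¬ P t} :=
    (((by fun_prop : Differentiable ℝ fun t : ℝ => 2 * t).arctan).div_const 2).differentiableOn
  refine measure_mono_null ?_
    (addHaar_image_eq_zero_of_differentiableOn_of_addHaar_eq_zero volume hd (ae_iff.1 h))
  intro τ hτ
  simp only [Set.mem_ofPred_eq, Classical.not_imp] at hτ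
  refine ⟨lensTime τ, hτ.2, ?_⟩
  simp only [lensTime]
  rw [mul_div_cancel₀ _ two_ne_zero, Real.arctan_tan (by linarith [hτ.1.1]) (by linarith [hτ.1.2])]
  ring

/-! ### Products of oscillator evolutions -/

/-- The product of four oscillator evolutions at time `t`. -/
noncomputable def oscQuartic (f₁ f₂ f₃ f₄ : L2) (t : ℝ) (x : Plane) : ℂ :=
  oscillatorGroup (-t) f₁ x * oscillatorGroup (-t) f₂ x *
    conj (oscillatorGroup (-t) f₃ x) * conj (oscillatorGroup (-t) f₄ x)

/-- The product `u₁ u₂ conj(u₃)` of three oscillator evolutions at time `t`. -/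
noncomputable def oscCubic (f₁ f₂ f₃ : L2) (t : ℝ) (x : Plane) : ℂ :=
  oscillatorGroup (-t) f₁ x * oscillatorGroup (-t) f₂ x * conj (oscillatorGroup (-t) f₃ x)

section
variable {τ : ℝ}

theorem coeFn_oscillatorGroup_neg (hτ : |τ| < Real.pi / 4) (f : L2) :
    oscillatorGroup (-τ) f =ᵐ[volume]
      lensFun (Real.cos (2 * τ)) (Real.tan (2 * τ)) (freeGroup (lensTime τ) f) := by
  rw [oscillatorGroup_neg_eq hτ, lensGroup_apply]
  exact coeFn_lensLI _ _ _

/-- Two of the three quadratic phases cancel by conjugation, leaving one lens transform and two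
spare factors 1/cos 2τ. Their product is the derivative of the time change. -/
theorem oscCubic_ae (hτ : |τ| < Real.pi / 4) (f₁ f₂ f₃ : L2) : oscCubic f₁ f₂ f₃ τ =ᵐ[volume]
    fun x => (((Real.cos (2 * τ) ^ 2)⁻¹ : ℝ) : ℂ) *
      lensFun (Real.cos (2 * τ)) (Real.tan (2 * τ)) (freeCubic f₁ f₂ f₃ (lensTime τ)) x := by
  filter_upwards [coeFn_oscillatorGroup_neg hτ f₁, coeFn_oscillatorGroup_neg hτ f₂,
    coeFn_oscillatorGroup_neg hτ f₃] with x h1 h2 h3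
  rw [oscCubic, h1, h2, h3]
  simp only [lensFun, freeCubic, map_mul, map_inv₀, Complex.conj_ofReal]
  set e := exp (((-(Real.tan (2 * τ) * ‖x‖ ^ 2 / 2) : ℝ) : ℂ) * I) with he
  have hee : e * conj e = 1 := by
    rw [Complex.mul_conj', he, norm_exp_ofReal_mul_I]; norm_num
  rw [ofReal_inv, ofReal_pow]
  set c := ((Real.cos (2 * τ) : ℝ) : ℂ)
  rw [← inv_pow]
  linear_combination (c⁻¹ ^ 3 * e * freeGroup (lensTime τ) f₁ ((Real.cos (2 * τ))⁻¹ • x) *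
    freeGroup (lensTime τ) f₂ ((Real.cos (2 * τ))⁻¹ • x) *
    conj (freeGroup (lensTime τ) f₃ ((Real.cos (2 * τ))⁻¹ • x))) * hee

/-- All phases cancel and four factors 1/cos 2τ remain. The dilation in x gives back cos²(2τ) upon
integration, so again exactly the derivative of the time change survives. -/
theorem oscQuartic_ae (hτ : |τ| < Real.pi / 4) (f₁ f₂ f₃ f₄ : L2) :
    oscQuartic f₁ f₂ f₃ f₄ τ =ᵐ[volume] fun x => (((Real.cos (2 * τ) ^ 2)⁻¹ ^ 2 : ℝ) : ℂ) *
      freeQuartic f₁ f₂ f₃ f₄ (lensTime τ) ((Real.cos (2 * τ))⁻¹ • x) := by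
  filter_upwards [oscCubic_ae hτ f₁ f₂ f₃, coeFn_oscillatorGroup_neg hτ f₄] with x h1 h4
  rw [oscQuartic, ← oscCubic, h1, h4]
  simp only [lensFun, freeCubic, freeQuartic, map_mul, map_inv₀, Complex.conj_ofReal]
  set e := exp (((-(Real.tan (2 * τ) * ‖x‖ ^ 2 / 2) : ℝ) : ℂ) * I) with he
  have hee : e * conj e = 1 := by
    rw [Complex.mul_conj', he, norm_exp_ofReal_mul_I]; norm_num
  rw [ofReal_pow, ofReal_inv, ofReal_pow]
  set c := ((Real.cos (2 * τ) : ℝ) : ℂ)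
  rw [← inv_pow]
  linear_combination (c⁻¹ ^ 4 * freeGroup (lensTime τ) f₁ ((Real.cos (2 * τ))⁻¹ • x) *
    freeGroup (lensTime τ) f₂ ((Real.cos (2 * τ))⁻¹ • x) *
    conj (freeGroup (lensTime τ) f₃ ((Real.cos (2 * τ))⁻¹ • x)) *
    conj (freeGroup (lensTime τ) f₄ ((Real.cos (2 * τ))⁻¹ • x))) * hee

theorem integral_oscQuartic (hτ : |τ| < Real.pi / 4) (f₁ f₂ f₃ f₄ : L2) :
    ∫ x, oscQuartic f₁ f₂ f₃ f₄ τ x =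
      (Real.cos (2 * τ) ^ 2)⁻¹ • ∫ x, freeQuartic f₁ f₂ f₃ f₄ (lensTime τ) x := by
  have hc := cos_two_mul_pos hτ
  have hc' : ((Real.cos (2 * τ) : ℝ) : ℂ) ≠ 0 := by exact_mod_cast hc.ne'
  rw [integral_congr_ae (oscQuartic_ae hτ f₁ f₂ f₃ f₄), integral_const_mul,
    integral_comp_inv_smul_plane hc (freeQuartic f₁ f₂ f₃ f₄ (lensTime τ)), real_smul, real_smul]
  push_cast
  push_cast at hc'
  field_simp

theorem integral_norm_oscQuartic (hτ : |τ| < Real.pi / 4) (f₁ f₂ f₃ f₄ : L2) :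
    ∫ x, ‖oscQuartic f₁ f₂ f₃ f₄ τ x‖ =
      (Real.cos (2 * τ) ^ 2)⁻¹ • ∫ x, ‖freeQuartic f₁ f₂ f₃ f₄ (lensTime τ) x‖ := by
  have hc := cos_two_mul_pos hτ
  have e : ∫ x, ‖oscQuartic f₁ f₂ f₃ f₄ τ x‖ = ∫ x, (Real.cos (2 * τ) ^ 2)⁻¹ ^ 2 *
      ‖freeQuartic f₁ f₂ f₃ f₄ (lensTime τ) ((Real.cos (2 * τ))⁻¹ • x)‖ := by
    refine integral_congr_ae ?_
    filter_upwards [oscQuartic_ae hτ f₁ f₂ f₃ f₄] with x hx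
    rw [hx, norm_mul, Complex.norm_real, Real.norm_eq_abs, abs_of_nonneg (by positivity)]
  rw [e, integral_const_mul, integral_comp_inv_smul_plane hc
    (fun x => ‖freeQuartic f₁ f₂ f₃ f₄ (lensTime τ) x‖), smul_eq_mul, smul_eq_mul]
  field_simp

theorem integrable_oscQuartic (hτ : |τ| < Real.pi / 4) {f₁ f₂ f₃ f₄ : L2}
    (h : Integrable (freeQuartic f₁ f₂ f₃ f₄ (lensTime τ)) volume) :
    Integrable (oscQuartic f₁ f₂ f₃ f₄ τ) volume :=
  ((h.comp_smul (inv_ne_zero (cos_two_mul_pos hτ).ne')).const_mul _).congr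
    (oscQuartic_ae hτ f₁ f₂ f₃ f₄).symm

theorem memLp_oscCubic (hτ : |τ| < Real.pi / 4) {f₁ f₂ f₃ : L2}
    (h : MemLp (freeCubic f₁ f₂ f₃ (lensTime τ)) 2 volume) :
    MemLp (oscCubic f₁ f₂ f₃ τ) 2 volume :=
  (memLp_congr_ae (oscCubic_ae hτ f₁ f₂ f₃)).2
    ((memLp_lensFun (cos_two_mul_pos hτ) _ h).const_mul _)

theorem toL2_const_mul (c : ℂ) {g : Plane → ℂ} (hg : MemLp g 2 volume) :
    toL2 (fun x => c * g x) = c • toL2 g := by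
  rw [toL2_of_memLp hg, toL2_of_memLp (hg.const_mul c)]
  exact hg.toLp_const_smul c

/-- The lens transform of k is the lens-transformed group applied to e^{-itΔ}k with t = `lensTime
τ`, and e^{iτH} inverts that group. -/
theorem oscillatorGroup_toL2_oscCubic (hτ : |τ| < Real.pi / 4) {f₁ f₂ f₃ : L2}
    (h : MemLp (freeCubic f₁ f₂ f₃ (lensTime τ)) 2 volume) :
    oscillatorGroup τ (toL2 (oscCubic f₁ f₂ f₃ τ)) = (Real.cos (2 * τ) ^ 2)⁻¹ •
      freeGroup (-lensTime τ) (toL2 (freeCubic f₁ f₂ f₃ (lensTime τ))) := by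
  have hc := cos_two_mul_pos hτ
  rw [toL2_congr (oscCubic_ae hτ f₁ f₂ f₃), toL2_const_mul _ (memLp_lensFun hc _ h),
    ← lensLI_toL2 hc _ h, oscillatorGroup_eq hτ, map_smul]
  set k := toL2 (freeCubic f₁ f₂ f₃ (lensTime τ))
  have hk : lensLI hc (Real.tan (2 * τ)) k = lensGroup hτ (freeGroup (-lensTime τ) k) := by
    rw [lensGroup_apply, freeGroup_freeGroup, add_neg_cancel, freeGroup_zero]
  rw [hk, lensGroup_neg_lensGroup]
  exact (RCLike.real_smul_eq_coe_smul (K := ℂ) _ _).symm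

end

theorem absConvergent_oscQuartic (f₁ f₂ f₃ f₄ : L2) :
    AbsConvergent (volume.restrict (Set.Icc (-(Real.pi / 4)) (Real.pi / 4)))
      (oscQuartic f₁ f₂ f₃ f₄) := by
  obtain ⟨h1, h2, h3⟩ := absConvergent_freeQuartic f₁ f₂ f₃ f₄
  rw [restrict_Icc_eq]
  refine ⟨?_, ?_, ?_⟩
  · filter_upwards [ae_lensTime h1, ae_restrict_mem measurableSet_lensInterval] with τ hτ hm
    exact integrable_oscQuartic (abs_lt_of_mem_lensInterval hm) hτ
  · refine ((integrableOn_lensTime_iff _).2 h2).congr ?_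
    filter_upwards [ae_restrict_mem measurableSet_lensInterval] with τ hm
    exact (integral_norm_oscQuartic (abs_lt_of_mem_lensInterval hm) f₁ f₂ f₃ f₄).symm
  · refine ((integrableOn_lensTime_iff _).2 h3).congr ?_
    filter_upwards [ae_restrict_mem measurableSet_lensInterval] with τ hm
    exact (integral_oscQuartic (abs_lt_of_mem_lensInterval hm) f₁ f₂ f₃ f₄).symm

theorem integral_integral_oscQuartic (f₁ f₂ f₃ f₄ : L2) :
    ∫ t in Set.Icc (-(Real.pi / 4)) (Real.pi / 4), ∫ x, oscQuartic f₁ f₂ f₃ f₄ t x =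
      ∫ t, ∫ x, freeQuartic f₁ f₂ f₃ f₄ t x := by
  rw [restrict_Icc_eq, ← integral_lensTime]
  exact setIntegral_congr_fun measurableSet_lensInterval fun τ hm =>
    integral_oscQuartic (abs_lt_of_mem_lensInterval hm) f₁ f₂ f₃ f₄

theorem ae_memLp_oscCubic (f₁ f₂ f₃ : L2) :
    ∀ᵐ t ∂(volume.restrict (Set.Icc (-(Real.pi / 4)) (Real.pi / 4))),
      MemLp (oscCubic f₁ f₂ f₃ t) 2 volume := by
  rw [restrict_Icc_eq]
  filter_upwards [ae_lensTime (ae_memLp_freeCubic f₁ f₂ f₃),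
    ae_restrict_mem measurableSet_lensInterval] with τ hτ hm
  exact memLp_oscCubic (abs_lt_of_mem_lensInterval hm) hτ

theorem oscillatorGroup_oscCubic_ae (f₁ f₂ f₃ : L2) :
    (fun τ => (Real.cos (2 * τ) ^ 2)⁻¹ •
      freeGroup (-lensTime τ) (toL2 (freeCubic f₁ f₂ f₃ (lensTime τ))))
      =ᵐ[volume.restrict lensInterval]
      fun τ => oscillatorGroup τ (toL2 (oscCubic f₁ f₂ f₃ τ)) := by
  filter_upwards [ae_lensTime (ae_memLp_freeCubic f₁ f₂ f₃),
    ae_restrict_mem measurableSet_lensInterval] with τ hτ hm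
  exact (oscillatorGroup_toL2_oscCubic (abs_lt_of_mem_lensInterval hm) hτ).symm

theorem integrableOn_oscillatorGroup_oscCubic (f₁ f₂ f₃ : L2) :
    IntegrableOn (fun t => oscillatorGroup t (toL2 (oscCubic f₁ f₂ f₃ t)))
      (Set.Icc (-(Real.pi / 4)) (Real.pi / 4)) volume := by
  rw [IntegrableOn, restrict_Icc_eq]
  exact ((integrableOn_lensTime_iff
    (fun t => freeGroup (-t) (toL2 (freeCubic f₁ f₂ f₃ t)))).2
      (integrable_freeGroup_freeCubic f₁ f₂ f₃)).congr (oscillatorGroup_oscCubic_ae f₁ f₂ f₃)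

theorem integral_oscillatorGroup_oscCubic (f₁ f₂ f₃ : L2) :
    ∫ t in Set.Icc (-(Real.pi / 4)) (Real.pi / 4),
      oscillatorGroup t (toL2 (oscCubic f₁ f₂ f₃ t)) =
      ∫ t, freeGroup (-t) (toL2 (freeCubic f₁ f₂ f₃ t)) := by
  rw [restrict_Icc_eq, ← integral_lensTime]
  exact (integral_congr_ae (oscillatorGroup_oscCubic_ae f₁ f₂ f₃)).symm

end CR
-- The main theorem
theorem mainTheorem3 (f₁ f₂ f₃ f₄ : L2) :
    -- the integrals defining the operator and the form converge absolutely, on all of `L²`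
    (∀ᵐ z : Plane, Integrable
      (fun p : ℝ × Plane => CR.integrandT f₁ f₂ f₃ p.1 p.2 z) volume) ∧
    MemLp (CR.T f₁ f₂ f₃) 2 volume ∧
    Integrable (fun p : ℝ × Plane × Plane =>
      CR.integrandT f₁ f₂ f₃ p.1 p.2.1 p.2.2 * conj (f₄ p.2.2)) volume ∧
    CR.energy f₁ f₂ f₃ f₄ = ∫ lam : ℝ, ∫ x : Plane, ∫ z : Plane,
      CR.integrandT f₁ f₂ f₃ lam x z * conj (f₄ z) ∧
    -- the form in terms of `e^{itΔ}`
    CR.AbsConvergent volume (fun t x =>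
      CR.freeGroup t f₁ x * CR.freeGroup t f₂ x *
        conj (CR.freeGroup t f₃ x) * conj (CR.freeGroup t f₄ x)) ∧
    CR.energy f₁ f₂ f₃ f₄ = 4 * Real.pi * ∫ t : ℝ, ∫ x : Plane,
      CR.freeGroup t f₁ x * CR.freeGroup t f₂ x *
        conj (CR.freeGroup t f₃ x) * conj (CR.freeGroup t f₄ x) ∧
    -- the form in terms of `e^{-itH}`
    CR.AbsConvergent (volume.restrict (Set.Icc (-(Real.pi / 4)) (Real.pi / 4))) (fun t x =>
      CR.oscillatorGroup (-t) f₁ x * CR.oscillatorGroup (-t) f₂ x *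
        conj (CR.oscillatorGroup (-t) f₃ x) * conj (CR.oscillatorGroup (-t) f₄ x)) ∧
    CR.energy f₁ f₂ f₃ f₄ =
      4 * Real.pi * ∫ t in Set.Icc (-(Real.pi / 4)) (Real.pi / 4), ∫ x : Plane,
        CR.oscillatorGroup (-t) f₁ x * CR.oscillatorGroup (-t) f₂ x *
          conj (CR.oscillatorGroup (-t) f₃ x) * conj (CR.oscillatorGroup (-t) f₄ x) ∧
    -- the operator in terms of `e^{itΔ}`, as a Bochner integral in `L²`
    (∀ᵐ t : ℝ, MemLp (fun x => CR.freeGroup t f₁ x * CR.freeGroup t f₂ x *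
      conj (CR.freeGroup t f₃ x)) 2 volume) ∧
    Integrable (fun t : ℝ => CR.freeGroup (-t) (CR.toL2 fun x =>
      CR.freeGroup t f₁ x * CR.freeGroup t f₂ x * conj (CR.freeGroup t f₃ x))) volume ∧
    CR.toL2 (CR.T f₁ f₂ f₃) = (4 * Real.pi : ℂ) • ∫ t : ℝ, CR.freeGroup (-t) (CR.toL2 fun x =>
      CR.freeGroup t f₁ x * CR.freeGroup t f₂ x * conj (CR.freeGroup t f₃ x)) ∧
    -- the operator in terms of `e^{-itH}`, as a Bochner integral in `L²`
    (∀ᵐ t ∂(volume.restrict (Set.Icc (-(Real.pi / 4)) (Real.pi / 4))),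
      MemLp (fun x => CR.oscillatorGroup (-t) f₁ x * CR.oscillatorGroup (-t) f₂ x *
        conj (CR.oscillatorGroup (-t) f₃ x)) 2 volume) ∧
    IntegrableOn (fun t : ℝ => CR.oscillatorGroup t (CR.toL2 fun x =>
      CR.oscillatorGroup (-t) f₁ x * CR.oscillatorGroup (-t) f₂ x *
        conj (CR.oscillatorGroup (-t) f₃ x)))
      (Set.Icc (-(Real.pi / 4)) (Real.pi / 4)) volume ∧
    CR.toL2 (CR.T f₁ f₂ f₃) =
      (4 * Real.pi : ℂ) • ∫ t in Set.Icc (-(Real.pi / 4)) (Real.pi / 4),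
        CR.oscillatorGroup t (CR.toL2 fun x =>
          CR.oscillatorGroup (-t) f₁ x * CR.oscillatorGroup (-t) f₂ x *
            conj (CR.oscillatorGroup (-t) f₃ x)) := by
  have m : ∀ f : L2, Measurable f := CR.measurable_coe
  have l : ∀ f : L2, MemLp f 2 volume := fun f => Lp.memLp f
  have hE : CR.energy f₁ f₂ f₃ f₄ = 4 * Real.pi * ∫ t, ∫ x, CR.freeQuartic f₁ f₂ f₃ f₄ t x := by
    rw [CR.energy_eq_strForm, CR.strForm_eq]
  refine ⟨CR.ae_integrable_integrandT (m f₁) (m f₂) (m f₃) (l f₁) (l f₂) (l f₃),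
    CR.memLp_T (m f₁) (m f₂) (m f₃) (l f₁) (l f₂) (l f₃),
    CR.integrable_integrandE_coe f₁ f₂ f₃ f₄,
    (CR.energy_coe f₁ f₂ f₃ f₄).trans
      (CR.integral_integrandE (CR.integrable_integrandE_coe f₁ f₂ f₃ f₄)),
    CR.absConvergent_freeQuartic f₁ f₂ f₃ f₄, hE, CR.absConvergent_oscQuartic f₁ f₂ f₃ f₄, ?_,
    CR.ae_memLp_freeCubic f₁ f₂ f₃, CR.integrable_freeGroup_freeCubic f₁ f₂ f₃,
    CR.toL2_T_eq f₁ f₂ f₃, CR.ae_memLp_oscCubic f₁ f₂ f₃,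
    CR.integrableOn_oscillatorGroup_oscCubic f₁ f₂ f₃, ?_⟩
  · exact hE.trans (congrArg _ (CR.integral_integral_oscQuartic f₁ f₂ f₃ f₄).symm)
  · exact (CR.toL2_T_eq f₁ f₂ f₃).trans
      (congrArg _ (CR.integral_oscillatorGroup_oscCubic f₁ f₂ f₃).symm)
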